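/- There is a single randomized algorithm (one fixed program, uniform in all parameters) with the following properties. Let $n\ge 1$ be an integer, let $\epsilon,\delta\in(0,1)$ be real numbers, given to the algorithm through the integers $n$, $\lceil 1/\epsilon\rceil$ and $\lceil\log_2(1/\delta)\rceil$, and let $|\psi\rangle\in(\mathbb C^2)^{\otimes n}$ be an unknown unit vector. The algorithm first uses its random bits to choose a list of $N$ Pauli product bases, each specified by an element of $\{X,Y,Z\}^n$ (qubit $j$ is measured in the eigenbasis of the $j$-th Pauli matrix). The whole list is chosen before any measurement takes place (nonadaptively). Then one fresh copy of $|\psi\rangle$ is measured in each chosen basis, and from the outcomes (and possibly further random bits) the algorithm computes a classical description of an estimate $|\hat\psi\rangle$, namely the list of its $2^n$ amplitudes as Gaussian integers, up to normalization. 1. (Copies) There are constants $C,a,b$, independent of $n,\epsilon,\delta,\psi$, such that always $$N\le C\,f\,\bigl(\log(2+f)\bigr)^b,\qquad f=\frac{2^n\,n^a\,\log(2/\delta)}{\epsilon},$$ that is, $N=\widetilde O\bigl(2^n\,\mathrm{poly}(n)\log(2/\delta)/\epsilon\bigr)$. 2. (Time) The total running time, for all random bits and all outcomes, is at most a fixed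 polynomial in $2^n$, $1/\epsilon$ and $\log(2/\delta)$: there are constants $C,c$, independent of $n,\epsilon,\delta,\psi$, with running time at most $C\bigl(2^n\epsilon^{-1}\log(2/\delta)\bigr)^c$. Time is counted in bit operations of a random-access program over the integers with $+,-,\times$, integer division, comparison, branching, counted loops and random bits, where an arithmetic operation on numbers of bit lengths $s,t$ is charged $(1+s)(1+t)$ and accessing a number is charged its bit length. 3. (Correctness) For every $|\psi\rangle$, with probability at least $1-\delta$ over the random bits and the measurement outcomes, $$|\langle\hat\psi|\psi\rangle|^2\ge 1-\epsilon .$$ -/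

import Mathlib

open MeasureTheory

namespace PauliTomography

/-! ## Qubits and Pauli product bases -/

/-- The state space `(ℂ²)^{⊗ n}`, in computational-basis coordinates. -/
abbrev Qubits (n : ℕ) : Type := EuclideanSpace ℂ (Fin n → Bool)

inductive Pauli where
  | X
  | Y
  | Z

/-- Coordinate `x` of the normalized eigenvector of a Pauli matrix that belongs to the outcome `b`
(eigenvalue `+1` for `b = false` and `-1` for `b = true`): `|0⟩, |1⟩` for `Z`,
`(|0⟩ ± |1⟩)/√2` for `X`, and `(|0⟩ ± i|1⟩)/√2` for `Y`. -/
noncomputable def Pauli.eigenvector : Pauli → Bool → Bool → ℂ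
  | .Z, b, x => if x = b then 1 else 0
  | .X, b, x => (if x && b then -1 else 1) / (Real.sqrt 2 : ℂ)
  | .Y, b, x => (if x then (if b then -Complex.I else Complex.I) else 1) / (Real.sqrt 2 : ℂ)

/-- The element with label `o` of the product basis `P 0 ⊗ ⋯ ⊗ P (n-1)`. -/
noncomputable def basisVector {n : ℕ} (P : Fin n → Pauli) (o : Fin n → Bool) : Qubits n :=
  WithLp.toLp 2 fun x => ∏ j, (P j).eigenvector (o j) (x j)

/-- Born probability of the outcome `o` when one copy of `ψ` is measured in the product basis
`P`. -/
noncomputable def bornProb {n : ℕ} (P : Fin n → Pauli) (ψ : Qubits n) (o : Fin n → Bool) : ℝ :=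
  ‖inner ℂ (basisVector P o) ψ‖ ^ 2

/-! ## Programs and their running time

Structured random-access programs over the integers. Memory consists of integer registers and
integer arrays; the only loops are counted loops. Time is counted in bit operations: an arithmetic
operation on `a` and `b` is charged `(1 + |a|) * (1 + |b|)`, where `|·|` is the bit length, and
access to a value is charged its bit length. -/

inductive BinOp where
  | add
  | sub
  | mul
  | div
  | le

def BinOp.eval : BinOp → ℤ → ℤ → ℤ
  | .add, a, b => a + b
  | .sub, a, b => a - b
  | .mul, a, b => a * b
  | .div, a, b => a / b
  | .le, a, b => if a ≤ b then 1 else 0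

inductive Expr where
  | lit (z : ℤ)
  | reg (x : ℕ)
  | arr (a : ℕ) (i : Expr)
  | op (o : BinOp) (e₁ e₂ : Expr)

inductive Cmd where
  /-- register `x` gets the value of `e` -/
  | assign (x : ℕ) (e : Expr)
  /-- cell `i` of the array `a` gets the value of `e` -/
  | store (a : ℕ) (i e : Expr)
  /-- register `x` gets a fresh uniformly random bit -/
  | flip (x : ℕ)
  | seq (c₁ c₂ : Cmd)
  /-- run `c₁` if `e` is nonzero and `c₂` otherwise -/
  | ite (e : Expr) (c₁ c₂ : Cmd)
  /-- with `N` the value of `e` on entry, run `c` for `x = 0, …, N - 1` in turn -/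
  | loop (x : ℕ) (e : Expr) (c : Cmd)

structure State where
  reg : ℕ → ℤ
  arr : ℕ → ℕ → ℤ
  /-- number of random bits consumed so far -/
  coins : ℕ
  /-- running time so far -/
  time : ℕ

/-- Bit length of an integer. -/
def bitLength (z : ℤ) : ℕ := Nat.size z.natAbs

def Expr.eval (s : State) : Expr → ℤ
  | .lit z => z
  | .reg x => s.reg x
  | .arr a i => s.arr a (i.eval s).toNat
  | .op o e₁ e₂ => o.eval (e₁.eval s) (e₂.eval s)

/-- Time needed to evaluate an expression. -/
def Expr.cost (s : State) : Expr → ℕ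
  | .lit z => 1 + bitLength z
  | .reg x => 1 + bitLength (s.reg x)
  | .arr a i => i.cost s + 1 + bitLength (s.arr a (i.eval s).toNat)
  | .op _ e₁ e₂ =>
      e₁.cost s + e₂.cost s + (1 + bitLength (e₁.eval s)) * (1 + bitLength (e₂.eval s))

def State.tick (s : State) (t : ℕ) : State := { s with time := s.time + t }

def State.setReg (s : State) (x : ℕ) (z : ℤ) : State :=
  { s with reg := Function.update s.reg x z }

def State.setArr (s : State) (a i : ℕ) (z : ℤ) : State :=
  { s with arr := Function.update s.arr a (Function.update (s.arr a) i z) }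

/-- `iter f N s = f (N-1) (⋯ (f 1 (f 0 s)))`. -/
def iter {α : Type} (f : ℕ → α → α) : ℕ → α → α
  | 0, s => s
  | k + 1, s => f k (iter f k s)

/-- Execution of a command, where `ω` is the sequence of random bits. -/
def Cmd.exec (ω : ℕ → Bool) : Cmd → State → State
  | .assign x e, s => (s.setReg x (e.eval s)).tick (1 + e.cost s)
  | .store a i e, s =>
      (s.setArr a (i.eval s).toNat (e.eval s)).tick (1 + i.cost s + e.cost s)
  | .flip x, s =>
      ({ s with coins := s.coins + 1 }.setReg x (if ω s.coins then 1 else 0)).tick 1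
  | .seq c₁ c₂, s => c₂.exec ω (c₁.exec ω s)
  | .ite e c₁ c₂, s =>
      if e.eval s ≠ 0 then c₁.exec ω (s.tick (1 + e.cost s))
      else c₂.exec ω (s.tick (1 + e.cost s))
  | .loop x e c, s =>
      iter (fun k s' => c.exec ω ((s'.setReg x k).tick (1 + bitLength k)))
        (e.eval s).toNat (s.tick (1 + e.cost s))

/-! ## Nonadaptive tomography algorithms -/

/-- `sampler` chooses all the measurement bases. Then one fresh copy is measured in each of them,
and `estimator` continues from the memory that `sampler` left, with the outcomes added. -/
structure Algorithm where
  sampler : Cmd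
  estimator : Cmd

/-- Registers `0, 1, 2` hold the number of qubits and the accuracy and confidence parameters; all
other memory is zero. -/
def initial (n K m : ℕ) : State where
  reg x := if x = 0 then n else if x = 1 then K else if x = 2 then m else 0
  arr _ _ := 0
  coins := 0
  time := 0

/-- The memory after all bases have been chosen. -/
def Algorithm.sampled (A : Algorithm) (n K m : ℕ) (ω : ℕ → Bool) : State :=
  A.sampler.exec ω (initial n K m)

/-- The number of chosen bases, which is the number of copies that are measured, is announced in
register `3`. -/
def Algorithm.numBases (A : Algorithm) (n K m : ℕ) (ω : ℕ → Bool) : ℕ :=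
  ((A.sampled n K m ω).reg 3).toNat

def Pauli.ofInt (z : ℤ) : Pauli := if z = 0 then .X else if z = 1 then .Y else .Z

/-- The `i`-th basis occupies the cells `i * n, …, i * n + n - 1` of array `0`. -/
def Algorithm.basis (A : Algorithm) (n K m : ℕ) (ω : ℕ → Bool) (i : ℕ) : Fin n → Pauli :=
  fun j => Pauli.ofInt ((A.sampled n K m ω).arr 0 (i * n + j))

/-- The measurement outcomes are put into array `1`: the bit of qubit `j` in the `i`-th copy goes
to cell `i * n + j`. -/
def State.record {N n : ℕ} (s : State) (o : Fin N → Fin n → Bool) : State :=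
  { s with
    arr := Function.update s.arr 1 fun k =>
      if h : k < N * n then
        (if o (Fin.divNat ⟨k, h⟩) (Fin.modNat ⟨k, h⟩) then 1 else 0)
      else 0 }

/-- The memory at the end of the whole run. -/
def Algorithm.final (A : Algorithm) (n K m : ℕ) (ω : ℕ → Bool)
    (o : Fin (A.numBases n K m ω) → Fin n → Bool) : State :=
  A.estimator.exec ω ((A.sampled n K m ω).record o)

/-- A computational basis label, read as a number in binary. -/
def labelIndex {n : ℕ} (x : Fin n → Bool) : ℕ := ∑ j, if x j then 2 ^ (j : ℕ) else 0

/-- The vector of Gaussian integers in array `2`, with the real and imaginary part of the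
amplitude with number `k` in cells `2 * k` and `2 * k + 1`. -/
noncomputable def outputVector (n : ℕ) (s : State) : Qubits n :=
  WithLp.toLp 2 fun x =>
    (s.arr 2 (2 * labelIndex x) : ℂ) + (s.arr 2 (2 * labelIndex x + 1) : ℂ) * Complex.I

/-- The output state `|ψ̂⟩`: the normalization of the output vector (a unit vector, unless that
vector is `0`). -/
noncomputable def outputState (n : ℕ) (s : State) : Qubits n :=
  ((‖outputVector n s‖ : ℂ)⁻¹) • outputVector n s

/-- Law of an infinite sequence of independent fair bits. -/
noncomputable def coinMeasure : Measure (ℕ → Bool) :=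
  Measure.infinitePi fun _ => (PMF.uniformOfFintype Bool).toMeasure

open Classical in
/-- Probability over the measurement outcomes, given the random bits `ω`, that the output state
has fidelity at least `1 - ε` with `ψ`; each chosen basis is measured on its own copy of `ψ`. -/
noncomputable def Algorithm.successGiven (A : Algorithm) (n K m : ℕ) (ψ : Qubits n) (ε : ℝ)
    (ω : ℕ → Bool) : ℝ :=
  ∑ o : Fin (A.numBases n K m ω) → Fin n → Bool,
    if 1 - ε ≤ ‖inner ℂ (outputState n (A.final n K m ω o)) ψ‖ ^ 2 then
      ∏ i : Fin (A.numBases n K m ω), bornProb (A.basis n K m ω i) ψ (o i)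
    else 0

/-- Probability over random bits and measurement outcomes that the output state has fidelity at
least `1 - ε` with `ψ`. -/
noncomputable def Algorithm.successProb (A : Algorithm) (n K m : ℕ) (ψ : Qubits n) (ε : ℝ) :
    ENNReal :=
  ∫⁻ ω, ENNReal.ofReal (A.successGiven n K m ψ ε ω) ∂coinMeasure

/-- The integer `⌈1/ε⌉` through which the algorithm is told the accuracy `ε`. -/
noncomputable def accuracyParam (ε : ℝ) : ℕ := ⌈1 / ε⌉₊

/-- The integer `⌈log₂(1/δ)⌉` through which the algorithm is told the failure probability `δ`. -/
noncomputable def confidenceParam (δ : ℝ) : ℕ := ⌈Real.logb 2 (1 / δ)⌉₊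

/-- `2 ^ n * n ^ a * log (2/δ) / ε`. -/
noncomputable def copyScale (a n : ℕ) (ε δ : ℝ) : ℝ :=
  2 ^ n * (n : ℝ) ^ a * Real.log (2 / δ) / ε

end PauliTomography

/-!
# Tomography of pure states by nonadaptive Pauli measurements

The labels of the computational basis form a binary tree: the nodes at depth `k` are the residue
classes modulo `2 ^ k`, that is, the possible values of the first `k` bits. For every node, the
estimator constructs a vector `φ` supported on the class, from the leaves up to the root. The loss
at a node is the squared norm of the part of `ψ` on the class that is orthogonal to `φ`; at a leaf
it is `0`, and at the root it is the infidelity of the output.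

At a node of depth `k`, let `u` consist of the inner products of `ψ` with the normalized vectors of
the two children. The best combination of the two vectors has the entries of `u` as coefficients.
The rank one matrix `u u*` is estimated from `R` copies of level `k`, on which the first `k` qubits
are measured in the basis `Z` and the others in uniformly random Pauli bases: the product of the
projectors `|o⟩⟨o|` on the first `k` qubits and of the inverted measurement channels on the
others has, between the two children's vectors, the entries of `u u*` as its mean
(`mean_shadowProd`). The estimator uses the column of the estimated matrix with the larger diagonal
entry. Where `u` is not large compared to the accuracy, the weight of the node is either small or
almost entirely lost already in the children. In all the cases, the loss is at most `1 + 1 / n`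
times the sum of the losses of the children, plus a constant multiple of `(n + 1) ^ 2 * B` with
`B = 2 ^ (n - k) * lam / R` (`loss_combine_le`, `Data.loss_level_le`). Since there are `2 ^ k` nodes
at depth `k`, every level contributes order `n ^ 2 * 2 ^ n * lam / R` to the final loss
(`Data.loss_amplitude_le`).

The dependence of the accuracy on the weight `p` of the node is essential here. The second moment
of an estimate is at most `2 ^ (n - k) * p` (`secondMoment_shadowProd`,
`secondMoment_observable_le`), which follows by induction on the qubits from the fact that a Bloch
vector has length at most one. With Bernstein's inequality (`prob_sum_ge_le_of_indep`), the error is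
of order `√(max p B * B)` except with probability `exp (-lam)`, and a union bound over the nodes
(`prob_not_allAccurate_le`) shows that `lam = n + m + 5` suffices for a failure probability of
order `2 ^ (-m)`. The inequality applies although the vectors of the children are random, because
they depend on the copies of deeper levels only (`Data.amplitude_congr`).

The program works with unnormalized Gaussian integers and therefore makes no rounding errors. Its
numbers have at most about `R * 5 ^ n` digits (`Data.bound_le`), and the rest of the time bound is
the general fact that a program with bounded numbers and loop counts runs in polynomial time
(`Cmd.Safe.time_le`). A uniformly random element of `{X, Y, Z}` cannot be obtained from a fixed
number of fair bits, so that residues modulo `3` of long random numbers are used; this costs a factor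
of `2` in the failure probability (`lintegral_trits_ge`, `one_add_pow_le_two`).
-/

namespace PauliTomography

/-! ### Reasoning about programs -/

/-- Effect of a command on the memory, ignoring the running time. The functional behaviour of a
program is established for `Cmd.run`, and `exec_same` transfers it to `Cmd.exec`. -/
def Cmd.run (ω : ℕ → Bool) : Cmd → State → State
  | .assign x e, s => s.setReg x (e.eval s)
  | .store a i e, s => s.setArr a (i.eval s).toNat (e.eval s)
  | .flip x, s => { s with coins := s.coins + 1 }.setReg x (if ω s.coins then 1 else 0)
  | .seq c₁ c₂, s => c₂.run ω (c₁.run ω s)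
  | .ite e c₁ c₂, s => if e.eval s ≠ 0 then c₁.run ω s else c₂.run ω s
  | .loop x e c, s => iter (fun k s' => c.run ω (s'.setReg x k)) (e.eval s).toNat s

/-- The states agree up to the running time. -/
structure State.Same (s s' : State) : Prop where
  reg : s.reg = s'.reg
  arr : s.arr = s'.arr
  coins : s.coins = s'.coins

theorem State.Same.eval {s s' : State} (h : s.Same s') (e : Expr) : e.eval s = e.eval s' := by
  induction e with
  | lit z => rfl
  | reg x => simp [Expr.eval, h.reg]
  | arr a i ih => simp [Expr.eval, h.arr, ih]
  | op o e₁ e₂ ih₁ ih₂ => simp [Expr.eval, ih₁, ih₂]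

theorem State.Same.setReg {s s' : State} (h : s.Same s') (x : ℕ) (z : ℤ) (t : ℕ) :
    ((s.setReg x z).tick t).Same (s'.setReg x z) := by
  constructor <;> simp [State.setReg, State.tick, h.reg, h.arr, h.coins]

theorem State.Same.tick {s s' : State} (h : s.Same s') (t : ℕ) : (s.tick t).Same s' := by
  constructor <;> simp [State.tick, h.reg, h.arr, h.coins]

theorem exec_same (ω : ℕ → Bool) (c : Cmd) :
    ∀ {s s' : State}, s.Same s' → (c.exec ω s).Same (c.run ω s') := by
  induction c with
  | assign x e =>
    intro s s' h
    simp only [Cmd.exec, Cmd.run, h.eval]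
    exact h.setReg _ _ _
  | store a i e =>
    intro s s' h
    simp only [Cmd.exec, Cmd.run, h.eval]
    constructor <;> simp [State.setArr, State.tick, h.reg, h.arr, h.coins]
  | flip x =>
    intro s s' h
    simp only [Cmd.exec, Cmd.run]
    constructor <;> simp [State.setReg, State.tick, h.reg, h.arr, h.coins]
  | seq c₁ c₂ ih₁ ih₂ =>
    intro s s' h
    exact ih₂ (ih₁ h)
  | ite e c₁ c₂ ih₁ ih₂ =>
    intro s s' h
    simp only [Cmd.exec, Cmd.run, h.eval]
    split_ifs
    · exact ih₁ (h.tick _)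
    · exact ih₂ (h.tick _)
  | loop x e c ih =>
    intro s s' h
    simp only [Cmd.exec, Cmd.run, h.eval]
    generalize (e.eval s').toNat = N
    induction N with
    | zero => exact h.tick _
    | succ N ihN => exact ih (ihN.setReg _ _ _)

/-- A run of the command in which all values written to the memory are at most `V` in absolute
value and every loop is repeated at most `T` times. -/
def Cmd.Safe (ω : ℕ → Bool) (V T : ℕ) : Cmd → State → Prop
  | .assign _ e, s => (e.eval s).natAbs ≤ V
  | .store _ _ e, s => (e.eval s).natAbs ≤ V
  | .flip _, _ => True
  | .seq c₁ c₂, s => c₁.Safe ω V T s ∧ c₂.Safe ω V T (c₁.run ω s)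
  | .ite e c₁ c₂, s => if e.eval s ≠ 0 then c₁.Safe ω V T s else c₂.Safe ω V T s
  | .loop x e c, s => (e.eval s).toNat ≤ T ∧ ∀ k < (e.eval s).toNat,
      c.Safe ω V T ((iter (fun k s' => c.run ω (s'.setReg x k)) k s).setReg x k)

/-- All memory contents are at most `V` in absolute value. -/
structure State.Bdd (V : ℕ) (s : State) : Prop where
  reg : ∀ x, (s.reg x).natAbs ≤ V
  arr : ∀ a i, (s.arr a i).natAbs ≤ V

theorem State.Bdd.setReg {V : ℕ} {s : State} (h : s.Bdd V) (x : ℕ) {z : ℤ} (hz : z.natAbs ≤ V) :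
    (s.setReg x z).Bdd V := by
  refine ⟨fun y => ?_, h.arr⟩
  by_cases hy : y = x
  · subst hy; simpa [State.setReg] using hz
  · simpa [State.setReg, hy] using h.reg y

theorem State.Bdd.setArr {V : ℕ} {s : State} (h : s.Bdd V) (a i : ℕ) {z : ℤ}
    (hz : z.natAbs ≤ V) : (s.setArr a i z).Bdd V := by
  refine ⟨h.reg, fun b j => ?_⟩
  by_cases hb : b = a
  · subst hb
    by_cases hj : j = i
    · subst hj; simpa [State.setArr] using hz
    · simpa [State.setArr, hj] using h.arr b j
  · simpa [State.setArr, hb] using h.arr b j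

theorem State.Same.bdd' {V : ℕ} {s s' : State} (h : s.Same s') (hs : s'.Bdd V) : s.Bdd V :=
  ⟨fun x => h.reg ▸ hs.reg x, fun a i => h.arr ▸ hs.arr a i⟩

/-- A safe run keeps the memory bounded. The bounds `1 ≤ V` and `T ≤ V` take care of the random bits
and of the loop counters, which `Cmd.Safe` does not mention. -/
theorem Cmd.Safe.bdd {ω : ℕ → Bool} {V T : ℕ} (hV : 1 ≤ V) (hT : T ≤ V) (c : Cmd) :
    ∀ {s : State}, c.Safe ω V T s → s.Bdd V → (c.run ω s).Bdd V := by
  induction c with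
  | assign x e => intro s h hs; exact hs.setReg x h
  | store a i e => intro s h hs; exact hs.setArr a _ h
  | flip x =>
    intro s _ hs
    have : State.Bdd V { s with coins := s.coins + 1 } := ⟨hs.reg, hs.arr⟩
    refine this.setReg x ?_
    split_ifs <;> simp [hV]
  | seq c₁ c₂ ih₁ ih₂ => intro s h hs; exact ih₂ h.2 (ih₁ h.1 hs)
  | ite e c₁ c₂ ih₁ ih₂ =>
    intro s h hs
    simp only [Cmd.Safe, Cmd.run] at h ⊢
    split_ifs at h ⊢
    · exact ih₁ h hs
    · exact ih₂ h hs
  | loop x e c ih =>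
    intro s h hs
    obtain ⟨hN, h⟩ := h
    simp only [Cmd.run]
    generalize (e.eval s).toNat = N at h hN
    induction N with
    | zero => exact hs
    | succ N ihN =>
      refine ih (h N (by omega)) ?_
      refine (ihN (fun k hk => h k (by omega)) (by omega)).setReg _ ?_
      simp; omega

/-- A measure of the length of an expression; literals count with their bit length. -/
def Expr.length : Expr → ℕ
  | .lit z => bitLength z + 1
  | .reg _ => 1
  | .arr _ i => i.length + 1
  | .op _ e₁ e₂ => e₁.length + e₂.length + 1

theorem bitLength_le {z : ℤ} {V : ℕ} (h : z.natAbs ≤ V) : bitLength z ≤ V.size :=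
  Nat.size_le_size h

theorem natAbs_lt_two_pow_bitLength (z : ℤ) : z.natAbs < 2 ^ bitLength z := Nat.lt_size_self _

theorem BinOp.bitLength_eval (o : BinOp) (a b : ℤ) :
    bitLength (o.eval a b) ≤ bitLength a + bitLength b + 1 := by
  have ha := natAbs_lt_two_pow_bitLength a
  have hb := natAbs_lt_two_pow_bitLength b
  have h1 : 2 ^ bitLength a ≤ 2 ^ (bitLength a + bitLength b) :=
    Nat.pow_le_pow_right (by norm_num) (by omega)
  have h2 : 2 ^ bitLength b ≤ 2 ^ (bitLength a + bitLength b) :=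
    Nat.pow_le_pow_right (by norm_num) (by omega)
  have h3 : 2 ^ (bitLength a + bitLength b + 1) = 2 * 2 ^ (bitLength a + bitLength b) := by ring
  refine Nat.size_le.2 ?_
  rw [h3]
  cases o with
  | add => have := Int.natAbs_add_le a b; simp only [BinOp.eval]; omega
  | sub => have := Int.natAbs_sub_le a b; simp only [BinOp.eval]; omega
  | mul =>
    simp only [BinOp.eval, Int.natAbs_mul]
    have : a.natAbs * b.natAbs ≤ 2 ^ bitLength a * 2 ^ bitLength b :=
      Nat.mul_le_mul ha.le hb.le
    rw [← pow_add] at this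
    have := Nat.two_pow_pos (bitLength a + bitLength b)
    omega
  | div =>
    have := Int.natAbs_ediv_le_natAbs a b
    simp only [BinOp.eval]
    omega
  | le =>
    have := Nat.two_pow_pos (bitLength a + bitLength b)
    simp only [BinOp.eval]
    split_ifs
    · simp only [Int.natAbs_one]; omega
    · simp

/-- The bit length of the value of an expression is at most its length times that of the memory
contents, because every operation at most adds the bit lengths of its arguments. -/
theorem Expr.bitLength_eval {V : ℕ} {s : State} (hs : s.Bdd V) (e : Expr) :
    bitLength (e.eval s) ≤ e.length * (V.size + 1) := by
  induction e with
  | lit z => simp only [Expr.eval, Expr.length]; nlinarith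
  | reg x => simp only [Expr.eval, Expr.length]; have := bitLength_le (hs.reg x); omega
  | arr a i ih =>
    simp only [Expr.eval, Expr.length]
    have := bitLength_le (hs.arr a (i.eval s).toNat)
    nlinarith
  | op o e₁ e₂ ih₁ ih₂ =>
    simp only [Expr.eval, Expr.length]
    have := o.bitLength_eval (e₁.eval s) (e₂.eval s)
    nlinarith

theorem Expr.cost_le {V : ℕ} {s : State} (hs : s.Bdd V) (e : Expr) :
    e.cost s ≤ 2 * e.length ^ 2 * (V.size + 1) ^ 2 := by
  set B := V.size + 1 with hB
  have hB1 : 1 ≤ B := by omega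
  have hB2 : B ≤ B ^ 2 := by nlinarith
  induction e with
  | lit z =>
    simp only [Expr.cost, Expr.length]
    have : 1 ≤ B ^ 2 := by omega
    nlinarith [Nat.zero_le (bitLength z), sq_nonneg (bitLength z),
      Nat.mul_le_mul_left (2 * (bitLength z + 1) ^ 2) this]
  | reg x =>
    simp only [Expr.cost, Expr.length]
    have := bitLength_le (hs.reg x)
    omega
  | arr a i ih =>
    simp only [Expr.cost, Expr.length]
    have := bitLength_le (hs.arr a (i.eval s).toNat)
    have h : 2 * i.length ^ 2 * B ^ 2 + B ^ 2 ≤ 2 * (i.length + 1) ^ 2 * B ^ 2 := by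
      have : 2 * (i.length + 1) ^ 2 * B ^ 2
        = 2 * i.length ^ 2 * B ^ 2 + B ^ 2 + (4 * i.length + 1) * B ^ 2 := by ring
      omega
    omega
  | op o e₁ e₂ ih₁ ih₂ =>
    simp only [Expr.cost, Expr.length]
    have h₁ := e₁.bitLength_eval hs
    have h₂ := e₂.bitLength_eval hs
    rw [← hB] at h₁ h₂
    have h : (1 + bitLength (e₁.eval s)) * (1 + bitLength (e₂.eval s))
        ≤ ((e₁.length + 1) * B) * ((e₂.length + 1) * B) :=
      Nat.mul_le_mul (by nlinarith) (by nlinarith)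
    have e : 2 * (e₁.length + e₂.length + 1) ^ 2 * B ^ 2
      = 2 * e₁.length ^ 2 * B ^ 2 + 2 * e₂.length ^ 2 * B ^ 2
        + ((e₁.length + 1) * B) * ((e₂.length + 1) * B)
        + (3 * e₁.length * e₂.length + 3 * e₁.length + 3 * e₂.length + 1) * B ^ 2 := by ring
    omega

/-- An upper bound for the number of nested loops. -/
def Cmd.depth : Cmd → ℕ
  | .assign _ _ => 0
  | .store _ _ _ => 0
  | .flip _ => 0
  | .seq c₁ c₂ => c₁.depth + c₂.depth
  | .ite _ c₁ c₂ => c₁.depth + c₂.depth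
  | .loop _ _ c => c.depth + 1

/-- A measure of the length of a command, chosen such that `Cmd.Safe.time_le` holds; the squares
come from `Expr.cost_le`. -/
def Cmd.length : Cmd → ℕ
  | .assign _ e => 1 + 2 * e.length ^ 2
  | .store _ i e => 1 + 2 * i.length ^ 2 + 2 * e.length ^ 2
  | .flip _ => 1
  | .seq c₁ c₂ => c₁.length + c₂.length
  | .ite e c₁ c₂ => 1 + 2 * e.length ^ 2 + c₁.length + c₂.length
  | .loop _ e c => 2 + 2 * e.length ^ 2 + c.length

/-- A safe run takes time polynomial in the number of loop repetitions and the bit length of the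
memory contents, where the exponent and the constant depend on the program only. -/
theorem Cmd.Safe.time_le {ω : ℕ → Bool} {V T : ℕ} (hV : 1 ≤ V) (hT : T ≤ V) (c : Cmd) :
    ∀ {s s' : State}, s.Same s' → c.Safe ω V T s' → s'.Bdd V →
      (c.exec ω s).time ≤ s.time + c.length * (T + 1) ^ c.depth * (V.size + 1) ^ 2 := by
  set B := V.size + 1 with hB
  have hB1 : 1 ≤ B ^ 2 := Nat.one_le_pow _ _ (by omega)
  have hp : ∀ d, 1 ≤ (T + 1) ^ d := fun d => Nat.one_le_pow _ _ (by omega)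
  induction c with
  | assign x e =>
    intro s s' h hsafe hs
    have := e.cost_le (h.bdd' hs)
    rw [← hB] at this
    simp only [Cmd.exec, State.tick, State.setReg, Cmd.length, Cmd.depth]
    have e : (1 + 2 * e.length ^ 2) * (T + 1) ^ 0 * B ^ 2
      = B ^ 2 + 2 * e.length ^ 2 * B ^ 2 := by ring
    omega
  | store a i e =>
    intro s s' h hsafe hs
    have h1 := e.cost_le (h.bdd' hs)
    have h2 := i.cost_le (h.bdd' hs)
    rw [← hB] at h1 h2
    simp only [Cmd.exec, State.tick, State.setArr, Cmd.length, Cmd.depth]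
    have e : (1 + 2 * i.length ^ 2 + 2 * e.length ^ 2) * (T + 1) ^ 0 * B ^ 2
      = B ^ 2 + 2 * i.length ^ 2 * B ^ 2 + 2 * e.length ^ 2 * B ^ 2 := by ring
    omega
  | flip x =>
    intro s s' h hsafe hs
    simp only [Cmd.exec, State.tick, State.setReg, Cmd.length, Cmd.depth, pow_zero, one_mul]
    omega
  | seq c₁ c₂ ih₁ ih₂ =>
    intro s s' h hsafe hs
    have h1 := ih₁ h hsafe.1 hs
    have h2 := ih₂ (exec_same ω c₁ h) hsafe.2 (Cmd.Safe.bdd hV hT c₁ hsafe.1 hs)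
    simp only [Cmd.exec, Cmd.length, Cmd.depth]
    have e1 : c₁.length * (T + 1) ^ c₁.depth * B ^ 2
        ≤ c₁.length * (T + 1) ^ (c₁.depth + c₂.depth) * B ^ 2 := by
      gcongr <;> omega
    have e2 : c₂.length * (T + 1) ^ c₂.depth * B ^ 2
        ≤ c₂.length * (T + 1) ^ (c₁.depth + c₂.depth) * B ^ 2 := by
      gcongr <;> omega
    have e3 : (c₁.length + c₂.length) * (T + 1) ^ (c₁.depth + c₂.depth) * B ^ 2
      = c₁.length * (T + 1) ^ (c₁.depth + c₂.depth) * B ^ 2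
        + c₂.length * (T + 1) ^ (c₁.depth + c₂.depth) * B ^ 2 := by ring
    omega
  | ite e c₁ c₂ ih₁ ih₂ =>
    intro s s' h hsafe hs
    have h1 := e.cost_le (h.bdd' hs)
    rw [← hB] at h1
    simp only [Cmd.exec, Cmd.Safe, Cmd.length, Cmd.depth, h.eval] at hsafe ⊢
    have e1 : c₁.length * (T + 1) ^ c₁.depth * B ^ 2
        ≤ c₁.length * (T + 1) ^ (c₁.depth + c₂.depth) * B ^ 2 := by
      gcongr <;> omega
    have e2 : c₂.length * (T + 1) ^ c₂.depth * B ^ 2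
        ≤ c₂.length * (T + 1) ^ (c₁.depth + c₂.depth) * B ^ 2 := by
      gcongr <;> omega
    have e0 : (1 + 2 * e.length ^ 2) * 1 * B ^ 2
        ≤ (1 + 2 * e.length ^ 2) * (T + 1) ^ (c₁.depth + c₂.depth) * B ^ 2 := by
      gcongr; exact hp _
    have e4 : (1 + 2 * e.length ^ 2) * 1 * B ^ 2 = B ^ 2 + 2 * e.length ^ 2 * B ^ 2 := by ring
    have e3 : (1 + 2 * e.length ^ 2 + c₁.length + c₂.length) *
        (T + 1) ^ (c₁.depth + c₂.depth) * B ^ 2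
      = (1 + 2 * e.length ^ 2) * (T + 1) ^ (c₁.depth + c₂.depth) * B ^ 2
        + c₁.length * (T + 1) ^ (c₁.depth + c₂.depth) * B ^ 2
        + c₂.length * (T + 1) ^ (c₁.depth + c₂.depth) * B ^ 2 := by ring
    split_ifs at hsafe ⊢
    · have := ih₁ (h.tick (1 + e.cost s)) hsafe hs
      simp only [State.tick] at this ⊢
      omega
    · have := ih₂ (h.tick (1 + e.cost s)) hsafe hs
      simp only [State.tick] at this ⊢
      omega
  | loop x e c ih =>
    intro s s' h hsafe hs
    obtain ⟨hN, hsafe⟩ := hsafe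
    have h1 := e.cost_le (h.bdd' hs)
    rw [← hB] at h1
    simp only [Cmd.exec, Cmd.length, Cmd.depth, h.eval]
    generalize (e.eval s').toNat = N at hN hsafe
    -- the loop invariant bounds the time spent so far by `k` times the bound for one repetition
    have key : ∀ k ≤ N,
        (iter (fun k s' => c.exec ω ((s'.setReg x k).tick (1 + bitLength k))) k
          (s.tick (1 + e.cost s))).Same (iter (fun k s' => c.run ω (s'.setReg x k)) k s') ∧
        (iter (fun k s' => c.run ω (s'.setReg x k)) k s').Bdd V ∧
        (iter (fun k s' => c.exec ω ((s'.setReg x k).tick (1 + bitLength k))) k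
          (s.tick (1 + e.cost s))).time ≤ s.time + 1 + e.cost s
            + k * (B + c.length * (T + 1) ^ c.depth * B ^ 2) := by
      intro k
      induction k with
      | zero =>
        intro _
        refine ⟨h.tick _, hs, ?_⟩
        simp only [iter, State.tick]; omega
      | succ k ihk =>
        intro hk
        obtain ⟨a1, a2, a3⟩ := ihk (by omega)
        have hkV : ((k : ℤ)).natAbs ≤ V := by simp; omega
        have b1 := a1.setReg x k (1 + bitLength k)
        have b2 := a2.setReg x hkV
        refine ⟨exec_same ω c b1, Cmd.Safe.bdd hV hT c (hsafe k (by omega)) b2, ?_⟩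
        have b3 := ih b1 (hsafe k (by omega)) b2
        have b4 := bitLength_le hkV
        simp only [iter]
        refine b3.trans ?_
        have : (k + 1) * (B + c.length * (T + 1) ^ c.depth * B ^ 2)
          = k * (B + c.length * (T + 1) ^ c.depth * B ^ 2) + B
            + c.length * (T + 1) ^ c.depth * B ^ 2 := by ring
        have b5 : ∀ (s : State) (z : ℤ) t, ((s.setReg x z).tick t).time = s.time + t :=
          fun _ _ _ => rfl
        rw [this, b5]
        omega
    have k3 := (key N le_rfl).2.2
    refine k3.trans ?_
    have e1 : N * (B + c.length * (T + 1) ^ c.depth * B ^ 2)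
        ≤ T * ((1 + c.length) * (T + 1) ^ c.depth * B ^ 2) := by
      refine Nat.mul_le_mul hN ?_
      have : B * 1 * 1 ≤ B * (T + 1) ^ c.depth * B := by gcongr; exact hp _; omega
      nlinarith
    have e2 : (2 + 2 * e.length ^ 2 + c.length) * (T + 1) ^ (c.depth + 1) * B ^ 2
      = T * ((1 + c.length) * (T + 1) ^ c.depth * B ^ 2)
        + (1 + 2 * e.length ^ 2) * (T + 1) ^ c.depth * B ^ 2 * T
        + (2 + 2 * e.length ^ 2 + c.length) * (T + 1) ^ c.depth * B ^ 2 := by ring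
    have e3 : (1 + 2 * e.length ^ 2) * 1 * B ^ 2
        ≤ (2 + 2 * e.length ^ 2 + c.length) * (T + 1) ^ c.depth * B ^ 2 := by
      exact Nat.mul_le_mul (Nat.mul_le_mul (by omega) (hp _)) le_rfl
    have e4 : (1 + 2 * e.length ^ 2) * 1 * B ^ 2 = B ^ 2 + 2 * e.length ^ 2 * B ^ 2 := by ring
    omega

/-! ### Program logic -/

/-- The run of `c` from `s` is safe and ends in a state with the property `Q`. -/
def Ok (ω : ℕ → Bool) (V T : ℕ) (c : Cmd) (s : State) (Q : State → Prop) : Prop :=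
  c.Safe ω V T s ∧ Q (c.run ω s)

/-- The registers that a command may change. -/
def Cmd.regs : Cmd → List ℕ
  | .assign x _ => [x]
  | .store _ _ _ => []
  | .flip x => [x]
  | .seq c₁ c₂ => c₁.regs ++ c₂.regs
  | .ite _ c₁ c₂ => c₁.regs ++ c₂.regs
  | .loop x _ c => x :: c.regs

/-- The arrays that a command may change. -/
def Cmd.arrs : Cmd → List ℕ
  | .assign _ _ => []
  | .store a _ _ => [a]
  | .flip _ => []
  | .seq c₁ c₂ => c₁.arrs ++ c₂.arrs
  | .ite _ c₁ c₂ => c₁.arrs ++ c₂.arrs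
  | .loop _ _ c => c.arrs

/-- The states agree outside the memory that `c` may change. -/
structure Cmd.Frame (c : Cmd) (s s' : State) : Prop where
  reg : ∀ x, x ∉ c.regs → s'.reg x = s.reg x
  arr : ∀ a, a ∉ c.arrs → s'.arr a = s.arr a

theorem Cmd.Frame.refl (c : Cmd) (s : State) : c.Frame s s := ⟨fun _ _ => rfl, fun _ _ => rfl⟩

/-- A command changes only the memory that occurs in it on the left of an assignment. -/
theorem Cmd.run_frame (ω : ℕ → Bool) (c : Cmd) : ∀ s, c.Frame s (c.run ω s) := by
  induction c with
  | assign x e =>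
    intro s
    refine ⟨fun y hy => ?_, fun _ _ => rfl⟩
    simp only [Cmd.regs, List.mem_singleton] at hy
    simp [Cmd.run, State.setReg, hy]
  | store a i e =>
    intro s
    refine ⟨fun _ _ => rfl, fun b hb => ?_⟩
    simp only [Cmd.arrs, List.mem_singleton] at hb
    simp [Cmd.run, State.setArr, hb]
  | flip x =>
    intro s
    refine ⟨fun y hy => ?_, fun _ _ => rfl⟩
    simp only [Cmd.regs, List.mem_singleton] at hy
    simp [Cmd.run, State.setReg, hy]
  | seq c₁ c₂ ih₁ ih₂ =>
    intro s
    refine ⟨fun y hy => ?_, fun b hb => ?_⟩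
    · simp only [Cmd.regs, List.mem_append, not_or] at hy
      rw [Cmd.run, (ih₂ _).reg y hy.2, (ih₁ _).reg y hy.1]
    · simp only [Cmd.arrs, List.mem_append, not_or] at hb
      rw [Cmd.run, (ih₂ _).arr b hb.2, (ih₁ _).arr b hb.1]
  | ite e c₁ c₂ ih₁ ih₂ =>
    intro s
    refine ⟨fun y hy => ?_, fun b hb => ?_⟩
    · simp only [Cmd.regs, List.mem_append, not_or] at hy
      simp only [Cmd.run]
      split_ifs
      · exact (ih₁ s).reg y hy.1
      · exact (ih₂ s).reg y hy.2
    · simp only [Cmd.arrs, List.mem_append, not_or] at hb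
      simp only [Cmd.run]
      split_ifs
      · exact (ih₁ s).arr b hb.1
      · exact (ih₂ s).arr b hb.2
  | loop x e c ih =>
    intro s
    simp only [Cmd.run]
    generalize (e.eval s).toNat = N
    induction N with
    | zero => exact Cmd.Frame.refl _ _
    | succ N ihN =>
      refine ⟨fun y hy => ?_, fun b hb => ?_⟩
      · rw [iter, ← ihN.reg y hy]
        simp only [Cmd.regs, List.mem_cons, not_or] at hy
        rw [(ih _).reg y hy.2]
        simp [State.setReg, hy.1]
      · rw [iter, ← ihN.arr b hb]
        simp only [Cmd.arrs] at hb
        rw [(ih _).arr b hb]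
        rfl

section Rules

variable {ω : ℕ → Bool} {V T : ℕ} {s : State} {Q Q' : State → Prop}

/-- The rule of consequence, strengthened by the fact that `c` respects its frame. -/
theorem Ok.mono {c : Cmd} (h : Ok ω V T c s Q) (hQ : ∀ s', c.Frame s s' → Q s' → Q' s') :
    Ok ω V T c s Q' :=
  ⟨h.1, hQ _ (c.run_frame ω s) h.2⟩

theorem Ok.assign {x : ℕ} {e : Expr} (hV : (e.eval s).natAbs ≤ V) (h : Q (s.setReg x (e.eval s))) :
    Ok ω V T (.assign x e) s Q :=
  ⟨hV, h⟩

theorem Ok.store {a : ℕ} {i e : Expr} (hV : (e.eval s).natAbs ≤ V)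
    (h : Q (s.setArr a (i.eval s).toNat (e.eval s))) : Ok ω V T (.store a i e) s Q :=
  ⟨hV, h⟩

theorem Ok.seq {c₁ c₂ : Cmd} (h : Ok ω V T c₁ s fun s' => Ok ω V T c₂ s' Q) :
    Ok ω V T (.seq c₁ c₂) s Q :=
  ⟨⟨h.1, h.2.1⟩, h.2.2⟩

theorem Ok.ite {e : Expr} {c₁ c₂ : Cmd} (h₁ : e.eval s ≠ 0 → Ok ω V T c₁ s Q)
    (h₂ : e.eval s = 0 → Ok ω V T c₂ s Q) : Ok ω V T (.ite e c₁ c₂) s Q := by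
  by_cases h : e.eval s = 0
  · have := h₂ h
    exact ⟨by simpa [Cmd.Safe, h] using this.1, by simpa [Cmd.run, h] using this.2⟩
  · have := h₁ h
    exact ⟨by simpa [Cmd.Safe, h] using this.1, by simpa [Cmd.run, h] using this.2⟩

/-- The rule for loops: `I k` is the invariant after `k` repetitions. -/
theorem Ok.loop {x : ℕ} {e : Expr} {c : Cmd} {N : ℕ} (I : ℕ → State → Prop)
    (hN : e.eval s = N) (hT : N ≤ T) (h0 : I 0 s)
    (hstep : ∀ k < N, ∀ s', (Cmd.loop x e c).Frame s s' → I k s' →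
      Ok ω V T c (s'.setReg x k) (I (k + 1)))
    (hQ : ∀ s', (Cmd.loop x e c).Frame s s' → I N s' → Q s') :
    Ok ω V T (.loop x e c) s Q := by
  have hN' : (e.eval s).toNat = N := by simp [hN]
  have key : ∀ k ≤ N, (Cmd.loop x e c).Frame s
      (iter (fun k s' => c.run ω (s'.setReg x k)) k s) ∧
      I k (iter (fun k s' => c.run ω (s'.setReg x k)) k s) := by
    intro k
    induction k with
    | zero => exact fun _ => ⟨Cmd.Frame.refl _ _, h0⟩
    | succ k ih =>
      intro hk
      obtain ⟨h1, h2⟩ := ih (by omega)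
      refine ⟨?_, (hstep k (by omega) _ h1 h2).2⟩
      refine ⟨fun y hy => ?_, fun b hb => ?_⟩
      · rw [iter, ← h1.reg y hy]
        simp only [Cmd.regs, List.mem_cons, not_or] at hy
        rw [(c.run_frame ω _).reg y hy.2]
        simp [State.setReg, hy.1]
      · rw [iter, ← h1.arr b hb]
        simp only [Cmd.arrs] at hb
        rw [(c.run_frame ω _).arr b hb]
        rfl
  refine ⟨⟨hN' ▸ hT, fun k hk => ?_⟩, ?_⟩
  · rw [hN'] at hk
    exact (hstep k hk _ (key k hk.le).1 (key k hk.le).2).1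
  · simp only [Cmd.run, hN']
    exact hQ _ (key N le_rfl).1 (key N le_rfl).2

end Rules

-- The usual notation for the expressions of the programming language; `/` is integer division.
instance : Add Expr := ⟨.op .add⟩
instance : Sub Expr := ⟨.op .sub⟩
instance : Mul Expr := ⟨.op .mul⟩
instance : Div Expr := ⟨.op .div⟩

/-- Remainder of the integer division. -/
def Expr.mod (a b : Expr) : Expr := a - a / b * b

/-- `1` if the two values are equal and `0` otherwise. -/
def Expr.eq (a b : Expr) : Expr := .op .le a b * .op .le b a

section Eval

variable (s : State) (a b : Expr)

@[simp] theorem Expr.eval_add : (a + b).eval s = a.eval s + b.eval s := rfl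
@[simp] theorem Expr.eval_sub : (a - b).eval s = a.eval s - b.eval s := rfl
@[simp] theorem Expr.eval_mul : (a * b).eval s = a.eval s * b.eval s := rfl
@[simp] theorem Expr.eval_div : (a / b).eval s = a.eval s / b.eval s := rfl
@[simp] theorem Expr.eval_lit (z : ℤ) : (Expr.lit z).eval s = z := rfl
@[simp] theorem Expr.eval_reg (x : ℕ) : (Expr.reg x).eval s = s.reg x := rfl
@[simp] theorem Expr.eval_arr (x : ℕ) : (Expr.arr x a).eval s = s.arr x (a.eval s).toNat := rfl
@[simp] theorem Expr.eval_le :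
    (Expr.op .le a b).eval s = if a.eval s ≤ b.eval s then 1 else 0 := rfl

@[simp] theorem Expr.eval_mod : (a.mod b).eval s = a.eval s % b.eval s := by
  simp only [Expr.mod, Expr.eval_sub, Expr.eval_mul, Expr.eval_div]
  rw [Int.emod_def, mul_comm]

@[simp] theorem Expr.eval_eq : (a.eq b).eval s = if a.eval s = b.eval s then 1 else 0 := by
  simp only [Expr.eq, Expr.eval_mul, Expr.eval_le]
  split_ifs <;> first | rfl | omega

@[simp] theorem State.setReg_reg (x y : ℕ) (z : ℤ) :
    (s.setReg x z).reg y = if y = x then z else s.reg y := by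
  simp [State.setReg, Function.update_apply]

@[simp] theorem State.setReg_arr (x : ℕ) (z : ℤ) : (s.setReg x z).arr = s.arr := rfl

@[simp] theorem State.setReg_coins (x : ℕ) (z : ℤ) : (s.setReg x z).coins = s.coins := rfl

@[simp] theorem State.setArr_reg (x i : ℕ) (z : ℤ) : (s.setArr x i z).reg = s.reg := rfl

@[simp] theorem State.setArr_coins (x i : ℕ) (z : ℤ) : (s.setArr x i z).coins = s.coins := rfl

@[simp] theorem State.setArr_arr (x i y j : ℕ) (z : ℤ) :
    (s.setArr x i z).arr y j = if y = x ∧ j = i then z else s.arr y j := by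
  by_cases h : y = x
  · subst h; by_cases hj : j = i <;> simp [State.setArr, hj]
  · simp [State.setArr, h]

end Eval

/-! ### The sampling program -/

/-- Number of copies that are measured per level. The factor `n + m + 5` pays for the union bound
over the nodes of the tree and for the failure probability; the factor `1536 * (n + 1) ^ 3` is the
one in `Data.loss_amplitude_le`. -/
def perLevel (n K m : ℕ) : ℕ := 1536 * (n + 1) ^ 3 * 2 ^ n * (n + m + 5) * K

/-- The integer with binary digits `ω a, …, ω (a + t - 1)`, the lowest one first. -/
def coinValue (ω : ℕ → Bool) (a t : ℕ) : ℕ :=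
  ∑ c ∈ Finset.range t, if ω (a + c) then 2 ^ c else 0

/-- Content of cell `q` of array `0` after the sampling: cell `q` belongs to qubit `q % n` of copy
`q / n`, which has level `q / n / R`; every cell consumes `t` random bits. -/
def cellValue (n R t : ℕ) (ω : ℕ → Bool) (q : ℕ) : ℤ :=
  if q % n < q / n / R then 2 else ((coinValue ω (t * q) t % 3 : ℕ) : ℤ)

theorem coinValue_succ (ω : ℕ → Bool) (a t : ℕ) :
    coinValue ω a (t + 1) = coinValue ω a t + if ω (a + t) then 2 ^ t else 0 :=
  Finset.sum_range_succ _ _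

theorem coinValue_lt (ω : ℕ → Bool) (a t : ℕ) : coinValue ω a t < 2 ^ t := by
  induction t with
  | zero => simp [coinValue]
  | succ t ih => rw [coinValue_succ, pow_succ]; split_ifs <;> omega

/-- Fills array `4` with the powers of two up to `2 ^ n`. -/
def powersCmd : Cmd :=
  .seq (.store 4 (.lit 0) (.lit 1))
    (.loop 4 (.reg 0) (.store 4 (.reg 4 + .lit 1) (.lit 2 * .arr 4 (.reg 4))))

/-- Evaluates to `perLevel`, with `2 ^ n` read from array `4`. -/
def perLevelExpr : Expr :=
  .lit 1536 * ((.reg 0 + .lit 1) * (.reg 0 + .lit 1) * (.reg 0 + .lit 1)) * .arr 4 (.reg 0) *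
    (.reg 0 + .reg 2 + .lit 5) * .reg 1

/-- Appends one random bit to the number in register `8`; register `9` holds the power of two that
belongs to the position of the bit. -/
def coinCmd : Cmd :=
  .seq (.flip 11) (.seq (.assign 8 (.reg 8 + .reg 9 * .reg 11)) (.assign 9 (.lit 2 * .reg 9)))

/-- Chooses the entry of array `0` whose index is in register `7`. -/
def cellCmd : Cmd :=
  .seq (.assign 8 (.lit 0)) <| .seq (.assign 9 (.lit 1)) <| .seq (.loop 10 (.reg 6) coinCmd) <|
    .ite (.op .le (Expr.mod (.reg 7) (.reg 0) + .lit 1) (.reg 7 / .reg 0 / .reg 5))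
      (.store 0 (.reg 7) (.lit 2))
      (.store 0 (.reg 7) (Expr.mod (.reg 8) (.lit 3)))

/-- Chooses all bases. Register `5` gets the number of copies per level, register `3` the number of
copies, and register `6` the number of cells, which is also the number of random bits per cell. -/
def samplerCmd : Cmd :=
  .seq powersCmd <| .seq (.assign 5 perLevelExpr) <| .seq (.assign 3 (.reg 0 * .reg 5)) <|
    .seq (.assign 6 (.reg 3 * .reg 0)) (.loop 7 (.reg 6) cellCmd)

section

variable {ω : ℕ → Bool} {V T : ℕ} {s : State}

theorem powersCmd_ok {n : ℕ} (hs : s.reg 0 = n) (hT : n ≤ T) (hV : 2 ^ n ≤ V) :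
    Ok ω V T powersCmd s fun s' => s'.coins = s.coins ∧ ∀ l ≤ n, s'.arr 4 l = 2 ^ l := by
  have h1 : 1 ≤ V := Nat.one_le_two_pow.trans hV
  refine Ok.seq (Ok.store (by simpa using h1) ?_)
  refine Ok.loop (N := n) (fun k s' => s'.coins = s.coins ∧ ∀ l ≤ k, s'.arr 4 l = 2 ^ l)
    (by simp [hs]) hT ?_ ?_ ?_
  · refine ⟨rfl, fun l hl => ?_⟩
    obtain rfl : l = 0 := by omega
    simp
  · rintro k hk s' - ⟨hc, hI⟩
    have hk' : s'.arr 4 k = 2 ^ k := hI k le_rfl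
    refine Ok.store ?_ ?_
    · simp only [Expr.eval_mul, Expr.eval_lit, Expr.eval_arr, Expr.eval_reg, State.setReg_reg,
        if_true, Int.toNat_natCast, State.setReg_arr, hk']
      have : ((2 : ℤ) * 2 ^ k).natAbs = 2 ^ (k + 1) := by
        rw [pow_succ, mul_comm, Int.natAbs_mul, Int.natAbs_pow]; rfl
      rw [this]
      exact (Nat.pow_le_pow_right (by norm_num) hk).trans hV
    · refine ⟨hc, fun l hl => ?_⟩
      have e : ((k : ℤ) + 1).toNat = k + 1 := by omega
      simp only [State.setArr_arr, Expr.eval_mul, Expr.eval_lit, Expr.eval_arr, Expr.eval_reg,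
        Expr.eval_add, State.setReg_reg, if_true, Int.toNat_natCast, State.setReg_arr, hk',
        true_and, e]
      split_ifs with h
      · rw [h, pow_succ, mul_comm]
      · exact hI l (by omega)
  · exact fun s' _ h => h

theorem perLevelExpr_eval {n K m : ℕ} (h0 : s.reg 0 = n) (h1 : s.reg 1 = K) (h2 : s.reg 2 = m)
    (h4 : s.arr 4 n = 2 ^ n) : perLevelExpr.eval s = perLevel n K m := by
  simp only [perLevelExpr, Expr.eval_mul, Expr.eval_lit, Expr.eval_arr, Expr.eval_reg,
    Expr.eval_add, h0, h1, h2, h4, Int.toNat_natCast, perLevel]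
  push_cast
  ring

/-- The invariant of the inner loop: after `c` flips, register `8` holds the number with the first
`c` bits of the block, and register `9` holds `2 ^ c`. -/
theorem cellCmd_ok {n R t q : ℕ} (h0 : s.reg 0 = n) (h5 : s.reg 5 = R) (h6 : s.reg 6 = t)
    (h7 : s.reg 7 = q) (hc : s.coins = t * q) (hT : t ≤ T) (hV : 2 ^ t ≤ V) (hV2 : 2 ≤ V) :
    Ok ω V T cellCmd s fun s' => s'.coins = t * (q + 1) ∧
      s'.arr 0 = Function.update (s.arr 0) q (cellValue n R t ω q) := by
  refine Ok.seq (Ok.assign (by simp) (Ok.seq (Ok.assign (by simp; omega) (Ok.seq ?_))))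
  refine Ok.loop (N := t) (fun c s' => s'.coins = t * q + c ∧
    s'.reg 8 = coinValue ω (t * q) c ∧ s'.reg 9 = 2 ^ c) (by simp [h6]) hT ?_ ?_ ?_
  · simp [hc, coinValue]
  · rintro c hc s' - ⟨i1, i2, i3⟩
    have hpow : 2 ^ (c + 1) ≤ V := (Nat.pow_le_pow_right (by norm_num) hc).trans hV
    have hval := coinValue_lt ω (t * q) (c + 1)
    have e1 : ((coinValue ω (t * q) c : ℤ) + 2 ^ c * (if ω (t * q + c) then 1 else 0))
        = coinValue ω (t * q) (c + 1) := by
      rw [coinValue_succ]; split_ifs <;> push_cast <;> ring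
    refine Ok.seq ⟨trivial, ?_⟩
    simp only [Cmd.run]
    refine Ok.seq (Ok.assign ?_ (Ok.assign ?_ ?_))
    · simp only [State.setReg_coins, Expr.eval_add, Expr.eval_reg, State.setReg_reg,
        Nat.reduceEqDiff, if_false, i2, Expr.eval_mul, i3, if_true, i1, e1]
      simp; omega
    · simp only [Expr.eval_mul, Expr.eval_lit, Expr.eval_reg, State.setReg_reg, Nat.reduceEqDiff,
        if_false, i3]
      have : ((2 : ℤ) * 2 ^ c).natAbs = 2 ^ (c + 1) := by
        rw [pow_succ, mul_comm, Int.natAbs_mul, Int.natAbs_pow]; rfl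
      rw [this]; exact hpow
    · refine ⟨?_, ?_, ?_⟩
      · simp [i1]; ring
      · simp only [State.setReg_coins, Expr.eval_add, Expr.eval_reg, State.setReg_reg,
          Nat.reduceEqDiff, if_false, i2, Expr.eval_mul, i3, if_true, i1, e1]
      · simp [i3, pow_succ, mul_comm]
  · rintro s' hf ⟨i1, i2, i3⟩
    have g0 : s'.reg 0 = n := by rw [hf.reg 0 (by decide)]; simpa using h0
    have g5 : s'.reg 5 = R := by rw [hf.reg 5 (by decide)]; simpa using h5
    have g7 : s'.reg 7 = q := by rw [hf.reg 7 (by decide)]; simpa using h7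
    have ga : s'.arr 0 = s.arr 0 := by rw [hf.arr 0 (by decide)]; simp
    have hcond : ((q : ℤ) % n + 1 ≤ (q : ℤ) / n / R) ↔ q % n < q / n / R := by
      rw [Int.add_one_le_iff]; exact_mod_cast Iff.rfl
    refine Ok.ite ?_ ?_
    · intro h
      simp only [Expr.eval_le, Expr.eval_add, Expr.eval_mod, Expr.eval_reg, Expr.eval_div,
        Expr.eval_lit, g0, g5, g7, hcond, ne_eq, ite_eq_right_iff, one_ne_zero,
        imp_false, not_not] at h
      refine Ok.store (by simpa using hV2) ⟨by simp [i1]; ring, ?_⟩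
      simp only [State.setArr, Function.update_self, Expr.eval_reg, g7, Int.toNat_natCast, ga,
        Expr.eval_lit]
      simp [cellValue, h]
    · intro h
      simp only [Expr.eval_le, Expr.eval_add, Expr.eval_mod, Expr.eval_reg, Expr.eval_div,
        Expr.eval_lit, g0, g5, g7, hcond, ite_eq_right_iff, one_ne_zero,
        imp_false] at h
      have e2 : (Expr.mod (.reg 8) (.lit 3)).eval s' = ((coinValue ω (t * q) t % 3 : ℕ) : ℤ) := by
        simp [i2]
      refine Ok.store (by rw [e2]; simp; omega) ⟨by simp [i1]; ring, ?_⟩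
      rw [e2]
      simp only [State.setArr, Function.update_self, Expr.eval_reg, g7, Int.toNat_natCast, ga]
      simp only [cellValue, h, if_false]

/-- The memory after the sampling. -/
structure Sampled (n K m : ℕ) (ω : ℕ → Bool) (s : State) : Prop where
  reg0 : s.reg 0 = n
  reg3 : s.reg 3 = (n * perLevel n K m : ℕ)
  reg5 : s.reg 5 = perLevel n K m
  pow : ∀ l ≤ n, s.arr 4 l = 2 ^ l
  cell : ∀ q < n * perLevel n K m * n, s.arr 0 q =
    cellValue n (perLevel n K m) (n * perLevel n K m * n) ω q
  out : s.arr 2 = 0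

theorem le_perLevel (n K m : ℕ) (hK : 1 ≤ K) : 2 ^ n ≤ perLevel n K m := by
  have : 1 * 2 ^ n * 1 * 1 ≤ 1536 * (n + 1) ^ 3 * 2 ^ n * (n + m + 5) * K := by
    gcongr
    · have := Nat.one_le_pow 3 (n + 1) (by omega); omega
    · omega
  simpa [perLevel] using this

theorem samplerCmd_ok {n K m : ℕ} (hn : 1 ≤ n) (hK : 1 ≤ K)
    (hT : n * perLevel n K m * n ≤ T) (hV : 2 ^ (n * perLevel n K m * n) ≤ V) :
    Ok ω V T samplerCmd (initial n K m) (Sampled n K m ω) := by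
  set R := perLevel n K m with hR
  have hR1 : 2 ^ n ≤ R := le_perLevel n K m hK
  have hn2 : n < 2 ^ n := Nat.lt_two_pow_self
  set t := n * R * n with ht
  have hRt : n * R ≤ t := Nat.le_mul_of_pos_right _ hn
  have hRt' : R ≤ n * R := Nat.le_mul_of_pos_left _ hn
  have htV : t < V := Nat.lt_two_pow_self.trans_le hV
  refine Ok.seq ((powersCmd_ok (n := n) (by simp [initial]) (by omega) (by omega)).mono ?_)
  rintro s hf ⟨hc, hpow⟩
  have h0 : s.reg 0 = n := by rw [hf.reg 0 (by decide)]; simp [initial]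
  have h1 : s.reg 1 = K := by rw [hf.reg 1 (by decide)]; simp [initial]
  have h2 : s.reg 2 = m := by rw [hf.reg 2 (by decide)]; simp [initial]
  have ha : s.arr 2 = 0 := by rw [hf.arr 2 (by decide)]; rfl
  replace hc : s.coins = 0 := hc
  have e5 := perLevelExpr_eval h0 h1 h2 (hpow n le_rfl)
  refine Ok.seq (Ok.assign (by rw [e5]; simp; omega) ?_)
  rw [e5]
  rw [← hR] at e5 ⊢
  refine Ok.seq (Ok.assign ?_ ?_)
  · simp [h0, Int.natAbs_mul]; omega
  refine Ok.seq (Ok.assign ?_ ?_)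
  · simp [h0, Int.natAbs_mul]; rw [← ht]; omega
  refine Ok.loop (N := t) (fun k s' => s'.coins = t * k ∧ ∀ q < k, s'.arr 0 q = cellValue n R t ω q)
    (by simp [h0, ht]) hT ?_ ?_ ?_
  · simp [hc]
  · rintro k hk s' hf' ⟨i1, i2⟩
    refine (cellCmd_ok (n := n) (R := R) (t := t) (q := k) ?_ ?_ ?_ (by simp) (by simpa using i1)
      hT hV (by omega)).mono ?_
    · simp [hf'.reg 0 (by decide), h0]
    · simp [hf'.reg 5 (by decide)]
    · simp [hf'.reg 6 (by decide), h0, ht]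
    · rintro s'' - ⟨j1, j2⟩
      refine ⟨j1, fun q hq => ?_⟩
      rw [j2, Function.update_apply]
      split_ifs with h
      · rw [h]
      · exact i2 q (by omega)
  · rintro s' hf' ⟨-, i2⟩
    constructor
    · simp [hf'.reg 0 (by decide), h0]
    · simp [hf'.reg 3 (by decide), h0, ← hR]
    · simp [hf'.reg 5 (by decide), ← hR]
    · intro l hl
      simp [hf'.arr 4 (by decide), hpow l hl]
    · exact i2
    · simp [hf'.arr 2 (by decide), ha]

end

/-! ### The estimator as a function of the data -/

/-- Binary digit `l` of `y`, the lowest one being digit `0`. -/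
def digit (y l : ℕ) : ℤ := ((y / 2 ^ l % 2 : ℕ) : ℤ)

/-- Matrix entry `(a, b)` of the factor that qubit `l` contributes to the level `k` estimator when
the outcome `o` is observed in the basis `P`: the projector `|o⟩⟨o|` if `l < k`, and otherwise the
matrix `1 + 3 (-1) ^ o P`, which is twice the inverse of the measurement channel applied to the
observed eigenprojector. -/
def entry (k l : ℕ) (P o a b : ℤ) : GaussianInt :=
  if l < k then ⟨if a = o ∧ b = o then 1 else 0, 0⟩
  else ⟨(if a = b then 1 else 0) + 3 * (1 - 2 * o) * ((if P = 0 then 1 else 0) *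
      (1 - if a = b then 1 else 0) + (if P = 2 then 1 else 0) * (if a = b then 1 else 0) *
      (1 - 2 * a)),
    (if P = 1 then 1 else 0) * (3 * (1 - 2 * o) * (a - b))⟩

/-- The input of the estimator: `R` copies per level on `n` qubits, and the arrays with the bases
and the outcomes. The copies `k * R, …, k * R + R - 1` belong to level `k`; there, the qubits below
`k` are measured in the basis `Z` and the others in random bases. -/
structure Data where
  n : ℕ
  R : ℕ
  basis : ℕ → ℤ
  outcome : ℕ → ℤ

namespace Data

variable (D : Data)

/-- Entry `(y, y')` of the level `k` estimator for the density matrix that comes from copy `c`. -/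
def weight (k c y y' : ℕ) : GaussianInt :=
  ∏ l ∈ Finset.range D.n,
    entry k l (D.basis (c * D.n + l)) (D.outcome (c * D.n + l)) (digit y l) (digit y' l)

/-- The summand of `gram` that belongs to copy `i` of level `k`. -/
def gramTerm (Φ : ℕ → GaussianInt) (k r r' i y y' : ℕ) : GaussianInt :=
  if y % 2 ^ (k + 1) = r ∧ y' % 2 ^ (k + 1) = r' then
    star (Φ y) * Φ y' * D.weight k (k * D.R + i) y y' else 0

/-- Estimate, up to the factor `R * 2 ^ (n - k)`, of `⟨φ|ψ⟩⟨ψ|φ'⟩`, where `φ` and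
`φ'` are the restrictions of `Φ` to the residue classes `r` and `r'` modulo `2 ^ (k + 1)`. -/
def gram (Φ : ℕ → GaussianInt) (k r r' : ℕ) : GaussianInt :=
  ∑ i ∈ Finset.range D.R, ∑ y ∈ Finset.range (2 ^ D.n), ∑ y' ∈ Finset.range (2 ^ D.n),
    D.gramTerm Φ k r r' i y y'

/-- Squared norm of the restriction of `Φ` to a residue class modulo `2 ^ (k + 1)`. -/
def mass (Φ : ℕ → GaussianInt) (k q : ℕ) : ℤ :=
  ∑ y ∈ Finset.range (2 ^ D.n), if y % 2 ^ (k + 1) = q then (Φ y).norm else 0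

/-- The two classes modulo `2 ^ (k + 1)` that make up the class of `z` modulo `2 ^ k`. -/
def half (b : ℕ) (k z : ℕ) : ℕ := z % 2 ^ k + b * 2 ^ k

/-- The column of the `2 × 2` matrix of estimates that is used for the combination: the one whose
diagonal entry is larger after normalization. -/
def pivot (Φ : ℕ → GaussianInt) (k z : ℕ) : ℕ :=
  if (D.gram Φ k (half 1 k z) (half 1 k z)).re * D.mass Φ k (half 0 k z) ≤
      (D.gram Φ k (half 0 k z) (half 0 k z)).re * D.mass Φ k (half 1 k z) then half 0 k z
  else half 1 k z

/-- The factor by which amplitude `z` is multiplied at level `k`: the entry of the chosen column,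
times the squared norm of `Φ` on the other half. The latter takes the place of dividing by the
squared norm of `Φ` on the half of `z`, so that the arithmetic stays within the Gaussian integers.
The factor is `1` if the chosen diagonal entry is not positive, so that the amplitudes never vanish
on a whole class. -/
def coef (Φ : ℕ → GaussianInt) (k z : ℕ) : GaussianInt :=
  if 1 ≤ (D.gram Φ k (D.pivot Φ k z) (D.pivot Φ k z)).re then
    D.gram Φ k (z % 2 ^ (k + 1)) (D.pivot Φ k z) *
      (D.mass Φ k (if z % 2 ^ (k + 1) = half 0 k z then half 1 k z else half 0 k z) : ℤ)
  else 1

/-- The amplitudes after `h` levels, starting with the level of the last qubit. -/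
def amplitude : ℕ → ℕ → GaussianInt
  | 0, _ => 1
  | h + 1, z => amplitude h z * D.coef (amplitude h) (D.n - 1 - h) z

end Data

/-- The sum of the absolute values of the real and the imaginary part. Being subadditive and
submultiplicative, it bounds the intermediate values of the estimator. -/
def absSum (g : GaussianInt) : ℕ := g.re.natAbs + g.im.natAbs

theorem absSum_add_le (g h : GaussianInt) : absSum (g + h) ≤ absSum g + absSum h := by
  simp only [absSum, Zsqrtd.re_add, Zsqrtd.im_add]; omega

theorem absSum_mul_le (g h : GaussianInt) : absSum (g * h) ≤ absSum g * absSum h := by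
  simp only [absSum, Zsqrtd.re_mul, Zsqrtd.im_mul]
  have h1 := Int.natAbs_add_le (g.re * h.re) (-1 * g.im * h.im)
  have h2 := Int.natAbs_add_le (g.re * h.im) (g.im * h.re)
  simp only [Int.natAbs_mul, Int.natAbs_neg, Int.natAbs_one, one_mul] at h1 h2
  nlinarith

theorem absSum_star (g : GaussianInt) : absSum (star g) = absSum g := by simp [absSum]

theorem absSum_sum_le {ι : Type*} (s : Finset ι) (f : ι → GaussianInt) :
    absSum (∑ i ∈ s, f i) ≤ ∑ i ∈ s, absSum (f i) :=
  Finset.le_sum_of_subadditive absSum (by simp [absSum]) absSum_add_le s f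

theorem absSum_prod_le {ι : Type*} (s : Finset ι) (f : ι → GaussianInt) :
    absSum (∏ i ∈ s, f i) ≤ ∏ i ∈ s, absSum (f i) :=
  Finset.le_prod_of_submultiplicative absSum (by simp [absSum]) absSum_mul_le s f

theorem norm_natAbs_le (g : GaussianInt) : g.norm.natAbs ≤ absSum g * absSum g := by
  simp only [absSum, Zsqrtd.norm_def]
  have h1 := Int.natAbs_sub_le (g.re * g.re) (-1 * g.im * g.im)
  simp only [Int.natAbs_mul, Int.natAbs_neg, Int.natAbs_one, one_mul] at h1
  nlinarith [Nat.zero_le (g.re.natAbs * g.im.natAbs)]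

theorem digit_eq (y l : ℕ) : digit y l = 0 ∨ digit y l = 1 := by
  unfold digit; have := Nat.mod_two_eq_zero_or_one (y / 2 ^ l); omega

theorem absSum_entry_le {k l : ℕ} {P o a b : ℤ} (ho : o = 0 ∨ o = 1) (ha : a = 0 ∨ a = 1)
    (hb : b = 0 ∨ b = 1) : absSum (entry k l P o a b) ≤ 8 := by
  unfold entry absSum
  rcases ho with rfl | rfl <;> rcases ha with rfl | rfl <;> rcases hb with rfl | rfl <;>
    split_ifs <;> simp_all

namespace Data

variable {D : Data}

/-- Outcomes are bits. -/
def Valid (D : Data) : Prop := ∀ q, D.outcome q = 0 ∨ D.outcome q = 1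

/-- All partial products of a weight are bounded; these are the intermediate values in the
program. -/
theorem absSum_partial_le (hD : D.Valid) (k c y y' j : ℕ) :
    absSum (∏ l ∈ Finset.range j, entry k l (D.basis (c * D.n + l)) (D.outcome (c * D.n + l))
      (digit y l) (digit y' l)) ≤ 8 ^ j := by
  refine (absSum_prod_le _ _).trans ?_
  calc _ ≤ ∏ l ∈ Finset.range j, 8 :=
        Finset.prod_le_prod' fun l _ => absSum_entry_le (hD _) (digit_eq _ _) (digit_eq _ _)
    _ = 8 ^ j := by simp

theorem absSum_gramTerm_le (hD : D.Valid) {Φ : ℕ → GaussianInt} {M : ℕ}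
    (hΦ : ∀ y < 2 ^ D.n, absSum (Φ y) ≤ M) {y y' : ℕ} (hy : y < 2 ^ D.n) (hy' : y' < 2 ^ D.n)
    (k r r' i : ℕ) : absSum (D.gramTerm Φ k r r' i y y') ≤ M * M * 8 ^ D.n := by
  unfold gramTerm
  split_ifs
  · refine (absSum_mul_le _ _).trans (Nat.mul_le_mul ?_ (absSum_partial_le hD _ _ _ _ _))
    refine (absSum_mul_le _ _).trans (Nat.mul_le_mul ?_ (hΦ _ hy'))
    rw [absSum_star]; exact hΦ _ hy
  · simp [absSum]

theorem absSum_gram_le (hD : D.Valid) {Φ : ℕ → GaussianInt} {M : ℕ}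
    (hΦ : ∀ y < 2 ^ D.n, absSum (Φ y) ≤ M) (k r r' : ℕ) :
    absSum (D.gram Φ k r r') ≤ D.R * (2 ^ D.n * (2 ^ D.n * (M * M * 8 ^ D.n))) := by
  unfold gram
  refine (absSum_sum_le _ _).trans ((Finset.sum_le_card_nsmul _ _ _ fun i _ =>
    (absSum_sum_le _ _).trans ((Finset.sum_le_card_nsmul _ _ _ fun y hy =>
    (absSum_sum_le _ _).trans (Finset.sum_le_card_nsmul _ _ _ fun y' hy' =>
      absSum_gramTerm_le hD hΦ (Finset.mem_range.1 hy) (Finset.mem_range.1 hy')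
        _ _ _ _)))).trans ?_)
  simp

theorem natAbs_mass_le {Φ : ℕ → GaussianInt} {M : ℕ}
    (hΦ : ∀ y < 2 ^ D.n, absSum (Φ y) ≤ M) (k q : ℕ) :
    (D.mass Φ k q).natAbs ≤ 2 ^ D.n * (M * M) := by
  unfold mass
  refine (Int.natAbs_sum_le _ _).trans ?_
  have : ∀ y ∈ Finset.range (2 ^ D.n),
      (if y % 2 ^ (k + 1) = q then (Φ y).norm else 0).natAbs ≤ M * M := by
    intro y hy
    have := hΦ y (Finset.mem_range.1 hy)
    split_ifs
    · exact (norm_natAbs_le _).trans (Nat.mul_le_mul this this)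
    · simp
  simpa using Finset.sum_le_card_nsmul _ _ _ this

/-- How the bound for the amplitudes grows at each level. -/
def growth (D : Data) (M : ℕ) : ℕ :=
  M * (D.R * (2 ^ D.n * (2 ^ D.n * (M * M * 8 ^ D.n))) * (2 ^ D.n * (M * M)))

theorem absSum_coef_le (hD : D.Valid) {Φ : ℕ → GaussianInt} {M : ℕ} (hR : 1 ≤ D.R) (hM : 1 ≤ M)
    (hΦ : ∀ y < 2 ^ D.n, absSum (Φ y) ≤ M) (k z : ℕ) :
    absSum (D.coef Φ k z) ≤
      D.R * (2 ^ D.n * (2 ^ D.n * (M * M * 8 ^ D.n))) * (2 ^ D.n * (M * M)) := by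
  unfold coef
  split
  · refine (absSum_mul_le _ _).trans (Nat.mul_le_mul (absSum_gram_le hD hΦ _ _ _) ?_)
    simpa [absSum] using natAbs_mass_le hΦ k _
  · refine le_trans (by simp [absSum]) (Nat.one_le_iff_ne_zero.2 ?_)
    positivity

/-- The bound for the amplitudes after `h` levels. -/
def bound (D : Data) : ℕ → ℕ
  | 0 => 1
  | h + 1 => D.growth (bound D h)

theorem one_le_bound (hR : 1 ≤ D.R) (h : ℕ) : 1 ≤ D.bound h := by
  induction h with
  | zero => exact le_rfl
  | succ h ih =>
    refine Nat.one_le_iff_ne_zero.2 ?_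
    simp only [bound, growth]
    positivity

theorem absSum_amplitude_le (hD : D.Valid) (hR : 1 ≤ D.R) (h : ℕ) :
    ∀ z < 2 ^ D.n, absSum (D.amplitude h z) ≤ D.bound h := by
  induction h with
  | zero => intro z _; simp [amplitude, absSum, bound]
  | succ h ih =>
    intro z hz
    exact (absSum_mul_le _ _).trans
      (Nat.mul_le_mul (ih z hz) (absSum_coef_le hD hR (one_le_bound hR h) ih _ _))

end Data

/-! ### The estimation program

Registers: `0` number of qubits, `5` copies per level, `4` number of finished levels, `6` level,
`7` and `8` residue classes, `9` copy within the level, `10` and `11` the indices `y` and `y'`,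
`12` qubit, `13` and `14` weight, `15` scratch, `17` and `18` accumulator, `20` index of the
amplitude, `21` and `22` masses of the two halves, `23` and `24` diagonal entries, `26` the larger
one of these after normalization, `27` mass of the other half.

Arrays: `0` bases, `1` outcomes, `2` amplitudes, `3` new amplitudes, `4` powers of two.
-/

/-- The index of qubit `l` of copy `i` of level `k` in the arrays of bases and outcomes, where
`i`, `k` and `l` are in registers `9`, `6` and `12`. -/
def cellExpr : Expr := (.reg 6 * .reg 5 + .reg 9) * .reg 0 + .reg 12

/-- The basis of the current qubit of the current copy. -/
def basisExpr : Expr := .arr 0 cellExpr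
/-- The outcome at the current qubit of the current copy. -/
def outcomeExpr : Expr := .arr 1 cellExpr
/-- The digit of register `y` at the current qubit. -/
def digitExpr (y : ℕ) : Expr := Expr.mod (.reg y / .arr 4 (.reg 12)) (.lit 2)
/-- Whether the current qubit is below the current level. -/
def fixedExpr : Expr := .op .le (.reg 12 + .lit 1) (.reg 6)

/-- The real part of `entry`. -/
def entryReExpr : Expr :=
  fixedExpr * (Expr.eq (digitExpr 10) outcomeExpr * Expr.eq (digitExpr 11) outcomeExpr) +
  (.lit 1 - fixedExpr) * (Expr.eq (digitExpr 10) (digitExpr 11) +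
    .lit 3 * (.lit 1 - .lit 2 * outcomeExpr) * (Expr.eq basisExpr (.lit 0) *
      (.lit 1 - Expr.eq (digitExpr 10) (digitExpr 11)) +
      Expr.eq basisExpr (.lit 2) * Expr.eq (digitExpr 10) (digitExpr 11) *
      (.lit 1 - .lit 2 * digitExpr 10)))

/-- The imaginary part of `entry`. -/
def entryImExpr : Expr :=
  (.lit 1 - fixedExpr) * (Expr.eq basisExpr (.lit 1) *
    (.lit 3 * (.lit 1 - .lit 2 * outcomeExpr) * (digitExpr 10 - digitExpr 11)))

/-- Multiplies the Gaussian integer in registers `13`, `14` by the next matrix entry. -/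
def weightStepCmd : Cmd :=
  .seq (.assign 15 (.reg 13 * entryReExpr - .reg 14 * entryImExpr)) <|
  .seq (.assign 14 (.reg 13 * entryImExpr + .reg 14 * entryReExpr)) (.assign 13 (.reg 15))

/-- Computes `Data.weight` into registers `13`, `14`. -/
def weightCmd : Cmd :=
  .seq (.assign 13 (.lit 1)) <| .seq (.assign 14 (.lit 0)) (.loop 12 (.reg 0) weightStepCmd)

/-- The real part of the amplitude whose index is in register `y`. -/
def ampRe (y : ℕ) : Expr := .arr 2 (.lit 2 * .reg y)
/-- The imaginary part of the amplitude whose index is in register `y`. -/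
def ampIm (y : ℕ) : Expr := .arr 2 (.lit 2 * .reg y + .lit 1)

/-- The real part of the product of `star (Φ y)` and `Φ y'`. -/
def crossRe : Expr := ampRe 10 * ampRe 11 + ampIm 10 * ampIm 11
/-- The imaginary part of the product of `star (Φ y)` and `Φ y'`. -/
def crossIm : Expr := ampRe 10 * ampIm 11 - ampIm 10 * ampRe 11

/-- The residue of register `y` modulo `2 ^ (k + 1)` for the current level `k`. -/
def classExpr (y : ℕ) : Expr := Expr.mod (.reg y) (.arr 4 (.reg 6 + .lit 1))

/-- Adds `Data.gramTerm` to registers `17`, `18`. -/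
def gramTermCmd : Cmd :=
  .ite (Expr.eq (classExpr 10) (.reg 7) * Expr.eq (classExpr 11) (.reg 8))
    (.seq weightCmd <|
      .seq (.assign 17 (.reg 17 + (crossRe * .reg 13 - crossIm * .reg 14)))
        (.assign 18 (.reg 18 + (crossRe * .reg 14 + crossIm * .reg 13))))
    (.assign 15 (.lit 0))

/-- Computes `Data.gram` for the classes in registers `7`, `8` into registers `17`, `18`. -/
def gramCmd : Cmd :=
  .seq (.assign 17 (.lit 0)) <| .seq (.assign 18 (.lit 0)) <|
    .loop 9 (.reg 5) (.loop 10 (.arr 4 (.reg 0)) (.loop 11 (.arr 4 (.reg 0)) gramTermCmd))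

/-- Computes `Data.mass` for the class in register `7` into register `17`. -/
def massCmd : Cmd :=
  .seq (.assign 17 (.lit 0)) <| .seq (.assign 18 (.lit 0)) <|
    .loop 10 (.arr 4 (.reg 0)) (.assign 17 (.reg 17 + Expr.eq (classExpr 10) (.reg 7) *
      (ampRe 10 * ampRe 10 + ampIm 10 * ampIm 10)))

/-- The lower half `Data.half 0` of the class of the current index. -/
def lowExpr : Expr := Expr.mod (.reg 20) (.arr 4 (.reg 6))
/-- The upper half `Data.half 1` of the class of the current index. -/
def highExpr : Expr := lowExpr + .arr 4 (.reg 6)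

/-- Computes `Data.coef` for the index in register `20` into registers `17`, `18`. -/
def coefCmd : Cmd :=
  .seq (.assign 7 lowExpr) <| .seq massCmd <| .seq (.assign 21 (.reg 17)) <|
  .seq (.assign 8 lowExpr) <| .seq gramCmd <| .seq (.assign 23 (.reg 17)) <|
  .seq (.assign 7 highExpr) <| .seq massCmd <| .seq (.assign 22 (.reg 17)) <|
  .seq (.assign 8 highExpr) <| .seq gramCmd <| .seq (.assign 24 (.reg 17)) <|
  .seq (.ite (.op .le (.reg 24 * .reg 21) (.reg 23 * .reg 22))
    (.seq (.assign 8 lowExpr) (.assign 26 (.reg 23)))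
    (.seq (.assign 8 highExpr) (.assign 26 (.reg 24)))) <|
  .seq (.assign 7 (classExpr 20)) <| .seq gramCmd <|
  .seq (.assign 27 (Expr.eq (classExpr 20) lowExpr * .reg 22 +
    (.lit 1 - Expr.eq (classExpr 20) lowExpr) * .reg 21)) <|
  .ite (.op .le (.lit 1) (.reg 26))
    (.seq (.assign 17 (.reg 17 * .reg 27)) (.assign 18 (.reg 18 * .reg 27)))
    (.seq (.assign 17 (.lit 1)) (.assign 18 (.lit 0)))

/-- Computes the new amplitude with the index in register `20` into array `3`. -/
def amplitudeCmd : Cmd :=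
  .seq coefCmd <|
  .seq (.store 3 (.lit 2 * .reg 20) (ampRe 20 * .reg 17 - ampIm 20 * .reg 18))
    (.store 3 (.lit 2 * .reg 20 + .lit 1) (ampRe 20 * .reg 18 + ampIm 20 * .reg 17))

/-- One level of the estimation. All amplitudes are needed for each of the new ones, so these are
first collected in array `3` and then copied. -/
def levelCmd : Cmd :=
  .seq (.assign 6 (.reg 0 - .lit 1 - .reg 4)) <|
  .seq (.loop 20 (.arr 4 (.reg 0)) amplitudeCmd)
    (.loop 20 (.lit 2 * .arr 4 (.reg 0)) (.store 2 (.reg 20) (.arr 3 (.reg 20))))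

/-- Starts with all amplitudes equal to `1` and runs through the levels, from the last qubit to the
first. -/
def estimatorCmd : Cmd :=
  .seq (.loop 20 (.arr 4 (.reg 0)) (.store 2 (.lit 2 * .reg 20) (.lit 1)))
    (.loop 4 (.reg 0) levelCmd)

/-- The part of the memory that the estimator only reads. -/
structure Env (D : Data) (s : State) : Prop where
  reg0 : s.reg 0 = D.n
  reg5 : s.reg 5 = D.R
  pow : ∀ l ≤ D.n, s.arr 4 l = 2 ^ l
  basis : s.arr 0 = D.basis
  outcome : s.arr 1 = D.outcome

theorem Env.frame {D : Data} {s s' : State} {c : Cmd} (h : Env D s) (hf : c.Frame s s')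
    (h0 : 0 ∉ c.regs) (h5 : 5 ∉ c.regs) (ha : 0 ∉ c.arrs ∧ 1 ∉ c.arrs ∧ 4 ∉ c.arrs) : Env D s' where
  reg0 := by rw [hf.reg 0 h0, h.reg0]
  reg5 := by rw [hf.reg 5 h5, h.reg5]
  pow l hl := by rw [hf.arr 4 ha.2.2, h.pow l hl]
  basis := by rw [hf.arr 0 ha.1, h.basis]
  outcome := by rw [hf.arr 1 ha.2.1, h.outcome]

theorem Env.setReg {D : Data} {s : State} (h : Env D s) {x : ℕ} (z : ℤ) (h0 : 0 ≠ x)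
    (h5 : 5 ≠ x) : Env D (s.setReg x z) where
  reg0 := by simp [h0, h.reg0]
  reg5 := by simp [h5, h.reg5]
  pow l hl := by simp [h.pow l hl]
  basis := by simp [h.basis]
  outcome := by simp [h.outcome]

/-- The array `a` holds the amplitudes `Φ`, in the format of the output. -/
def Holds (D : Data) (a : ℕ → ℤ) (Φ : ℕ → GaussianInt) : Prop :=
  ∀ y < 2 ^ D.n, a (2 * y) = (Φ y).re ∧ a (2 * y + 1) = (Φ y).im

section

variable {ω : ℕ → Bool} {V T : ℕ} {s : State} {D : Data}

theorem toNat_two_mul (y : ℕ) : (2 * (y : ℤ)).toNat = 2 * y := by omega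
theorem toNat_two_mul_add_one (y : ℕ) : (2 * (y : ℤ) + 1).toNat = 2 * y + 1 := by omega

theorem digitExpr_eval {y l v : ℕ} (h : s.reg y = v) (hl : s.reg 12 = l)
    (hp : s.arr 4 l = 2 ^ l) : (digitExpr y).eval s = digit v l := by
  simp only [digitExpr, Expr.eval_mod, Expr.eval_div, Expr.eval_reg, Expr.eval_arr, hl, h,
    Int.toNat_natCast, hp, Expr.eval_lit, digit]
  push_cast
  rfl

theorem classExpr_eval {y k v : ℕ} (h : s.reg y = v) (hk : s.reg 6 = k)
    (hp : s.arr 4 (k + 1) = 2 ^ (k + 1)) :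
    (classExpr y).eval s = ((v % 2 ^ (k + 1) : ℕ) : ℤ) := by
  have e : ((k : ℤ) + 1).toNat = k + 1 := by omega
  simp only [classExpr, Expr.eval_mod, Expr.eval_reg, Expr.eval_arr, Expr.eval_add, hk, h,
    Expr.eval_lit, e, hp]
  push_cast
  rfl

theorem fixedExpr_eval {k l : ℕ} (hk : s.reg 6 = k) (hl : s.reg 12 = l) :
    fixedExpr.eval s = if l < k then 1 else 0 := by
  simp only [fixedExpr, Expr.eval_le, Expr.eval_add, Expr.eval_reg, Expr.eval_lit, hk, hl,
    Int.add_one_le_iff, Nat.cast_lt]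

theorem entryExpr_eval (h : Env D s) {k l i y y' : ℕ} (hk : s.reg 6 = k) (hi : s.reg 9 = i)
    (hy : s.reg 10 = y) (hy' : s.reg 11 = y') (hl : s.reg 12 = l) (hln : l < D.n) :
    (⟨entryReExpr.eval s, entryImExpr.eval s⟩ : GaussianInt) =
      entry k l (D.basis ((k * D.R + i) * D.n + l)) (D.outcome ((k * D.R + i) * D.n + l))
        (digit y l) (digit y' l) := by
  have hp := h.pow l hln.le
  have hc : cellExpr.eval s = (((k * D.R + i) * D.n + l : ℕ) : ℤ) := by
    simp [cellExpr, hk, hi, hl, h.reg0, h.reg5]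
  have hb : basisExpr.eval s = D.basis ((k * D.R + i) * D.n + l) := by
    simp only [basisExpr, Expr.eval_arr, hc, Int.toNat_natCast, h.basis]
  have ho : outcomeExpr.eval s = D.outcome ((k * D.R + i) * D.n + l) := by
    simp only [outcomeExpr, Expr.eval_arr, hc, Int.toNat_natCast, h.outcome]
  simp only [entryReExpr, entryImExpr, Expr.eval_add, Expr.eval_mul, Expr.eval_sub, Expr.eval_lit,
    Expr.eval_eq, fixedExpr_eval hk hl, digitExpr_eval hy hl hp, digitExpr_eval hy' hl hp, hb, ho,
    entry]
  generalize digit y l = a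
  generalize digit y' l = b
  generalize D.basis ((k * D.R + i) * D.n + l) = P
  generalize D.outcome ((k * D.R + i) * D.n + l) = o
  by_cases hlk : l < k
  · by_cases h1 : a = o <;> by_cases h2 : b = o <;> simp [hlk, h1, h2]
  · simp [hlk]

theorem absSum_re_le (g : GaussianInt) : g.re.natAbs ≤ absSum g := Nat.le_add_right _ _
theorem absSum_im_le (g : GaussianInt) : g.im.natAbs ≤ absSum g := Nat.le_add_left _ _

theorem weightCmd_ok (h : Env D s) (hD : D.Valid) {k i y y' : ℕ} (hk : s.reg 6 = k)
    (hi : s.reg 9 = i) (hy : s.reg 10 = y) (hy' : s.reg 11 = y') (hT : D.n ≤ T)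
    (hV : 8 ^ D.n ≤ V) :
    Ok ω V T weightCmd s fun s' =>
      (⟨s'.reg 13, s'.reg 14⟩ : GaussianInt) = D.weight k (k * D.R + i) y y' := by
  have hV1 : 1 ≤ V := (Nat.one_le_pow _ _ (by norm_num)).trans hV
  refine Ok.seq (Ok.assign (by simpa using hV1) (Ok.seq (Ok.assign (by simp) ?_)))
  refine Ok.loop (N := D.n) (fun j s' => (⟨s'.reg 13, s'.reg 14⟩ : GaussianInt) =
    ∏ l ∈ Finset.range j, entry k l (D.basis ((k * D.R + i) * D.n + l))
      (D.outcome ((k * D.R + i) * D.n + l)) (digit y l) (digit y' l))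
    (by simp [h.reg0]) hT ?_ ?_ ?_
  · simp; rfl
  · intro l hl s' hf hI
    have h' : Env D (s'.setReg 12 l) :=
      ((((h.setReg _ (by decide) (by decide)).setReg _ (by decide) (by decide)).frame hf
        (by decide) (by decide) (by decide)).setReg _ (by decide) (by decide))
    have he := entryExpr_eval h' (k := k) (l := l) (i := i) (y := y) (y' := y')
      (by simp [hf.reg 6 (by decide), hk]) (by simp [hf.reg 9 (by decide), hi])
      (by simp [hf.reg 10 (by decide), hy]) (by simp [hf.reg 11 (by decide), hy'])
      (by simp) hl
    have hprod := Finset.prod_range_succ (fun l => entry k l (D.basis ((k * D.R + i) * D.n + l))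
      (D.outcome ((k * D.R + i) * D.n + l)) (digit y l) (digit y' l)) l
    rw [← hI, ← he] at hprod
    have hb := Data.absSum_partial_le hD k (k * D.R + i) y y' (l + 1)
    have hb' : absSum _ ≤ V := hb.trans ((Nat.pow_le_pow_right (by norm_num) hl).trans hV)
    have he15 : ∀ z : ℤ, (⟨entryReExpr.eval ((s'.setReg 12 l).setReg 15 z),
        entryImExpr.eval ((s'.setReg 12 l).setReg 15 z)⟩ : GaussianInt) =
        ⟨entryReExpr.eval (s'.setReg 12 l), entryImExpr.eval (s'.setReg 12 l)⟩ := by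
      intro z
      rw [he]
      exact entryExpr_eval (h'.setReg _ (by decide) (by decide))
        (by simp [hf.reg 6 (by decide), hk]) (by simp [hf.reg 9 (by decide), hi])
        (by simp [hf.reg 10 (by decide), hy]) (by simp [hf.reg 11 (by decide), hy'])
        (by simp) hl
    generalize hgen : (∏ l ∈ Finset.range (l + 1), entry k l
      (D.basis ((k * D.R + i) * D.n + l)) (D.outcome ((k * D.R + i) * D.n + l))
      (digit y l) (digit y' l)) = g at hprod hb'
    have hre := congrArg Zsqrtd.re hprod
    have him := congrArg Zsqrtd.im hprod
    simp only [Zsqrtd.re_mul, Zsqrtd.im_mul] at hre him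
    have e15 := fun z => congrArg Zsqrtd.re (he15 z)
    have e15' := fun z => congrArg Zsqrtd.im (he15 z)
    simp only at e15 e15'
    have b1 := (absSum_re_le g).trans hb'
    have b2 := (absSum_im_le g).trans hb'
    have c1 : (Expr.reg 13 * entryReExpr - Expr.reg 14 * entryImExpr).eval (s'.setReg 12 l)
        = g.re := by
      rw [hre]; simp; ring
    refine Ok.seq (Ok.assign (by rw [c1]; exact b1) ?_)
    rw [c1]
    have c2 : (Expr.reg 13 * entryImExpr + Expr.reg 14 * entryReExpr).eval
        ((s'.setReg 12 l).setReg 15 g.re) = g.im := by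
      rw [him]; simp [e15, e15']
    refine Ok.seq (Ok.assign (by rw [c2]; exact b2) ?_)
    rw [c2]
    refine Ok.assign (by simpa using b1) ?_
    simp
  · intro s' _ hI
    exact hI

/-- The accumulator of sums of Gaussian integers. -/
def acc (s : State) : GaussianInt := ⟨s.reg 17, s.reg 18⟩

theorem acc_setReg {x : ℕ} (z : ℤ) (h1 : 17 ≠ x) (h2 : 18 ≠ x) : acc (s.setReg x z) = acc s := by
  simp [acc, h1, h2]

/-- A loop whose body adds `f k` to the accumulator computes a sum. -/
theorem Ok.accumulate {x N : ℕ} {e : Expr} {c : Cmd} (f : ℕ → GaussianInt) (b : ℕ)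
    (hN : e.eval s = N) (hT : N ≤ T) (hb : ∀ k < N, absSum (f k) ≤ b)
    (hV : absSum (acc s) + N * b ≤ V)
    (hstep : ∀ k < N, ∀ s', (Cmd.loop x e c).Frame s s' → absSum (acc s') + b ≤ V →
      Ok ω V T c (s'.setReg x k) fun s'' => acc s'' = acc s' + f k) :
    Ok ω V T (.loop x e c) s fun s' => acc s' = acc s + ∑ k ∈ Finset.range N, f k := by
  refine Ok.loop (fun k s' => acc s' = acc s + ∑ j ∈ Finset.range k, f j) hN hT (by simp) ?_
    fun s' _ h => h
  intro k hk s' hf hI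
  refine (hstep k hk s' hf ?_).mono fun s'' _ h => ?_
  · rw [hI]
    have h1 := absSum_add_le (acc s) (∑ j ∈ Finset.range k, f j)
    have h2 : absSum (∑ j ∈ Finset.range k, f j) ≤ k * b := by
      refine (absSum_sum_le _ _).trans ?_
      simpa using Finset.sum_le_card_nsmul (Finset.range k) (fun j => absSum (f j)) b
        fun j hj => hb j ((Finset.mem_range.1 hj).trans hk)
    have h3 : (k + 1) * b ≤ N * b := Nat.mul_le_mul_right _ hk
    have h4 : (k + 1) * b = k * b + b := by ring
    omega
  · rw [h, hI, Finset.sum_range_succ, add_assoc]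

theorem ampExpr_eval {y v : ℕ} {Φ : ℕ → GaussianInt} (hΦ : Holds D (s.arr 2) Φ) (h : s.reg y = v)
    (hv : v < 2 ^ D.n) : (ampRe y).eval s = (Φ v).re ∧ (ampIm y).eval s = (Φ v).im := by
  simp only [ampRe, ampIm, Expr.eval_arr, Expr.eval_mul, Expr.eval_add, Expr.eval_lit,
    Expr.eval_reg, h, toNat_two_mul, toNat_two_mul_add_one]
  exact hΦ v hv

theorem gramTermCmd_ok (h : Env D s) (hD : D.Valid) {k i y y' r r' M : ℕ} {Φ : ℕ → GaussianInt}
    (hΦ : Holds D (s.arr 2) Φ) (hM : ∀ y < 2 ^ D.n, absSum (Φ y) ≤ M) (hM1 : 1 ≤ M)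
    (hkn : k < D.n) (hk : s.reg 6 = k) (hr : s.reg 7 = r) (hr' : s.reg 8 = r')
    (hi : s.reg 9 = i) (hy : s.reg 10 = y) (hy' : s.reg 11 = y')
    (hyn : y < 2 ^ D.n) (hyn' : y' < 2 ^ D.n) (hT : D.n ≤ T)
    (hV : absSum (acc s) + M * M * 8 ^ D.n ≤ V) :
    Ok ω V T gramTermCmd s fun s' => acc s' = acc s + D.gramTerm Φ k r r' i y y' := by
  have hV8 : 8 ^ D.n ≤ V := by
    have : 1 * 1 * 8 ^ D.n ≤ M * M * 8 ^ D.n := by gcongr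
    omega
  have hcond : (Expr.eq (classExpr 10) (.reg 7) * Expr.eq (classExpr 11) (.reg 8)).eval s
      = if y % 2 ^ (k + 1) = r ∧ y' % 2 ^ (k + 1) = r' then 1 else 0 := by
    simp only [Expr.eval_mul, Expr.eval_eq, classExpr_eval hy hk (h.pow _ hkn),
      classExpr_eval hy' hk (h.pow _ hkn), Expr.eval_reg, hr, hr', Nat.cast_inj]
    by_cases h1 : y % 2 ^ (k + 1) = r <;> by_cases h2 : y' % 2 ^ (k + 1) = r' <;> simp [h1, h2]
  have hbound := Data.absSum_gramTerm_le hD hM hyn hyn' k r r' i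
  refine Ok.ite ?_ ?_
  · intro hne
    rw [hcond] at hne
    have hcl : y % 2 ^ (k + 1) = r ∧ y' % 2 ^ (k + 1) = r' := by
      by_contra hcon; simp [hcon] at hne
    refine Ok.seq ((weightCmd_ok h hD hk hi hy hy' hT hV8).mono ?_)
    intro s' hf hw
    have hacc : acc s' = acc s := by
      simp only [acc, hf.reg 17 (by decide), hf.reg 18 (by decide)]
    have hΦ' : Holds D (s'.arr 2) Φ := by rw [hf.arr 2 (by decide)]; exact hΦ
    have g10 : s'.reg 10 = y := by rw [hf.reg 10 (by decide), hy]
    have g11 : s'.reg 11 = y' := by rw [hf.reg 11 (by decide), hy']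
    have hcross : ∀ s'' : State, s''.arr = s'.arr → s''.reg 10 = y → s''.reg 11 = y' →
        (⟨crossRe.eval s'', crossIm.eval s''⟩ : GaussianInt) = star (Φ y) * Φ y' := by
      intro s'' ha e1 e2
      rw [← ha] at hΦ'
      obtain ⟨a1, a2⟩ := ampExpr_eval hΦ' e1 hyn
      obtain ⟨a3, a4⟩ := ampExpr_eval hΦ' e2 hyn'
      ext <;> simp [crossRe, crossIm, a1, a2, a3, a4, sub_eq_add_neg]
    have hterm : D.gramTerm Φ k r r' i y y' =
        star (Φ y) * Φ y' * D.weight k (k * D.R + i) y y' := by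
      simp only [Data.gramTerm, if_pos hcl]
    rw [← hw] at hterm
    have hres := absSum_add_le (acc s') (D.gramTerm Φ k r r' i y y')
    rw [← hacc] at hV
    have hres' : absSum (acc s' + D.gramTerm Φ k r r' i y y') ≤ V := by omega
    rw [← hacc]
    have hre := congrArg Zsqrtd.re (congrArg (acc s' + ·) hterm)
    have him := congrArg Zsqrtd.im (congrArg (acc s' + ·) hterm)
    rw [← hcross s' rfl g10 g11] at hre
    simp only [Zsqrtd.re_add, Zsqrtd.re_mul] at hre
    generalize hG : acc s' + D.gramTerm Φ k r r' i y y' = G at *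
    have b1 := (absSum_re_le G).trans hres'
    have b2 := (absSum_im_le G).trans hres'
    have c1 : (Expr.reg 17 + (crossRe * Expr.reg 13 - crossIm * Expr.reg 14)).eval s' = G.re := by
      rw [← hG, Zsqrtd.re_add, hre]; simp [acc]; ring
    refine Ok.seq (Ok.assign (by rw [c1]; exact b1) ?_)
    rw [c1]
    have hcr := hcross (s'.setReg 17 G.re) rfl (by simp [g10]) (by simp [g11])
    rw [← hcr] at him
    simp only [Zsqrtd.im_add, Zsqrtd.im_mul] at him
    have c2 : (Expr.reg 18 + (crossRe * Expr.reg 14 + crossIm * Expr.reg 13)).eval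
        (s'.setReg 17 G.re) = G.im := by
      rw [him]; simp [acc]
    refine Ok.assign (by rw [c2]; exact b2) ?_
    rw [c2]
    ext <;> simp [acc]
  · intro hne
    rw [hcond] at hne
    have hcl : ¬ (y % 2 ^ (k + 1) = r ∧ y' % 2 ^ (k + 1) = r') := by
      intro hcon; simp [hcon] at hne
    refine Ok.assign (by simp) ?_
    rw [acc_setReg _ (by decide) (by decide), Data.gramTerm, if_neg hcl, add_zero]

end

/-! ### Correctness of the estimation program -/

section

variable {ω : ℕ → Bool} {V T : ℕ} {s : State} {D : Data}

/-- A version of `Env.frame` that checks the side conditions by computation. -/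
theorem Env.exec {c : Cmd} (h : Env D s) {s' : State} (hf : c.Frame s s')
    (h0 : 0 ∉ c.regs := by decide) (h5 : 5 ∉ c.regs := by decide)
    (ha : 0 ∉ c.arrs ∧ 1 ∉ c.arrs ∧ 4 ∉ c.arrs := by decide) : Env D s' := h.frame hf h0 h5 ha

theorem Env.size_eval (h : Env D s) : (Expr.arr 4 (.reg 0)).eval s = (2 ^ D.n : ℕ) := by
  simp [h.reg0, h.pow D.n le_rfl]

theorem gramCmd_ok (h : Env D s) (hD : D.Valid) {k r r' M : ℕ} {Φ : ℕ → GaussianInt}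
    (hΦ : Holds D (s.arr 2) Φ) (hM : ∀ y < 2 ^ D.n, absSum (Φ y) ≤ M) (hM1 : 1 ≤ M)
    (hkn : k < D.n) (hk : s.reg 6 = k) (hr : s.reg 7 = r) (hr' : s.reg 8 = r')
    (hT : 2 ^ D.n ≤ T) (hTR : D.R ≤ T)
    (hV : D.R * (2 ^ D.n * (2 ^ D.n * (M * M * 8 ^ D.n))) ≤ V) :
    Ok ω V T gramCmd s fun s' => acc s' = D.gram Φ k r r' := by
  have hnT : D.n ≤ T := Nat.lt_two_pow_self.le.trans hT
  refine Ok.seq (Ok.assign (by simp) (Ok.seq (Ok.assign (by simp) ?_)))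
  simp only [Expr.eval_lit]
  set s₀ := (s.setReg 17 0).setReg 18 0 with hs₀
  have h₀ : Env D s₀ := (h.setReg _ (by decide) (by decide)).setReg _ (by decide) (by decide)
  have hacc : acc s₀ = 0 := by simp [acc, hs₀]; rfl
  -- the two inner loops are handled by the same rule
  refine (Ok.accumulate (fun i => ∑ y ∈ Finset.range (2 ^ D.n), ∑ y' ∈ Finset.range (2 ^ D.n),
    D.gramTerm Φ k r r' i y y') (2 ^ D.n * (2 ^ D.n * (M * M * 8 ^ D.n)))
    (by rw [Expr.eval_reg, h₀.reg5]) hTR ?_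
    (by rw [hacc]; simpa [absSum] using hV) ?_).mono fun s' _ hs' => ?_
  · intro i _
    refine (absSum_sum_le _ _).trans ((Finset.sum_le_card_nsmul _ _ _ fun y hy =>
      (absSum_sum_le _ _).trans (Finset.sum_le_card_nsmul _ _ _ fun y' hy' =>
      Data.absSum_gramTerm_le hD hM (Finset.mem_range.1 hy) (Finset.mem_range.1 hy') _ _ _ _)).trans
        ?_)
    simp
  · intro i hi s₁ f₁ hb₁
    have h₁ : Env D (s₁.setReg 9 i) := (h₀.exec f₁).setReg _ (by decide) (by decide)
    refine (Ok.accumulate (fun y => ∑ y' ∈ Finset.range (2 ^ D.n),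
      D.gramTerm Φ k r r' i y y') (2 ^ D.n * (M * M * 8 ^ D.n)) h₁.size_eval
      hT ?_ (by rwa [acc_setReg _ (by decide) (by decide)]) ?_).mono fun s' _ hs' => by
        rwa [acc_setReg _ (by decide) (by decide)] at hs'
    · intro y hy
      refine (absSum_sum_le _ _).trans ((Finset.sum_le_card_nsmul _ _ _ fun y' hy' =>
        Data.absSum_gramTerm_le hD hM hy (Finset.mem_range.1 hy') _ _ _ _).trans ?_)
      simp
    · intro y hy s₂ f₂ hb₂
      have h₂ : Env D (s₂.setReg 10 y) := (h₁.exec f₂).setReg _ (by decide) (by decide)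
      refine (Ok.accumulate (fun y' => D.gramTerm Φ k r r' i y y') (M * M * 8 ^ D.n) h₂.size_eval
        hT ?_ (by rwa [acc_setReg _ (by decide) (by decide)]) ?_).mono fun s' _ hs' => by
          rwa [acc_setReg _ (by decide) (by decide)] at hs'
      · intro y' hy'
        exact Data.absSum_gramTerm_le hD hM hy hy' _ _ _ _
      · intro y' hy' s₃ f₃ hb₃
        have h₃ : Env D (s₃.setReg 11 y') := (h₂.exec f₃).setReg _ (by decide) (by decide)
        refine (gramTermCmd_ok h₃ hD (k := k) (i := i) (y := y) (y' := y') (r := r) (r' := r')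
          ?_ hM hM1 hkn ?_ ?_ ?_ ?_ ?_ ?_ hy hy' hnT
          (by rwa [acc_setReg _ (by decide) (by decide)])).mono fun s' _ hs' => by
            rwa [acc_setReg _ (by decide) (by decide)] at hs'
        · simp only [State.setReg_arr, f₃.arr 2 (by decide), f₂.arr 2 (by decide),
            f₁.arr 2 (by decide)]
          exact hΦ
        · simp [f₃.reg 6 (by decide), f₂.reg 6 (by decide), f₁.reg 6 (by decide), hs₀, hk]
        · simp [f₃.reg 7 (by decide), f₂.reg 7 (by decide), f₁.reg 7 (by decide), hs₀, hr]
        · simp [f₃.reg 8 (by decide), f₂.reg 8 (by decide), f₁.reg 8 (by decide), hs₀, hr']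
        · simp [f₃.reg 9 (by decide), f₂.reg 9 (by decide)]
        · simp [f₃.reg 10 (by decide)]
        · simp
  · rw [hs', hacc, zero_add]; rfl

theorem massCmd_ok (h : Env D s) {k q M : ℕ} {Φ : ℕ → GaussianInt}
    (hΦ : Holds D (s.arr 2) Φ) (hM : ∀ y < 2 ^ D.n, absSum (Φ y) ≤ M)
    (hkn : k < D.n) (hk : s.reg 6 = k) (hq : s.reg 7 = q)
    (hT : 2 ^ D.n ≤ T) (hV : 2 ^ D.n * (M * M) ≤ V) :
    Ok ω V T massCmd s fun s' => s'.reg 17 = D.mass Φ k q := by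
  refine Ok.seq (Ok.assign (by simp) (Ok.seq (Ok.assign (by simp) ?_)))
  simp only [Expr.eval_lit]
  set s₀ := (s.setReg 17 0).setReg 18 0 with hs₀
  have h₀ : Env D s₀ := (h.setReg _ (by decide) (by decide)).setReg _ (by decide) (by decide)
  have hacc : acc s₀ = 0 := by simp [acc, hs₀]; rfl
  refine (Ok.accumulate (fun y => (((if y % 2 ^ (k + 1) = q then (Φ y).norm else 0 : ℤ)) :
    GaussianInt)) (M * M) h₀.size_eval hT ?_ (by rw [hacc]; simpa [absSum] using hV) ?_).mono
    fun s' _ hs' => ?_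
  · intro y hy
    have := hM y hy
    simp only [absSum, Zsqrtd.re_intCast, Zsqrtd.im_intCast, Int.natAbs_zero, add_zero]
    split_ifs
    · exact (norm_natAbs_le _).trans (Nat.mul_le_mul this this)
    · simp
  · intro y hy s₁ f₁ hb₁
    have h₁ : Env D (s₁.setReg 10 y) := (h₀.exec f₁).setReg _ (by decide) (by decide)
    have g6 : (s₁.setReg 10 y).reg 6 = k := by simp [f₁.reg 6 (by decide), hs₀, hk]
    have g7 : (s₁.setReg 10 y).reg 7 = q := by simp [f₁.reg 7 (by decide), hs₀, hq]
    have g2 : Holds D ((s₁.setReg 10 y).arr 2) Φ := by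
      simp only [State.setReg_arr, f₁.arr 2 (by decide)]; exact hΦ
    obtain ⟨a1, a2⟩ := ampExpr_eval (y := 10) g2 (by simp) hy
    have hn := norm_natAbs_le (Φ y)
    have hMy := Nat.mul_le_mul (hM y hy) (hM y hy)
    have e : (Expr.reg 17 + Expr.eq (classExpr 10) (.reg 7) *
      (ampRe 10 * ampRe 10 + ampIm 10 * ampIm 10)).eval (s₁.setReg 10 y) = (acc s₁).re +
        if y % 2 ^ (k + 1) = q then (Φ y).norm else 0 := by
      simp only [Expr.eval_add, Expr.eval_mul, Expr.eval_eq, Expr.eval_reg, g7, a1, a2,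
        classExpr_eval (y := 10) (v := y) (by simp) g6 (h₁.pow _ hkn), Nat.cast_inj,
        Zsqrtd.norm_def]
      split_ifs <;> simp [acc]
    refine Ok.assign ?_ ?_
    · rw [e]
      have h1 := absSum_re_le (acc s₁)
      split_ifs
      · have := Int.natAbs_add_le (acc s₁).re (Φ y).norm
        omega
      · simp only [add_zero]; omega
    · rw [e]
      split_ifs <;> (ext <;> simp [acc])
  · have := congrArg Zsqrtd.re hs'
    rw [hacc, zero_add, ← Int.cast_sum, Zsqrtd.re_intCast] at this
    exact this

/-- The memory during the computation of the new amplitude `z` of level `k`: the data, the current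
amplitudes `Φ`, and the two indices. -/
structure LevelEnv (D : Data) (Φ : ℕ → GaussianInt) (k z : ℕ) (s : State) : Prop where
  env : Env D s
  holds : Holds D (s.arr 2) Φ
  reg6 : s.reg 6 = k
  reg20 : s.reg 20 = z

theorem LevelEnv.exec {c : Cmd} {Φ : ℕ → GaussianInt} {k z : ℕ}
    (h : LevelEnv D Φ k z s) {s' : State} (hf : c.Frame s s')
    (hr : 0 ∉ c.regs ∧ 5 ∉ c.regs ∧ 6 ∉ c.regs ∧ 20 ∉ c.regs := by decide)
    (ha : 0 ∉ c.arrs ∧ 1 ∉ c.arrs ∧ 4 ∉ c.arrs ∧ 2 ∉ c.arrs := by decide) :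
    LevelEnv D Φ k z s' where
  env := h.env.frame hf hr.1 hr.2.1 ⟨ha.1, ha.2.1, ha.2.2.1⟩
  holds := by rw [hf.arr 2 ha.2.2.2]; exact h.holds
  reg6 := by rw [hf.reg 6 hr.2.2.1, h.reg6]
  reg20 := by rw [hf.reg 20 hr.2.2.2, h.reg20]

theorem LevelEnv.setReg {Φ : ℕ → GaussianInt} {k z : ℕ}
    (h : LevelEnv D Φ k z s) (x : ℕ) (v : ℤ)
    (hr : 0 ≠ x ∧ 5 ≠ x ∧ 6 ≠ x ∧ 20 ≠ x := by decide) :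
    LevelEnv D Φ k z (s.setReg x v) where
  env := h.env.setReg _ hr.1 hr.2.1
  holds := h.holds
  reg6 := by simp [hr.2.2.1, h.reg6]
  reg20 := by simp [hr.2.2.2, h.reg20]

section Level

variable {Φ : ℕ → GaussianInt} {M k z : ℕ}

theorem LevelEnv.low (h : LevelEnv D Φ k z s) (hkn : k < D.n) :
    lowExpr.eval s = Data.half 0 k z := by
  simp only [lowExpr, Expr.eval_mod, Expr.eval_reg, Expr.eval_arr, h.reg6, h.reg20,
    Int.toNat_natCast, h.env.pow k hkn.le, Data.half]
  push_cast; ring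

theorem LevelEnv.high (h : LevelEnv D Φ k z s) (hkn : k < D.n) :
    highExpr.eval s = Data.half 1 k z := by
  simp only [highExpr, Expr.eval_add, h.low hkn, Expr.eval_reg, Expr.eval_arr, h.reg6,
    Int.toNat_natCast, h.env.pow k hkn.le, Data.half]
  push_cast; ring

theorem LevelEnv.own (h : LevelEnv D Φ k z s) (hkn : k < D.n) :
    (classExpr 20).eval s = ((z % 2 ^ (k + 1) : ℕ) : ℤ) :=
  classExpr_eval h.reg20 h.reg6 (h.env.pow _ hkn)

theorem mod_lt_bound {V : ℕ} (a b : ℕ) (hb : 0 < b) (h : b ≤ V) : ((a % b : ℕ) : ℤ).natAbs ≤ V := by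
  have := Nat.mod_lt a hb
  simp only [Int.natAbs_natCast]; omega

theorem half_lt (b : ℕ) (hb : b ≤ 1) (k z : ℕ) : Data.half b k z < 2 ^ (k + 1) := by
  have := Nat.mod_lt z (Nat.two_pow_pos k)
  have : b * 2 ^ k ≤ 1 * 2 ^ k := Nat.mul_le_mul_right _ hb
  rw [Data.half, pow_succ]; omega

theorem coefCmd_ok (h : LevelEnv D Φ k z s) (hD : D.Valid) (hR : 1 ≤ D.R)
    (hM : ∀ y < 2 ^ D.n, absSum (Φ y) ≤ M) (hM1 : 1 ≤ M) (hkn : k < D.n)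
    (hT : 2 ^ D.n ≤ T) (hTR : D.R ≤ T) (hV : D.growth M ≤ V) :
    Ok ω V T coefCmd s fun s' => acc s' = D.coef Φ k z := by
  have hV' : D.R * (2 ^ D.n * (2 ^ D.n * (M * M * 8 ^ D.n))) * (2 ^ D.n * (M * M)) ≤ V :=
    (Nat.le_mul_of_pos_left _ hM1).trans hV
  have hVg : D.R * (2 ^ D.n * (2 ^ D.n * (M * M * 8 ^ D.n))) ≤ V :=
    (Nat.le_mul_of_pos_right _ (by positivity)).trans hV'
  have hVm : 2 ^ D.n * (M * M) ≤ V :=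
    (Nat.le_mul_of_pos_left _ (by positivity)).trans hV'
  have hV2 : 2 ^ D.n ≤ V := (Nat.le_mul_of_pos_right _ (by positivity)).trans hVm
  have hhalf : ∀ b ≤ 1, ((Data.half b k z : ℕ) : ℤ).natAbs ≤ V := fun b hb => by
    have h1 := half_lt b hb k z
    have h2 : 2 ^ (k + 1) ≤ 2 ^ D.n := Nat.pow_le_pow_right (by norm_num) hkn
    simp only [Int.natAbs_natCast]; omega
  have hmass : ∀ q, (D.mass Φ k q).natAbs ≤ V := fun q =>
    (Data.natAbs_mass_le hM k q).trans hVm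
  have hgram : ∀ r r', (D.gram Φ k r r').re.natAbs ≤ V := fun r r' =>
    (absSum_re_le _).trans ((Data.absSum_gram_le hD hM k r r').trans hVg)
  set q₀ := Data.half 0 k z with hq₀
  set q₁ := Data.half 1 k z with hq₁
  set n₀ := D.mass Φ k q₀ with hn₀
  set n₁ := D.mass Φ k q₁ with hn₁
  set d₀ := (D.gram Φ k q₀ q₀).re with hd₀
  set d₁ := (D.gram Φ k q₁ q₁).re with hd₁
  have gram : ∀ {s : State} {r r' : ℕ}, LevelEnv D Φ k z s → s.reg 7 = r → s.reg 8 = r' →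
      Ok ω V T gramCmd s fun s' => acc s' = D.gram Φ k r r' := fun h h7 h8 =>
    gramCmd_ok h.env hD h.holds hM hM1 hkn h.reg6 h7 h8 hT hTR hVg
  have mass : ∀ {s : State} {q : ℕ}, LevelEnv D Φ k z s → s.reg 7 = q →
      Ok ω V T massCmd s fun s' => s'.reg 17 = D.mass Φ k q := fun h h7 =>
    massCmd_ok h.env h.holds hM hkn h.reg6 h7 hT hVm
  -- mass and diagonal entry of the first half
  refine Ok.seq (Ok.assign (by rw [h.low hkn]; exact hhalf 0 (by norm_num)) ?_)
  rw [h.low hkn]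
  replace h := h.setReg 7 q₀
  refine Ok.seq ((mass (q := q₀) h (by simp)).mono fun s₁ f₁ r17 => ?_)
  have r7 : s₁.reg 7 = q₀ := by simp [f₁.reg 7 (by decide)]
  replace h := h.exec f₁
  refine Ok.seq (Ok.assign (by simpa [r17] using hmass q₀) ?_)
  rw [Expr.eval_reg, r17]
  replace h := h.setReg 21 (D.mass Φ k q₀)
  refine Ok.seq (Ok.assign (by rw [h.low hkn]; exact hhalf 0 (by norm_num)) ?_)
  rw [h.low hkn]
  replace h := h.setReg 8 q₀
  refine Ok.seq ((gram (r := q₀) (r' := q₀) h (by simp [r7]) (by simp)).mono fun s₂ f₂ hacc => ?_)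
  have r17 : s₂.reg 17 = d₀ := congrArg Zsqrtd.re hacc
  have r21 : s₂.reg 21 = n₀ := by simp [f₂.reg 21 (by decide), hn₀]
  replace h := h.exec f₂
  refine Ok.seq (Ok.assign (by simpa [r17] using hgram q₀ q₀) ?_)
  rw [Expr.eval_reg, r17]
  replace h := h.setReg 23 d₀
  -- the same for the second half
  refine Ok.seq (Ok.assign (by rw [h.high hkn]; exact hhalf 1 le_rfl) ?_)
  rw [h.high hkn]
  replace h := h.setReg 7 q₁
  refine Ok.seq ((mass (q := q₁) h (by simp)).mono fun s₃ f₃ r17 => ?_)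
  have r7 : s₃.reg 7 = q₁ := by simp [f₃.reg 7 (by decide)]
  have r21 : s₃.reg 21 = n₀ := by simp [f₃.reg 21 (by decide), r21]
  have r23 : s₃.reg 23 = d₀ := by simp [f₃.reg 23 (by decide)]
  replace h := h.exec f₃
  refine Ok.seq (Ok.assign (by simpa [r17] using hmass q₁) ?_)
  rw [Expr.eval_reg, r17]
  replace h := h.setReg 22 (D.mass Φ k q₁)
  refine Ok.seq (Ok.assign (by rw [h.high hkn]; exact hhalf 1 le_rfl) ?_)
  rw [h.high hkn]
  replace h := h.setReg 8 q₁
  refine Ok.seq ((gram (r := q₁) (r' := q₁) h (by simp [r7]) (by simp)).mono fun s₄ f₄ hacc => ?_)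
  have r17 : s₄.reg 17 = d₁ := congrArg Zsqrtd.re hacc
  have r21 : s₄.reg 21 = n₀ := by simp [f₄.reg 21 (by decide), r21]
  have r22 : s₄.reg 22 = n₁ := by simp [f₄.reg 22 (by decide), hn₁]
  have r23 : s₄.reg 23 = d₀ := by simp [f₄.reg 23 (by decide), r23]
  replace h := h.exec f₄
  refine Ok.seq (Ok.assign (by simpa [r17] using hgram q₁ q₁) ?_)
  rw [Expr.eval_reg, r17]
  replace h := h.setReg 24 d₁
  -- the pivot
  have hpivot : D.pivot Φ k z = if d₁ * n₀ ≤ d₀ * n₁ then q₀ else q₁ := rfl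
  have key : Ok ω V T (.ite (.op .le (.reg 24 * .reg 21) (.reg 23 * .reg 22))
      (.seq (.assign 8 lowExpr) (.assign 26 (.reg 23)))
      (.seq (.assign 8 highExpr) (.assign 26 (.reg 24)))) (s₄.setReg 24 d₁) fun s' =>
      s'.reg 8 = D.pivot Φ k z ∧
        s'.reg 26 = (D.gram Φ k (D.pivot Φ k z) (D.pivot Φ k z)).re := by
    have hev : (Expr.op .le (.reg 24 * .reg 21) (.reg 23 * .reg 22)).eval (s₄.setReg 24 d₁)
        = if d₁ * n₀ ≤ d₀ * n₁ then 1 else 0 := by simp [r21, r22, r23]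
    refine Ok.ite ?_ ?_ <;> intro hc <;> rw [hev] at hc
    · have hle : d₁ * n₀ ≤ d₀ * n₁ := by by_contra hcon; simp [hcon] at hc
      rw [hpivot, if_pos hle]
      refine Ok.seq (Ok.assign (by rw [h.low hkn]; exact hhalf 0 (by norm_num)) ?_)
      refine Ok.assign (by simpa [r23] using hgram q₀ q₀) ?_
      simp [h.low hkn, r23, hd₀, hq₀]
    · have hle : ¬ d₁ * n₀ ≤ d₀ * n₁ := by intro hcon; simp [hcon] at hc
      rw [hpivot, if_neg hle]
      refine Ok.seq (Ok.assign (by rw [h.high hkn]; exact hhalf 1 le_rfl) ?_)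
      refine Ok.assign (by simpa using hgram q₁ q₁) ?_
      rw [h.high hkn]
      simp [hd₁, hq₁]
  refine Ok.seq (key.mono fun s₅ f₅ ⟨r8, r26⟩ => ?_)
  have r21 : s₅.reg 21 = n₀ := by simp [f₅.reg 21 (by decide), r21]
  have r22 : s₅.reg 22 = n₁ := by simp [f₅.reg 22 (by decide), r22]
  replace h := h.exec f₅
  -- the matrix element between the class of the amplitude and the pivot
  refine Ok.seq (Ok.assign (by
    rw [h.own hkn]
    exact mod_lt_bound _ _ (by positivity)
      ((Nat.pow_le_pow_right (by norm_num) hkn).trans hV2)) ?_)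
  rw [h.own hkn]
  replace h := h.setReg 7 ((z % 2 ^ (k + 1) : ℕ) : ℤ)
  refine Ok.seq ((gram (r := z % 2 ^ (k + 1)) (r' := D.pivot Φ k z) h (by simp)
    (by simpa using r8)).mono fun s₆ f₆ hacc => ?_)
  have r21 : s₆.reg 21 = n₀ := by simp [f₆.reg 21 (by decide), r21]
  have r22 : s₆.reg 22 = n₁ := by simp [f₆.reg 22 (by decide), r22]
  have r26 : s₆.reg 26 = (D.gram Φ k (D.pivot Φ k z) (D.pivot Φ k z)).re := by
    rw [f₆.reg 26 (by decide), ← r26]; simp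
  replace h := h.exec f₆
  set own := z % 2 ^ (k + 1) with hown
  have hother : (Expr.eq (classExpr 20) lowExpr * .reg 22 +
      (.lit 1 - Expr.eq (classExpr 20) lowExpr) * .reg 21).eval s₆ =
      D.mass Φ k (if own = q₀ then q₁ else q₀) := by
    simp only [Expr.eval_add, Expr.eval_mul, Expr.eval_sub, Expr.eval_eq, Expr.eval_lit,
      Expr.eval_reg, h.own hkn, h.low hkn, r21, r22, Nat.cast_inj]
    split_ifs <;> simp [hn₀, hn₁]
  refine Ok.seq (Ok.assign (by rw [hother]; exact hmass _) ?_)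
  rw [hother]
  set nOther := D.mass Φ k (if own = q₀ then q₁ else q₀) with hnOther
  have hcoef : D.coef Φ k z =
      if 1 ≤ (D.gram Φ k (D.pivot Φ k z) (D.pivot Φ k z)).re then
        D.gram Φ k own (D.pivot Φ k z) * (nOther : ℤ) else 1 := rfl
  have hb : absSum (D.coef Φ k z) ≤ V := (Data.absSum_coef_le hD hR hM1 hM k z).trans hV'
  rw [hcoef] at hb ⊢
  have hre : s₆.reg 17 = (D.gram Φ k own (D.pivot Φ k z)).re := congrArg Zsqrtd.re hacc
  have him : s₆.reg 18 = (D.gram Φ k own (D.pivot Φ k z)).im := congrArg Zsqrtd.im hacc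
  refine Ok.ite ?_ ?_ <;> intro hc <;>
    simp only [Expr.eval_le, Expr.eval_lit, Expr.eval_reg, State.setReg_reg, Nat.reduceEqDiff,
      if_false, r26, ne_eq, ite_eq_right_iff, one_ne_zero, imp_false, not_not] at hc
  · rw [if_pos hc] at hb ⊢
    have b1 := (absSum_re_le _).trans hb
    have b2 := (absSum_im_le _).trans hb
    simp only [Zsqrtd.re_mul, Zsqrtd.im_mul, Zsqrtd.re_intCast, Zsqrtd.im_intCast, mul_zero,
      add_zero, zero_add] at b1 b2
    refine Ok.seq (Ok.assign (by simpa [hre] using b1) (Ok.assign (by simpa [him] using b2) ?_))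
    ext <;> simp [acc, hre, him]
  · rw [if_neg hc] at hb ⊢
    have hV1 : 1 ≤ V := by simpa [absSum] using hb
    refine Ok.seq (Ok.assign (by simpa using hV1) (Ok.assign (by simp) ?_))
    ext <;> simp [acc]

theorem amplitudeCmd_ok (h : LevelEnv D Φ k z s) (hD : D.Valid) (hR : 1 ≤ D.R)
    (hM : ∀ y < 2 ^ D.n, absSum (Φ y) ≤ M) (hM1 : 1 ≤ M) (hkn : k < D.n) (hz : z < 2 ^ D.n)
    (hT : 2 ^ D.n ≤ T) (hTR : D.R ≤ T) (hV : D.growth M ≤ V) :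
    Ok ω V T amplitudeCmd s fun s' =>
      s'.arr 3 = Function.update (Function.update (s.arr 3) (2 * z) (Φ z * D.coef Φ k z).re)
        (2 * z + 1) (Φ z * D.coef Φ k z).im := by
  refine Ok.seq ((coefCmd_ok h hD hR hM hM1 hkn hT hTR hV).mono fun s₁ f₁ hacc => ?_)
  replace h := h.exec f₁
  obtain ⟨a1, a2⟩ := ampExpr_eval h.holds h.reg20 hz
  have hb : absSum (Φ z * D.coef Φ k z) ≤ V := (absSum_mul_le _ _).trans
    ((Nat.mul_le_mul (hM z hz) (Data.absSum_coef_le hD hR hM1 hM k z)).trans hV)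
  have b1 := (absSum_re_le _).trans hb
  have b2 := (absSum_im_le _).trans hb
  have c1 : (ampRe 20 * .reg 17 - ampIm 20 * .reg 18).eval s₁ = (Φ z * D.coef Φ k z).re := by
    rw [← hacc]; simp [a1, a2, acc, sub_eq_add_neg]
  refine Ok.seq (Ok.store (by rw [c1]; exact b1) ?_)
  rw [c1]
  have h2 : Holds D ((s₁.setArr 3 ((Expr.lit 2 * .reg 20).eval s₁).toNat
      (Φ z * D.coef Φ k z).re).arr 2) Φ := h.holds
  obtain ⟨a3, a4⟩ := ampExpr_eval (y := 20) h2 h.reg20 hz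
  have c2 : (ampRe 20 * .reg 18 + ampIm 20 * .reg 17).eval (s₁.setArr 3
      ((Expr.lit 2 * .reg 20).eval s₁).toNat (Φ z * D.coef Φ k z).re)
      = (Φ z * D.coef Φ k z).im := by
    generalize ((Expr.lit 2 * .reg 20).eval s₁).toNat = i at a3 a4 ⊢
    rw [Expr.eval_add, Expr.eval_mul, Expr.eval_mul, a3, a4, Zsqrtd.im_mul, ← hacc]
    simp [acc]
  refine Ok.store (by rw [c2]; exact b2) ?_
  rw [c2]
  simp only [State.setArr, Function.update_self, Expr.eval_mul, Expr.eval_add, Expr.eval_lit,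
    Expr.eval_reg, h.reg20, toNat_two_mul, toNat_two_mul_add_one, f₁.arr 3 (by decide)]

end Level

theorem levelCmd_ok (h : Env D s) (hD : D.Valid) (hR : 1 ≤ D.R) {j M : ℕ} {Φ : ℕ → GaussianInt}
    (hΦ : Holds D (s.arr 2) Φ) (hM : ∀ y < 2 ^ D.n, absSum (Φ y) ≤ M) (hM1 : 1 ≤ M)
    (hj : j < D.n) (h4 : s.reg 4 = j) (hT : 2 * 2 ^ D.n ≤ T) (hTR : D.R ≤ T)
    (hV : D.growth M ≤ V) (hnV : D.n ≤ V) :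
    Ok ω V T levelCmd s fun s' =>
      Holds D (s'.arr 2) fun z => Φ z * D.coef Φ (D.n - 1 - j) z := by
  set k := D.n - 1 - j with hk
  have e6 : (Expr.reg 0 - .lit 1 - .reg 4).eval s = k := by
    simp only [Expr.eval_sub, Expr.eval_reg, Expr.eval_lit, h.reg0, h4]; omega
  refine Ok.seq (Ok.assign (by rw [e6]; simp; omega) ?_)
  rw [e6]
  set s₀ := s.setReg 6 k with hs₀
  have h₀ : Env D s₀ := h.setReg _ (by decide) (by decide)
  set Ψ : ℕ → GaussianInt := fun z => Φ z * D.coef Φ k z with hΨ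
  refine Ok.seq ?_
  refine Ok.loop (N := 2 ^ D.n) (fun z s' => ∀ y < z, s'.arr 3 (2 * y) = (Ψ y).re ∧
    s'.arr 3 (2 * y + 1) = (Ψ y).im) h₀.size_eval (by omega) (by simp) ?_ ?_
  · intro z hz s₁ f₁ hI
    have g2 : (s₁.setReg 20 z).arr 2 = s.arr 2 := by
      simp [f₁.arr 2 (by decide), hs₀]
    have hL : LevelEnv D Φ k z (s₁.setReg 20 z) :=
      ⟨(h₀.exec f₁).setReg _ (by decide) (by decide), by rw [g2]; exact hΦ,
        by simp [f₁.reg 6 (by decide), hs₀], by simp⟩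
    refine (amplitudeCmd_ok hL hD hR hM hM1 (by omega) hz (by omega) hTR hV).mono
      fun s₂ _ h3 y hy => ?_
    rw [h3]
    by_cases hyz : y = z
    · subst hyz
      simp [hΨ]
    · have := hI y (by omega)
      rw [Function.update_of_ne (by omega), Function.update_of_ne (by omega),
        Function.update_of_ne (by omega), Function.update_of_ne (by omega)]
      exact this
  · intro s₁ f₁ hI
    have h₁ : Env D s₁ := h₀.exec f₁
    have hb : ∀ y < 2 ^ D.n, absSum (Ψ y) ≤ V := fun y hy => (absSum_mul_le _ _).trans
      ((Nat.mul_le_mul (hM y hy) (Data.absSum_coef_le hD hR hM1 hM k y)).trans hV)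
    have hN : (Expr.lit 2 * Expr.arr 4 (.reg 0)).eval s₁ = (2 * 2 ^ D.n : ℕ) := by
      rw [Expr.eval_mul, h₁.size_eval, Expr.eval_lit]; push_cast; ring
    refine Ok.loop (N := 2 * 2 ^ D.n) (fun z s' => ∀ y < z, s'.arr 2 y = s₁.arr 3 y) hN hT
      (by simp) ?_ ?_
    · intro z hz s₂ f₂ hI2
      have g3 : s₂.arr 3 = s₁.arr 3 := f₂.arr 3 (by decide)
      have hz2 := hI (z / 2) (by omega)
      have hbz := hb (z / 2) (by omega)
      have b1 := (absSum_re_le _).trans hbz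
      have b2 := (absSum_im_le _).trans hbz
      have hzV : (s₁.arr 3 z).natAbs ≤ V := by
        rcases Nat.mod_two_eq_zero_or_one z with hz0 | hz0
        · have e : 2 * (z / 2) = z := by omega
          rw [e] at hz2; rw [hz2.1]; exact b1
        · have e : 2 * (z / 2) + 1 = z := by omega
          rw [e] at hz2; rw [hz2.2]; exact b2
      refine Ok.store (by simpa [g3] using hzV) fun y hy => ?_
      simp only [State.setArr_arr, Expr.eval_reg, State.setReg_reg, if_true, Int.toNat_natCast,
        true_and, Expr.eval_arr, State.setReg_arr, g3]
      split_ifs with hyz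
      · rw [hyz]
      · exact hI2 y (by omega)
    · intro s₂ _ hI2 y hy
      rw [hI2 _ (by omega), hI2 _ (by omega)]
      exact hI y hy

/-- The program computes `Data.amplitude`, with all values bounded by the numbers `Data.bound`. -/
theorem estimatorCmd_ok (h : Env D s) (hD : D.Valid) (hR : 1 ≤ D.R) (h2 : s.arr 2 = 0)
    (hT : 2 * 2 ^ D.n ≤ T) (hTR : D.R ≤ T) (hV : ∀ j ≤ D.n, D.bound j ≤ V) (hnV : D.n ≤ V) :
    Ok ω V T estimatorCmd s fun s' => Holds D (s'.arr 2) (D.amplitude D.n) := by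
  have hV1 : 1 ≤ V := hV 0 (by omega)
  refine Ok.seq ?_
  refine Ok.loop (N := 2 ^ D.n) (fun z s' => (∀ y < z, s'.arr 2 (2 * y) = 1) ∧
    ∀ y, s'.arr 2 (2 * y + 1) = 0) h.size_eval (by omega) (by simp [h2]) ?_ ?_
  · rintro z hz s₁ f₁ ⟨hI, hI'⟩
    refine Ok.store (by simpa using hV1) ⟨fun y hy => ?_, fun y => ?_⟩
    · simp only [State.setArr_arr, Expr.eval_mul, Expr.eval_lit, Expr.eval_reg, State.setReg_reg,
        if_true, toNat_two_mul, true_and, State.setReg_arr]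
      split_ifs
      · rfl
      · exact hI y (by omega)
    · simp only [State.setArr_arr, Expr.eval_mul, Expr.eval_lit, Expr.eval_reg, State.setReg_reg,
        if_true, toNat_two_mul, true_and, State.setReg_arr]
      rw [if_neg (by omega)]
      exact hI' y
  · rintro s₁ f₁ ⟨hI, hI'⟩
    have h₁ : Env D s₁ := h.exec f₁
    have hnT : D.n ≤ T := by have := @Nat.lt_two_pow_self D.n; omega
    refine Ok.loop (N := D.n) (fun j s' => Holds D (s'.arr 2) (D.amplitude j))
      (by rw [Expr.eval_reg, h₁.reg0]) hnT ?_ ?_ ?_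
    · intro y hy
      exact ⟨by simp [hI y hy, Data.amplitude], by simp [hI' y, Data.amplitude]⟩
    · intro j hj s₂ f₂ hI2
      exact levelCmd_ok ((h₁.exec f₂).setReg _ (by decide) (by decide)) hD hR hI2
        (Data.absSum_amplitude_le hD hR j) (Data.one_le_bound hR j) hj (by simp) hT hTR
        (hV (j + 1) hj) hnV
    · exact fun s' _ h => h

end

/-! ### One qubit -/

/-- The Pauli matrices, numbered as in the memory of the program. -/
def pauli (P : Fin 3) : Pauli := Pauli.ofInt ((P : ℕ) : ℤ)

/-- A bit as it is stored in the memory of the program. -/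
def bitInt (b : Bool) : ℤ := if b then 1 else 0

/-- The sign of the eigenvalue that belongs to an outcome. -/
def sign (o : Bool) : ℝ := if o then -1 else 1

/-- The probability with which the Pauli matrix `P` is chosen for a qubit that is either measured
in the basis `Z`, for a prescribed outcome, or in a uniformly random basis. -/
noncomputable def pauliWeight : Option Bool → Fin 3 → ℝ
  | some _, P => if P = 2 then 1 else 0
  | none, _ => 1 / 3

/-- The estimator for one qubit: the projector to a prescribed label, or twice the inverse of the
measurement channel. -/
noncomputable def shadow : Option Bool → Fin 3 → Bool → Bool → Bool → ℂ
  | some t, _, o, a, b => if o = t ∧ a = t ∧ b = t then 1 else 0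
  | none, P, o, a, b =>
    GaussianInt.toComplex (entry 0 0 ((P : ℕ) : ℤ) (bitInt o) (bitInt a) (bitInt b))

/-- Whether a label is compatible with the prescribed one. -/
def compat : Option Bool → Bool → ℝ
  | some t, a => if a = t then 1 else 0
  | none, _ => 1

/-- The factor by which the mean of `shadow` differs from the projected density matrix. -/
def meanFactor : Option Bool → ℝ
  | some _ => 1
  | none => 2

/-- The component of the Bloch vector of a pair of amplitudes. -/
noncomputable def bloch (P : Fin 3) (u : Bool → ℂ) : ℝ :=
  ![2 * (u false * star (u true)).re, -2 * (u false * star (u true)).im,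
    ‖u false‖ ^ 2 - ‖u true‖ ^ 2] P

/-- Component of a `2 × 2` matrix in the basis of Pauli matrices. -/
noncomputable def pauliPart (P : Fin 3) (m : Bool → Bool → ℂ) : ℂ :=
  ![m false true + m true false, Complex.I * (m true false - m false true),
    m false false - m true true] P

/-- Amplitude of the outcome `o` of the measurement of one qubit. -/
noncomputable def outcomeAmp (P : Fin 3) (o : Bool) (u : Bool → ℂ) : ℂ :=
  ∑ x, star ((pauli P).eigenvector o x) * u x

theorem sq_norm_eq (z : ℂ) : ‖z‖ ^ 2 = z.re * z.re + z.im * z.im := by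
  rw [Complex.sq_norm, Complex.normSq_apply]

theorem inv_sqrt_two_mul : ((Real.sqrt 2)⁻¹) * (Real.sqrt 2)⁻¹ = (2 : ℝ)⁻¹ := by
  rw [← mul_inv, Real.mul_self_sqrt (by norm_num)]

theorem outcomeAmp_zero (o : Bool) (u : Bool → ℂ) :
    outcomeAmp 0 o u = ((Real.sqrt 2)⁻¹ : ℝ) * (u false + (sign o : ℂ) * u true) := by
  cases o <;> simp [outcomeAmp, pauli, Pauli.ofInt, Pauli.eigenvector, sign] <;> ring

theorem outcomeAmp_one (o : Bool) (u : Bool → ℂ) :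
    outcomeAmp 1 o u =
      ((Real.sqrt 2)⁻¹ : ℝ) * (u false - (sign o : ℂ) * Complex.I * u true) := by
  cases o <;> simp [outcomeAmp, pauli, Pauli.ofInt, Pauli.eigenvector, sign] <;> ring

theorem outcomeAmp_two (o : Bool) (u : Bool → ℂ) : outcomeAmp 2 o u = u o := by
  cases o <;> simp [outcomeAmp, pauli, Pauli.ofInt, Pauli.eigenvector]

/-- Born's rule in Bloch coordinates. -/
theorem sq_norm_outcomeAmp (P : Fin 3) (o : Bool) (u : Bool → ℂ) :
    ‖outcomeAmp P o u‖ ^ 2 =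
      (‖u false‖ ^ 2 + ‖u true‖ ^ 2 + sign o * bloch P u) / 2 := by
  have h := inv_sqrt_two_mul
  fin_cases P
  · simp only [Fin.zero_eta, outcomeAmp_zero, norm_mul, mul_pow, Complex.norm_real, norm_inv,
      Real.norm_eq_abs, abs_of_nonneg (Real.sqrt_nonneg 2), inv_pow,
      Real.sq_sqrt (zero_le_two (α := ℝ))]
    cases o <;> simp [sq_norm_eq, bloch, sign] <;> ring
  · simp only [Fin.mk_one, outcomeAmp_one, norm_mul, mul_pow, Complex.norm_real, norm_inv,
      Real.norm_eq_abs, abs_of_nonneg (Real.sqrt_nonneg 2), inv_pow,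
      Real.sq_sqrt (zero_le_two (α := ℝ))]
    cases o <;> simp [sq_norm_eq, bloch, sign] <;> ring
  · have e : (⟨2, by norm_num⟩ : Fin 3) = 2 := rfl
    rw [e, outcomeAmp_two]
    cases o <;> simp [bloch, sign]
    ring

/-- The random one-qubit estimator in Bloch coordinates. -/
theorem sum_shadow_none (P : Fin 3) (o : Bool) (m : Bool → Bool → ℂ) :
    ∑ a, ∑ b, shadow none P o a b * m a b =
      m false false + m true true + 3 * (sign o : ℂ) * pauliPart P m := by
  fin_cases P <;> cases o <;>
    simp [shadow, entry, bitInt, pauliPart, sign, GaussianInt.toComplex_def] <;> ring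

/-- Parseval's identity for the basis of Pauli matrices. -/
theorem sq_norm_pauliPart (m : Bool → Bool → ℂ) :
    ‖m false false + m true true‖ ^ 2 + ∑ P, ‖pauliPart P m‖ ^ 2 =
      2 * ∑ a, ∑ b, ‖m a b‖ ^ 2 := by
  simp [Fin.sum_univ_three, pauliPart, sq_norm_eq]
  ring

theorem sum_sq_norm_outcomeAmp (P : Fin 3) (u : Bool → ℂ) :
    ∑ o, ‖outcomeAmp P o u‖ ^ 2 = ∑ x, ‖u x‖ ^ 2 := by
  simp [sq_norm_outcomeAmp, sign]; ring

/-- The one-qubit estimator is unbiased. -/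
theorem mean_shadow_qubit (f : Option Bool) (u v : Bool → ℂ) (a b : Bool) :
    ∑ P, ∑ o, (pauliWeight f P : ℂ) * shadow f P o a b *
      (outcomeAmp P o u * star (outcomeAmp P o v)) =
      (meanFactor f * compat f a * compat f b : ℝ) * (u a * star (v b)) := by
  have h : (((Real.sqrt 2)⁻¹ : ℝ) : ℂ) * (((Real.sqrt 2)⁻¹ : ℝ) : ℂ) = 2⁻¹ := by
    rw [← Complex.ofReal_mul, inv_sqrt_two_mul]; simp
  cases f with
  | some t =>
    simp only [Fin.sum_univ_three, outcomeAmp_two]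
    cases t <;> cases a <;> cases b <;> simp [pauliWeight, shadow, meanFactor, compat]
  | none =>
    have e0 : ∀ o, outcomeAmp 0 o u * star (outcomeAmp 0 o v) =
        2⁻¹ * ((u false + (sign o : ℂ) * u true) * star (v false + (sign o : ℂ) * v true)) := by
      intro o; rw [outcomeAmp_zero, outcomeAmp_zero, ← h]; simp; ring
    have e1 : ∀ o, outcomeAmp 1 o u * star (outcomeAmp 1 o v) =
        2⁻¹ * ((u false - (sign o : ℂ) * Complex.I * u true) *
          star (v false - (sign o : ℂ) * Complex.I * v true)) := by
      intro o; rw [outcomeAmp_one, outcomeAmp_one, ← h]; simp; ring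
    simp only [Fin.sum_univ_three, outcomeAmp_two, e0, e1]
    have hI := Complex.I_mul_I
    cases a <;> cases b <;>
      simp [pauliWeight, shadow, meanFactor, compat, entry, bitInt, sign,
        GaussianInt.toComplex_def] <;> ring_nf <;> simp only [Complex.I_sq] <;> ring

/-- The one-qubit estimator has operator norm at most `4`. -/
theorem shadow_opNorm_qubit (P : Fin 3) (o : Bool) (u : Bool → ℂ) :
    ∑ a, ‖∑ b, shadow none P o a b * u b‖ ^ 2 ≤ 16 * ∑ a, ‖u a‖ ^ 2 := by
  fin_cases P <;> cases o <;>
    simp [shadow, entry, bitInt, GaussianInt.toComplex_def, sq_norm_eq] <;>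
    nlinarith [sq_nonneg ((u true).re - (u false).re), sq_nonneg ((u true).re + (u false).re),
      sq_nonneg ((u true).im - (u false).im), sq_nonneg ((u true).im + (u false).im),
      sq_nonneg ((u true).re - (u false).im), sq_nonneg ((u true).re + (u false).im),
      sq_nonneg ((u true).im - (u false).re), sq_nonneg ((u true).im + (u false).re),
      sq_nonneg (u true).re, sq_nonneg (u true).im, sq_nonneg (u false).re,
      sq_nonneg (u false).im]

/-- The Cauchy–Schwarz inequality with weights. -/
theorem sum_mul_sq_le {ι : Type*} [Fintype ι] (c : ι → ℝ) (hc : ∀ i, 0 ≤ c i) (u v : ι → ℂ) :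
    ‖∑ i, (c i : ℂ) * (u i * star (v i))‖ ^ 2 ≤
      (∑ i, c i * ‖u i‖ ^ 2) * ∑ i, c i * ‖v i‖ ^ 2 := by
  have h1 : ‖∑ i, (c i : ℂ) * (u i * star (v i))‖ ≤
      ∑ i, (Real.sqrt (c i) * ‖u i‖) * (Real.sqrt (c i) * ‖v i‖) := by
    refine (norm_sum_le _ _).trans (Finset.sum_le_sum fun i _ => le_of_eq ?_)
    rw [norm_mul, norm_mul, norm_star, Complex.norm_real, Real.norm_of_nonneg (hc i)]
    nth_rewrite 1 [← Real.mul_self_sqrt (hc i)]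
    ring
  have h2 := Finset.sum_mul_sq_le_sq_mul_sq Finset.univ (fun i => Real.sqrt (c i) * ‖u i‖)
    (fun i => Real.sqrt (c i) * ‖v i‖)
  refine (pow_le_pow_left₀ (norm_nonneg _) h1 2).trans (h2.trans (le_of_eq ?_))
  simp only [mul_pow, Real.sq_sqrt (hc _)]

/-- A Bloch vector has length at most `1`. -/
theorem sum_sq_bloch_le {ι : Type*} [Fintype ι] (c : ι → ℝ) (hc : ∀ i, 0 ≤ c i)
    (ψ : ι → Bool → ℂ) :
    ∑ P, (∑ i, c i * bloch P (ψ i)) ^ 2 ≤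
      (∑ i, c i * (‖ψ i false‖ ^ 2 + ‖ψ i true‖ ^ 2)) ^ 2 := by
  have h := sum_mul_sq_le c hc (fun i => ψ i false) (fun i => ψ i true)
  set G := ∑ i, (c i : ℂ) * (ψ i false * star (ψ i true)) with hG
  set p := ∑ i, c i * ‖ψ i false‖ ^ 2 with hp
  set q := ∑ i, c i * ‖ψ i true‖ ^ 2 with hq
  have e0 : ∑ i, c i * bloch 0 (ψ i) = 2 * G.re := by
    rw [hG, Complex.re_sum, Finset.mul_sum]
    refine Finset.sum_congr rfl fun i _ => ?_
    rw [Complex.re_ofReal_mul]; simp only [bloch, Matrix.cons_val_zero]; ring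
  have e1 : ∑ i, c i * bloch 1 (ψ i) = -2 * G.im := by
    rw [hG, Complex.im_sum, Finset.mul_sum]
    refine Finset.sum_congr rfl fun i _ => ?_
    rw [Complex.im_ofReal_mul]; simp only [bloch, Matrix.cons_val_one, Matrix.cons_val_zero]; ring
  have e2 : ∑ i, c i * bloch 2 (ψ i) = p - q := by
    rw [hp, hq, ← Finset.sum_sub_distrib]
    refine Finset.sum_congr rfl fun i _ => ?_
    simp only [bloch, Matrix.cons_val]; ring
  have e3 : ∑ i, c i * (‖ψ i false‖ ^ 2 + ‖ψ i true‖ ^ 2) = p + q := by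
    rw [hp, hq, ← Finset.sum_add_distrib]
    exact Finset.sum_congr rfl fun i _ => by ring
  rw [Fin.sum_univ_three, e0, e1, e2, e3]
  rw [sq_norm_eq] at h
  nlinarith

theorem le_half_mul_add_of_sq_le {t a b x : ℝ} (ht : 0 ≤ t) (ha : 0 ≤ a) (hb : 0 ≤ b)
    (h : x ^ 2 ≤ t ^ 2 * (a * b)) : x ≤ t * (a + b) / 2 := by
  refine (abs_le_of_sq_le_sq' (h.trans ?_) (by positivity)).2
  have := mul_nonneg (sq_nonneg t) (sq_nonneg (a - b))
  linarith [show (t * (a + b) / 2) ^ 2 = t ^ 2 * (a * b) + t ^ 2 * (a - b) ^ 2 / 4 by ring]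

/-- The second moment for one random qubit. The three components of the Bloch vector of the state
enter linearly, and their squares add up to at most `1`; this is why the factor is `8` and not
`12`, which one would get from bounding the probabilities of the outcomes by `1`. -/
theorem secondMoment_qubit_none {ι κ : Type*} [Fintype ι] [Fintype κ] (c : ι → ℝ)
    (hc : ∀ i, 0 ≤ c i) (ψ : ι → Bool → ℂ) (m : κ → Bool → Bool → ℂ) :
    ∑ P : Fin 3, ∑ o, (1 / 3 : ℝ) * ((∑ i, c i * ‖outcomeAmp P o (ψ i)‖ ^ 2) *
      ∑ j, ‖∑ a, ∑ b, shadow none P o a b * m j a b‖ ^ 2) ≤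
    8 * ((∑ i, c i * (‖ψ i false‖ ^ 2 + ‖ψ i true‖ ^ 2)) *
      ∑ j, ∑ a, ∑ b, ‖m j a b‖ ^ 2) := by
  set t := ∑ i, c i * (‖ψ i false‖ ^ 2 + ‖ψ i true‖ ^ 2) with ht
  have ht0 : 0 ≤ t := Finset.sum_nonneg fun i _ => mul_nonneg (hc i) (by positivity)
  set r : Fin 3 → ℝ := fun P => ∑ i, c i * bloch P (ψ i) with hr
  have hr2 : ∑ P, r P ^ 2 ≤ t ^ 2 := sum_sq_bloch_le c hc ψ
  set d : κ → ℂ := fun j => m j false false + m j true true with hd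
  set Q := ∑ j, ‖d j‖ ^ 2 with hQ
  set S : Fin 3 → ℝ := fun P => ∑ j, ‖pauliPart P (m j)‖ ^ 2 with hS
  set J : Fin 3 → ℝ := fun P => ∑ j, (d j * star (pauliPart P (m j))).re with hJ
  have hQ0 : 0 ≤ Q := Finset.sum_nonneg fun _ _ => by positivity
  have hS0 : ∀ P, 0 ≤ S P := fun P => Finset.sum_nonneg fun _ _ => by positivity
  have hJ2 : ∀ P, J P ^ 2 ≤ Q * S P := by
    intro P
    have h := sum_mul_sq_le (fun _ : κ => (1 : ℝ)) (fun _ => zero_le_one) d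
      (fun j => pauliPart P (m j))
    simp only [Complex.ofReal_one, one_mul] at h
    refine le_trans ?_ h
    rw [hJ, sq_norm_eq]
    simp only [← Complex.re_sum]
    nlinarith [mul_self_nonneg (∑ j, d j * star (pauliPart P (m j))).im]
  have hA : ∀ P o, ∑ i, c i * ‖outcomeAmp P o (ψ i)‖ ^ 2 = (t + sign o * r P) / 2 := by
    intro P o
    rw [ht, hr, Finset.mul_sum, ← Finset.sum_add_distrib, Finset.sum_div]
    refine Finset.sum_congr rfl fun i _ => ?_
    rw [sq_norm_outcomeAmp]; ring
  have hB : ∀ P o, ∑ j, ‖∑ a, ∑ b, shadow none P o a b * m j a b‖ ^ 2 =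
      Q + 9 * S P + 6 * sign o * J P := by
    intro P o
    rw [hQ, hS, hJ, Finset.mul_sum, Finset.mul_sum, ← Finset.sum_add_distrib,
      ← Finset.sum_add_distrib]
    refine Finset.sum_congr rfl fun j _ => ?_
    rw [sum_shadow_none]
    cases o <;> simp [sign, sq_norm_eq, hd] <;> ring
  have hM : 2 * ∑ j, ∑ a, ∑ b, ‖m j a b‖ ^ 2 = Q + ∑ P, S P := by
    rw [hQ, hS, Finset.mul_sum, Finset.sum_comm, ← Finset.sum_add_distrib]
    exact Finset.sum_congr rfl fun j _ => (sq_norm_pauliPart (m j)).symm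
  have hrJ : ∑ P, r P * J P ≤ t * (Q + ∑ P, S P) / 2 := by
    have h1 := Finset.sum_mul_sq_le_sq_mul_sq Finset.univ r J
    have h2 : ∑ P, J P ^ 2 ≤ Q * ∑ P, S P := by
      rw [Finset.mul_sum]; exact Finset.sum_le_sum fun P _ => hJ2 P
    have hSs : 0 ≤ ∑ P, S P := Finset.sum_nonneg fun P _ => hS0 P
    have h3 : (∑ P, r P * J P) ^ 2 ≤ t ^ 2 * (Q * ∑ P, S P) :=
      h1.trans (mul_le_mul hr2 h2 (Finset.sum_nonneg fun _ _ => sq_nonneg _) (sq_nonneg _))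
    exact le_half_mul_add_of_sq_le ht0 hQ0 hSs h3
  have hsum : ∑ P : Fin 3, ∑ o, (1 / 3 : ℝ) * ((∑ i, c i * ‖outcomeAmp P o (ψ i)‖ ^ 2) *
      ∑ j, ‖∑ a, ∑ b, shadow none P o a b * m j a b‖ ^ 2) =
      t * Q + 3 * t * ∑ P, S P + 2 * ∑ P, r P * J P := by
    simp only [hA, hB]
    simp only [Fin.sum_univ_three, Fintype.sum_bool, sign]
    simp; ring
  rw [hsum]
  have hSs : 0 ≤ ∑ P, S P := Finset.sum_nonneg fun P _ => hS0 P
  have e : 8 * (t * ∑ j, ∑ a, ∑ b, ‖m j a b‖ ^ 2) = 4 * t * (Q + ∑ P, S P) := by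
    rw [← hM]; ring
  rw [e]
  nlinarith [mul_nonneg ht0 hQ0, mul_nonneg ht0 hSs]

/-! ### Several qubits -/

theorem sum_fin_succ_pi {α E : Type*} [Fintype α] [AddCommMonoid E] {n : ℕ}
    (F : (Fin (n + 1) → α) → E) : ∑ f, F f = ∑ a, ∑ g : Fin n → α, F (Fin.cons a g) := by
  rw [← Fintype.sum_prod_type']
  exact (Fintype.sum_equiv (Fin.consEquiv fun _ => α) _ _ fun p => rfl).symm

section

variable {n : ℕ}

/-- The product of the one-qubit estimators. -/
noncomputable def shadowProd (f : Fin n → Option Bool) (P : Fin n → Fin 3) (o z z' : Fin n → Bool) :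
    ℂ := ∏ l, shadow (f l) (P l) (o l) (z l) (z' l)

/-- Probability of a choice of bases. -/
noncomputable def basisWeight (f : Fin n → Option Bool) (P : Fin n → Fin 3) : ℝ :=
  ∏ l, pauliWeight (f l) (P l)

/-- Whether a label has the prescribed bits. -/
def compatProd (f : Fin n → Option Bool) (z : Fin n → Bool) : ℝ := ∏ l, compat (f l) (z l)

/-- Amplitude of an outcome of the measurement in a product basis. -/
noncomputable def productAmp (P : Fin n → Fin 3) (o : Fin n → Bool) (ψ : (Fin n → Bool) → ℂ) : ℂ :=
  ∑ y, (∏ l, star ((pauli (P l)).eigenvector (o l) (y l))) * ψ y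

/-- Number of qubits without a prescribed bit. -/
def freeCount (f : Fin n → Option Bool) : ℕ := ∑ l, if f l = none then 1 else 0

theorem productAmp_cons (P₀ : Fin 3) (P : Fin n → Fin 3) (o₀ : Bool) (o : Fin n → Bool)
    (ψ : (Fin (n + 1) → Bool) → ℂ) :
    productAmp (Fin.cons P₀ P : Fin (n + 1) → Fin 3) (Fin.cons o₀ o : Fin (n + 1) → Bool) ψ =
      productAmp P o fun y => outcomeAmp P₀ o₀ fun x => ψ (Fin.cons x y) := by
  simp only [productAmp, outcomeAmp, sum_fin_succ_pi, Fin.prod_univ_succ, Fin.cons_zero,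
    Fin.cons_succ, Finset.mul_sum]
  rw [Finset.sum_comm]
  exact Finset.sum_congr rfl fun _ _ => Finset.sum_congr rfl fun _ _ => by ring

theorem shadowProd_cons (f : Fin (n + 1) → Option Bool) (P₀ : Fin 3) (P : Fin n → Fin 3)
    (o₀ a b : Bool) (o z z' : Fin n → Bool) :
    shadowProd f (Fin.cons P₀ P : Fin (n + 1) → Fin 3) (Fin.cons o₀ o : Fin (n + 1) → Bool)
      (Fin.cons a z : Fin (n + 1) → Bool) (Fin.cons b z' : Fin (n + 1) → Bool) =
      shadow (f 0) P₀ o₀ a b * shadowProd (fun l => f l.succ) P o z z' := by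
  simp only [shadowProd, Fin.prod_univ_succ, Fin.cons_zero, Fin.cons_succ]

theorem basisWeight_cons (f : Fin (n + 1) → Option Bool) (P₀ : Fin 3) (P : Fin n → Fin 3) :
    basisWeight f (Fin.cons P₀ P : Fin (n + 1) → Fin 3) =
      pauliWeight (f 0) P₀ * basisWeight (fun l => f l.succ) P := by
  simp only [basisWeight, Fin.prod_univ_succ, Fin.cons_zero, Fin.cons_succ]

theorem compatProd_cons (f : Fin (n + 1) → Option Bool) (a : Bool) (z : Fin n → Bool) :
    compatProd f (Fin.cons a z : Fin (n + 1) → Bool) =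
      compat (f 0) a * compatProd (fun l => f l.succ) z := by
  simp only [compatProd, Fin.prod_univ_succ, Fin.cons_zero, Fin.cons_succ]

theorem freeCount_succ (f : Fin (n + 1) → Option Bool) :
    freeCount f = (if f 0 = none then 1 else 0) + freeCount fun l => f l.succ := by
  simp only [freeCount, Fin.sum_univ_succ]

theorem pauliWeight_nonneg (f : Option Bool) (P : Fin 3) : 0 ≤ pauliWeight f P := by
  cases f with
  | none => norm_num [pauliWeight]
  | some t => simp only [pauliWeight]; split_ifs <;> norm_num

theorem basisWeight_nonneg (f : Fin n → Option Bool) (P : Fin n → Fin 3) : 0 ≤ basisWeight f P :=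
  Finset.prod_nonneg fun _ _ => pauliWeight_nonneg _ _

theorem compat_nonneg (f : Option Bool) (a : Bool) : 0 ≤ compat f a := by
  cases f with
  | none => exact zero_le_one
  | some t => simp only [compat]; split_ifs <;> norm_num

theorem compatProd_nonneg (f : Fin n → Option Bool) (z : Fin n → Bool) : 0 ≤ compatProd f z :=
  Finset.prod_nonneg fun _ _ => compat_nonneg _ _

/-- The probabilities of the outcomes add up to the squared norm of the state. -/
theorem sum_sq_norm_productAmp : ∀ {n : ℕ} (P : Fin n → Fin 3) (ψ : (Fin n → Bool) → ℂ),
    ∑ o, ‖productAmp P o ψ‖ ^ 2 = ∑ y, ‖ψ y‖ ^ 2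
  | 0, P, ψ => by simp [productAmp]
  | n + 1, P, ψ => by
    have ih := sum_sq_norm_productAmp (Fin.tail P)
    have hP : P = Fin.cons (P 0) (Fin.tail P) := (Fin.cons_self_tail P).symm
    generalize P 0 = P₀ at hP
    generalize Fin.tail P = P' at hP ih
    subst hP
    simp only [sum_fin_succ_pi, productAmp_cons, ih]
    rw [Finset.sum_comm, Finset.sum_comm (s := (Finset.univ : Finset Bool))]
    exact Finset.sum_congr rfl fun y _ => sum_sq_norm_outcomeAmp P₀ fun x => ψ (Fin.cons x y)

/-- The estimator is unbiased. -/
theorem mean_shadowProd : ∀ {n : ℕ} (f : Fin n → Option Bool) (ψ : (Fin n → Bool) → ℂ)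
    (z z' : Fin n → Bool),
    ∑ P, ∑ o, ((basisWeight f P * ‖productAmp P o ψ‖ ^ 2 : ℝ) : ℂ) * shadowProd f P o z z' =
      (2 ^ freeCount f * compatProd f z * compatProd f z' : ℝ) * (ψ z * star (ψ z'))
  | 0, f, ψ, z, z' => by
    have hp : ∀ P o, productAmp P o ψ = ψ z := fun P o => by
      rw [productAmp, Fintype.sum_subsingleton _ z]; simp
    rw [Subsingleton.elim z' z]
    simp only [hp]
    simp only [Finset.univ_unique, Finset.sum_singleton, basisWeight, shadowProd,
      compatProd, freeCount, Finset.univ_eq_empty, Finset.prod_empty, Finset.sum_empty]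
    simp [← Complex.mul_conj']
  | n + 1, f, ψ, z, z' => by
    obtain ⟨a, z, rfl⟩ : ∃ a w, z = Fin.cons a w := ⟨z 0, Fin.tail z, (Fin.cons_self_tail z).symm⟩
    obtain ⟨b, z', rfl⟩ : ∃ b w, z' = Fin.cons b w :=
      ⟨z' 0, Fin.tail z', (Fin.cons_self_tail z').symm⟩
    have ih := fun P₀ o₀ => mean_shadowProd (fun l => f l.succ)
      (fun y => outcomeAmp P₀ o₀ fun x => ψ (Fin.cons x y)) z z'
    have hq := mean_shadow_qubit (f 0) (fun x => ψ (Fin.cons x z)) (fun x => ψ (Fin.cons x z')) a b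
    have hfac : (2 : ℝ) ^ freeCount f = meanFactor (f 0) * 2 ^ freeCount fun l => f l.succ := by
      rw [freeCount_succ, pow_add]
      cases f 0 <;> simp [meanFactor]
    calc _ = ∑ P₀, ∑ o₀, (pauliWeight (f 0) P₀ : ℂ) * shadow (f 0) P₀ o₀ a b *
          ∑ P, ∑ o, ((basisWeight (fun l => f l.succ) P * ‖productAmp P o
            fun y => outcomeAmp P₀ o₀ fun x => ψ (Fin.cons x y)‖ ^ 2 : ℝ) : ℂ) *
            shadowProd (fun l => f l.succ) P o z z' := by
          simp only [sum_fin_succ_pi, productAmp_cons, shadowProd_cons, basisWeight_cons,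
            Finset.mul_sum]
          refine Finset.sum_congr rfl fun P₀ _ => ?_
          rw [Finset.sum_comm]
          refine Finset.sum_congr rfl fun o₀ _ => Finset.sum_congr rfl fun P _ =>
            Finset.sum_congr rfl fun o _ => ?_
          push_cast; ring
      _ = (2 ^ freeCount (fun l => f l.succ) * compatProd (fun l => f l.succ) z *
            compatProd (fun l => f l.succ) z' : ℝ) *
          ∑ P₀, ∑ o₀, (pauliWeight (f 0) P₀ : ℂ) * shadow (f 0) P₀ o₀ a b *
            (outcomeAmp P₀ o₀ (fun x => ψ (Fin.cons x z)) *
              star (outcomeAmp P₀ o₀ fun x => ψ (Fin.cons x z'))) := by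
          simp only [ih, Finset.mul_sum]
          exact Finset.sum_congr rfl fun P₀ _ => Finset.sum_congr rfl fun o₀ _ => by ring
      _ = _ := by
          rw [hq, hfac, compatProd_cons, compatProd_cons]
          push_cast; ring

/-- The second moment of a linear functional `m` of the estimator. The induction measures the
qubits one by one; the rest of the system is in the pure state that belongs to the outcome, and the
functional is replaced by its partial contraction. -/
theorem secondMoment_shadowProd : ∀ {n : ℕ} (f : Fin n → Option Bool) (ψ : (Fin n → Bool) → ℂ)
    (m : (Fin n → Bool) → (Fin n → Bool) → ℂ),
    ∑ P, ∑ o, basisWeight f P * (‖productAmp P o ψ‖ ^ 2 *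
      ‖∑ z, ∑ z', shadowProd f P o z z' * m z z'‖ ^ 2) ≤
      8 ^ freeCount f * ((∑ z, compatProd f z * ‖ψ z‖ ^ 2) * ∑ z, ∑ z', ‖m z z'‖ ^ 2)
  | 0, f, ψ, m => by
    simp [basisWeight, productAmp, shadowProd, compatProd, freeCount]
  | n + 1, f, ψ, m => by
    set f' : Fin n → Option Bool := fun l => f l.succ with hf'
    have ih := fun P₀ o₀ => secondMoment_shadowProd f'
      (fun y => outcomeAmp P₀ o₀ fun x => ψ (Fin.cons x y))
      (fun z z' => ∑ a, ∑ b, shadow (f 0) P₀ o₀ a b * m (Fin.cons a z) (Fin.cons b z'))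
    have hstep : ∑ P, ∑ o, basisWeight f P * (‖productAmp P o ψ‖ ^ 2 *
        ‖∑ z, ∑ z', shadowProd f P o z z' * m z z'‖ ^ 2) =
        ∑ P₀, ∑ o₀, pauliWeight (f 0) P₀ * ∑ P, ∑ o, basisWeight f' P *
          (‖productAmp P o fun y => outcomeAmp P₀ o₀ fun x => ψ (Fin.cons x y)‖ ^ 2 *
          ‖∑ z, ∑ z', shadowProd f' P o z z' *
            ∑ a, ∑ b, shadow (f 0) P₀ o₀ a b * m (Fin.cons a z) (Fin.cons b z')‖ ^ 2) := by
      have hcontract : ∀ P₀ o₀ P o, ∑ a, ∑ z, ∑ b, ∑ z', shadow (f 0) P₀ o₀ a b *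
          shadowProd f' P o z z' * m (Fin.cons a z) (Fin.cons b z') =
          ∑ z, ∑ z', shadowProd f' P o z z' *
            ∑ a, ∑ b, shadow (f 0) P₀ o₀ a b * m (Fin.cons a z) (Fin.cons b z') := by
        intro P₀ o₀ P o
        rw [Finset.sum_comm]
        refine Finset.sum_congr rfl fun z _ => ?_
        simp only [Finset.mul_sum]
        rw [Finset.sum_comm (s := (Finset.univ : Finset (Fin n → Bool)))]
        refine Finset.sum_congr rfl fun a _ => ?_
        rw [Finset.sum_comm]
        exact Finset.sum_congr rfl fun z' _ => Finset.sum_congr rfl fun b _ => by ring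
      simp only [sum_fin_succ_pi, productAmp_cons, shadowProd_cons, basisWeight_cons,
        ← hf', hcontract]
      refine Finset.sum_congr rfl fun P₀ _ => ?_
      rw [Finset.sum_comm]
      refine Finset.sum_congr rfl fun o₀ _ => ?_
      rw [Finset.mul_sum]
      refine Finset.sum_congr rfl fun P _ => ?_
      rw [Finset.mul_sum]
      exact Finset.sum_congr rfl fun o _ => by ring
    rw [hstep]
    have hle : ∑ P₀, ∑ o₀, pauliWeight (f 0) P₀ * ∑ P, ∑ o, basisWeight f' P *
          (‖productAmp P o fun y => outcomeAmp P₀ o₀ fun x => ψ (Fin.cons x y)‖ ^ 2 *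
          ‖∑ z, ∑ z', shadowProd f' P o z z' *
            ∑ a, ∑ b, shadow (f 0) P₀ o₀ a b * m (Fin.cons a z) (Fin.cons b z')‖ ^ 2) ≤
        8 ^ freeCount f' * ∑ P₀, ∑ o₀, pauliWeight (f 0) P₀ *
          ((∑ z, compatProd f' z * ‖outcomeAmp P₀ o₀ fun x => ψ (Fin.cons x z)‖ ^ 2) *
          ∑ p : (Fin n → Bool) × (Fin n → Bool), ‖∑ a, ∑ b, shadow (f 0) P₀ o₀ a b *
            m (Fin.cons a p.1) (Fin.cons b p.2)‖ ^ 2) := by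
      simp only [Finset.mul_sum (a := (8 : ℝ) ^ freeCount f')]
      refine Finset.sum_le_sum fun P₀ _ => Finset.sum_le_sum fun o₀ _ => ?_
      rw [Fintype.sum_prod_type, mul_left_comm]
      exact mul_le_mul_of_nonneg_left (ih P₀ o₀) (pauliWeight_nonneg _ _)
    refine hle.trans ?_
    have hm : ∑ z, ∑ z', ‖m z z'‖ ^ 2 = ∑ p : (Fin n → Bool) × (Fin n → Bool),
        ∑ a, ∑ b, ‖m (Fin.cons a p.1) (Fin.cons b p.2)‖ ^ 2 := by
      rw [Fintype.sum_prod_type]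
      simp only [sum_fin_succ_pi]
      rw [Finset.sum_comm]
      refine Finset.sum_congr rfl fun z _ => ?_
      rw [Finset.sum_comm (s := (Finset.univ : Finset (Fin n → Bool)))]
      exact Finset.sum_congr rfl fun a _ => Finset.sum_comm
    have hψ : ∑ z, compatProd f z * ‖ψ z‖ ^ 2 =
        ∑ z, compatProd f' z * ∑ a, compat (f 0) a * ‖ψ (Fin.cons a z)‖ ^ 2 := by
      simp only [sum_fin_succ_pi, compatProd_cons, Finset.mul_sum]
      rw [Finset.sum_comm]
      exact Finset.sum_congr rfl fun z _ => Finset.sum_congr rfl fun a _ => by rw [← hf']; ring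
    rw [hm, hψ, freeCount_succ, pow_add, mul_comm ((8 : ℝ) ^ (if f 0 = none then 1 else 0)),
      mul_assoc]
    refine mul_le_mul_of_nonneg_left ?_ (by positivity)
    have hc := compatProd_nonneg f'
    cases hf0 : f 0 with
    | none =>
      have h := secondMoment_qubit_none (compatProd f') hc
        (fun z x => ψ (Fin.cons x z))
        (fun (p : (Fin n → Bool) × (Fin n → Bool)) a b => m (Fin.cons a p.1) (Fin.cons b p.2))
      simp only [pauliWeight]
      refine h.trans (le_of_eq ?_)
      simp only [if_true, pow_one, compat, one_mul, Fintype.sum_bool]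
      congr 2
      exact Finset.sum_congr rfl fun z _ => by ring
    | some t =>
      -- only the outcome `t` of the measurement of `Z` contributes
      have e1 : ∀ P₀ o₀ (p : (Fin n → Bool) × (Fin n → Bool)),
          ∑ a, ∑ b, shadow (some t) P₀ o₀ a b * m (Fin.cons a p.1) (Fin.cons b p.2) =
          if o₀ = t then m (Fin.cons t p.1) (Fin.cons t p.2) else 0 := by
        intro P₀ o₀ p
        cases t <;> cases o₀ <;> simp [shadow]
      have e2 : ∑ P₀, ∑ o₀, pauliWeight (some t) P₀ *
          ((∑ z, compatProd f' z * ‖outcomeAmp P₀ o₀ fun x => ψ (Fin.cons x z)‖ ^ 2) *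
          ∑ p : (Fin n → Bool) × (Fin n → Bool), ‖∑ a, ∑ b, shadow (some t) P₀ o₀ a b *
            m (Fin.cons a p.1) (Fin.cons b p.2)‖ ^ 2) =
          (∑ z, compatProd f' z * ‖ψ (Fin.cons t z)‖ ^ 2) *
            ∑ p : (Fin n → Bool) × (Fin n → Bool), ‖m (Fin.cons t p.1) (Fin.cons t p.2)‖ ^ 2 := by
        simp only [e1]
        simp only [Fin.sum_univ_three, pauliWeight, outcomeAmp_two]
        cases t <;> simp
      rw [e2]
      simp only [reduceCtorEq, if_false, pow_zero, one_mul, compat]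
      refine mul_le_mul ?_ ?_ (Finset.sum_nonneg fun _ _ => by positivity)
        (Finset.sum_nonneg fun z _ => mul_nonneg (hc z)
          (Finset.sum_nonneg fun a _ => by positivity))
      · refine Finset.sum_le_sum fun z _ => mul_le_mul_of_nonneg_left ?_ (hc z)
        cases t <;> simp
      · refine Finset.sum_le_sum fun p _ => ?_
        refine le_trans ?_ (Finset.single_le_sum (f := fun a => ∑ b, ‖m (Fin.cons a p.1)
          (Fin.cons b p.2)‖ ^ 2) (fun a _ => Finset.sum_nonneg fun b _ => by positivity)
          (Finset.mem_univ t))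
        exact Finset.single_le_sum (f := fun b => ‖m (Fin.cons t p.1) (Fin.cons b p.2)‖ ^ 2)
          (fun b _ => by positivity) (Finset.mem_univ t)

/-- The estimator has operator norm at most `4` per qubit without a prescribed bit. -/
theorem opNorm_shadowProd : ∀ {n : ℕ} (f : Fin n → Option Bool) (P : Fin n → Fin 3)
    (o : Fin n → Bool) (b : (Fin n → Bool) → ℂ),
    ∑ z, ‖∑ z', shadowProd f P o z z' * b z'‖ ^ 2 ≤ 16 ^ freeCount f * ∑ z, ‖b z‖ ^ 2
  | 0, f, P, o, b => by simp [shadowProd, freeCount]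
  | n + 1, f, P, o, b => by
    obtain ⟨P₀, P, rfl⟩ : ∃ P₀ P', P = Fin.cons P₀ P' :=
      ⟨P 0, Fin.tail P, (Fin.cons_self_tail P).symm⟩
    obtain ⟨o₀, o, rfl⟩ : ∃ a w, o = Fin.cons a w := ⟨o 0, Fin.tail o, (Fin.cons_self_tail o).symm⟩
    set f' : Fin n → Option Bool := fun l => f l.succ with hf'
    have ih := fun a => opNorm_shadowProd f' P o fun z' => ∑ c, shadow (f 0) P₀ o₀ a c *
      b (Fin.cons c z')
    have hq : ∀ u : Bool → ℂ, ∑ a, ‖∑ c, shadow (f 0) P₀ o₀ a c * u c‖ ^ 2 ≤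
        16 ^ (if f 0 = none then 1 else 0) * ∑ a, ‖u a‖ ^ 2 := by
      intro u
      cases hf0 : f 0 with
      | none => simpa using shadow_opNorm_qubit P₀ o₀ u
      | some t =>
        have h0 := sq_nonneg ‖u true‖
        have h1 := sq_nonneg ‖u false‖
        cases t <;> cases o₀ <;> simp [shadow] <;> nlinarith
    calc _ = ∑ a, ∑ z, ‖∑ z', shadowProd f' P o z z' *
          ∑ c, shadow (f 0) P₀ o₀ a c * b (Fin.cons c z')‖ ^ 2 := by
          simp only [sum_fin_succ_pi, shadowProd_cons, ← hf']
          refine Finset.sum_congr rfl fun a _ => Finset.sum_congr rfl fun z _ => ?_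
          rw [Finset.sum_comm]
          simp only [Finset.mul_sum]
          congr 2
          exact Finset.sum_congr rfl fun z' _ => Finset.sum_congr rfl fun c _ => by ring
      _ ≤ ∑ a, 16 ^ freeCount f' * ∑ z, ‖∑ c, shadow (f 0) P₀ o₀ a c * b (Fin.cons c z)‖ ^ 2 :=
          Finset.sum_le_sum fun a _ => ih a
      _ = 16 ^ freeCount f' * ∑ z, ∑ a, ‖∑ c, shadow (f 0) P₀ o₀ a c * b (Fin.cons c z)‖ ^ 2 := by
          rw [← Finset.mul_sum, Finset.sum_comm]
      _ ≤ 16 ^ freeCount f' * ∑ z, 16 ^ (if f 0 = none then 1 else 0) *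
            ∑ a, ‖b (Fin.cons a z)‖ ^ 2 := by
          gcongr with z _
          exact hq fun c => b (Fin.cons c z)
      _ = _ := by
          rw [← Finset.mul_sum, freeCount_succ, pow_add, sum_fin_succ_pi, Finset.sum_comm,
            ← mul_assoc, mul_comm (16 ^ freeCount f' : ℝ), ← hf']

/-- The quadratic form of the estimator at vectors of norm at most one is bounded by its operator
norm. -/
theorem norm_shadowProd_form_le (f : Fin n → Option Bool) (P : Fin n → Fin 3) (o : Fin n → Bool)
    (a b : (Fin n → Bool) → ℂ) (ha : ∑ z, ‖a z‖ ^ 2 ≤ 1) (hb : ∑ z, ‖b z‖ ^ 2 ≤ 1) :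
    ‖∑ z, ∑ z', shadowProd f P o z z' * (star (a z) * b z')‖ ≤ 4 ^ freeCount f := by
  have h := opNorm_shadowProd f P o b
  have h2 := sum_mul_sq_le (fun _ : Fin n → Bool => (1 : ℝ)) (fun _ => zero_le_one)
    (fun z => ∑ z', shadowProd f P o z z' * b z') a
  simp only [Complex.ofReal_one, one_mul] at h2
  have e : ∑ z, ∑ z', shadowProd f P o z z' * (star (a z) * b z') =
      ∑ z, (∑ z', shadowProd f P o z z' * b z') * star (a z) := by
    refine Finset.sum_congr rfl fun z _ => ?_
    rw [Finset.sum_mul]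
    exact Finset.sum_congr rfl fun z' _ => by ring
  rw [e]
  refine abs_le_of_sq_le_sq' ?_ (by positivity) |>.2
  refine h2.trans ?_
  have e4 : ((4 : ℝ) ^ freeCount f) ^ 2 = 16 ^ freeCount f := by
    rw [← pow_mul, mul_comm, pow_mul]; norm_num
  rw [e4]
  calc _ ≤ (16 ^ freeCount f * ∑ z, ‖b z‖ ^ 2) * 1 := by
        refine mul_le_mul h ha (Finset.sum_nonneg fun _ _ => by positivity) ?_
        exact mul_nonneg (by positivity) (Finset.sum_nonneg fun _ _ => by positivity)
    _ ≤ (16 ^ freeCount f * 1) * 1 := by gcongr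
    _ = _ := by ring

end

/-! ### Concentration for independent observations -/

section

variable {J A : Type*} [Fintype J] [DecidableEq J] [Fintype A]

open Classical in
/-- Probability of an event when the observations `d j` are independent with laws `μ j`. -/
noncomputable def prob (μ : J → A → ℝ) (B : (J → A) → Prop) : ℝ :=
  ∑ d, if B d then ∏ j, μ j (d j) else 0

variable {μ : J → A → ℝ}

theorem prob_mono (hμ : ∀ j a, 0 ≤ μ j a) {B B' : (J → A) → Prop} (h : ∀ d, B d → B' d) :
    prob μ B ≤ prob μ B' := by
  classical
  refine Finset.sum_le_sum fun d _ => ?_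
  have := Finset.prod_nonneg fun j (_ : j ∈ Finset.univ) => hμ j (d j)
  by_cases h1 : B d
  · simp [h1, h d h1]
  · by_cases h2 : B' d <;> simp [h1, h2, this]

theorem prob_exists_le (hμ : ∀ j a, 0 ≤ μ j a) {ι : Type*} (s : Finset ι)
    (B : ι → (J → A) → Prop) : prob μ (fun d => ∃ i ∈ s, B i d) ≤ ∑ i ∈ s, prob μ (B i) := by
  classical
  unfold prob
  rw [Finset.sum_comm]
  refine Finset.sum_le_sum fun d _ => ?_
  have h0 := Finset.prod_nonneg fun j (_ : j ∈ Finset.univ) => hμ j (d j)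
  split_ifs with h
  · obtain ⟨i, hi, hB⟩ := h
    refine le_trans (by simp [hB]) (Finset.single_le_sum
      (f := fun i => if B i d then ∏ j, μ j (d j) else 0) (fun i _ => ?_) hi)
    split_ifs
    · exact h0
    · exact le_rfl
  · refine Finset.sum_nonneg fun i _ => ?_
    split_ifs
    · exact h0
    · exact le_rfl

theorem sum_prod_eq_one (hμ1 : ∀ j, ∑ a, μ j a = 1) : ∑ d : J → A, ∏ j, μ j (d j) = 1 := by
  rw [← Fintype.prod_sum]; simp [hμ1]

/-- Bernstein's inequality, with the free parameter `lam` of the exponential moment. -/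
theorem prob_sum_ge_le (hμ : ∀ j a, 0 ≤ μ j a) (hμ1 : ∀ j, ∑ a, μ j a = 1) (X : J → A → ℝ)
    {b m v η lam : ℝ} (hb : ∀ j a, |X j a| ≤ b) (hm : ∀ j, ∑ a, μ j a * X j a = m)
    (hv : ∀ j, ∑ a, μ j a * X j a ^ 2 ≤ v) (hl : 0 ≤ lam) (hlb : lam * b ≤ 1) :
    prob μ (fun d => (Fintype.card J : ℝ) * (m + η) ≤ ∑ j, X j (d j)) ≤
      Real.exp (-((Fintype.card J : ℝ) * (lam * η - lam ^ 2 * v))) := by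
  classical
  set R : ℝ := (Fintype.card J : ℝ) with hR
  -- the bound `exp x ≤ 1 + x + x ^ 2`, which holds for `|x| ≤ 1`
  have hmgf : ∀ j, ∑ a, μ j a * Real.exp (lam * X j a) ≤ Real.exp (lam * m + lam ^ 2 * v) := by
    intro j
    have h1 : ∀ a, Real.exp (lam * X j a) ≤ 1 + lam * X j a + (lam * X j a) ^ 2 := by
      intro a
      have h2 : |lam * X j a| ≤ 1 := by
        rw [abs_mul, abs_of_nonneg hl]
        exact (mul_le_mul_of_nonneg_left (hb j a) hl).trans hlb
      have := (abs_le.1 (Real.abs_exp_sub_one_sub_id_le h2)).2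
      linarith
    calc _ ≤ ∑ a, μ j a * (1 + lam * X j a + (lam * X j a) ^ 2) :=
          Finset.sum_le_sum fun a _ => mul_le_mul_of_nonneg_left (h1 a) (hμ j a)
      _ = ∑ a, μ j a + lam * ∑ a, μ j a * X j a + lam ^ 2 * ∑ a, μ j a * X j a ^ 2 := by
          rw [Finset.mul_sum, Finset.mul_sum, ← Finset.sum_add_distrib, ← Finset.sum_add_distrib]
          exact Finset.sum_congr rfl fun a _ => by ring
      _ ≤ 1 + lam * m + lam ^ 2 * v := by
          rw [hμ1, hm]
          have := mul_le_mul_of_nonneg_left (hv j) (sq_nonneg lam)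
          linarith
      _ ≤ _ := by
          have := Real.add_one_le_exp (lam * m + lam ^ 2 * v); linarith
  have h1 : prob μ (fun d => R * (m + η) ≤ ∑ j, X j (d j)) ≤
      ∑ d : J → A, (∏ j, μ j (d j)) * Real.exp (lam * (∑ j, X j (d j)) - lam * (R * (m + η))) := by
    refine Finset.sum_le_sum fun d _ => ?_
    have h0 := Finset.prod_nonneg fun j (_ : j ∈ Finset.univ) => hμ j (d j)
    split_ifs with h
    · refine le_mul_of_one_le_right h0 (Real.one_le_exp ?_)
      have := mul_le_mul_of_nonneg_left h hl
      linarith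
    · positivity
  have h2 : ∑ d : J → A, (∏ j, μ j (d j)) *
      Real.exp (lam * (∑ j, X j (d j)) - lam * (R * (m + η))) =
      Real.exp (-(lam * (R * (m + η)))) * ∏ j, ∑ a, μ j a * Real.exp (lam * X j a) := by
    rw [Fintype.prod_sum, Finset.mul_sum]
    refine Finset.sum_congr rfl fun d _ => ?_
    rw [Finset.prod_mul_distrib, ← Real.exp_sum, ← Finset.mul_sum, sub_eq_add_neg, Real.exp_add]
    ring
  have h3 : ∏ j, ∑ a, μ j a * Real.exp (lam * X j a) ≤
      ∏ _j : J, Real.exp (lam * m + lam ^ 2 * v) :=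
    Finset.prod_le_prod (fun j _ => Finset.sum_nonneg fun a _ => mul_nonneg (hμ j a)
      (Real.exp_pos _).le) fun j _ => hmgf j
  rw [← Real.exp_sum, Finset.sum_const, Finset.card_univ, nsmul_eq_mul, ← hR] at h3
  refine h1.trans (h2.trans_le ((mul_le_mul_of_nonneg_left h3 (Real.exp_pos _).le).trans
    (le_of_eq ?_)))
  rw [← Real.exp_add]
  congr 1
  ring

/-- It suffices to bound the conditional probabilities of an event, given the observations outside
a set of indices. -/
theorem prob_le_of_cond (hμ : ∀ j a, 0 ≤ μ j a) (hμ1 : ∀ j, ∑ a, μ j a = 1) (p : J → Prop)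
    [DecidablePred p] (B : (J → A) → Prop) {β : ℝ}
    (h : ∀ d₂ : {j // ¬ p j} → A, prob (fun j : {j // p j} => μ j) (fun d₁ =>
      B ((Equiv.piEquivPiSubtypeProd p fun _ => A).symm (d₁, d₂))) ≤ β) : prob μ B ≤ β := by
  classical
  set e := Equiv.piEquivPiSubtypeProd p fun _ : J => A with he
  have h1 : prob μ B = ∑ d₂ : {j // ¬ p j} → A, (∏ j : {j // ¬ p j}, μ j (d₂ j)) *
      prob (fun j : {j // p j} => μ j) (fun d₁ => B (e.symm (d₁, d₂))) := by
    unfold prob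
    rw [← e.symm.sum_comp, Fintype.sum_prod_type, Finset.sum_comm]
    refine Finset.sum_congr rfl fun d₂ _ => ?_
    rw [Finset.mul_sum]
    refine Finset.sum_congr rfl fun d₁ _ => ?_
    rw [mul_ite, mul_zero, ← Fintype.prod_subtype_mul_prod_subtype p
      fun j => μ j (e.symm (d₁, d₂) j)]
    have e1 : ∀ j : {j // p j}, e.symm (d₁, d₂) j = d₁ j := fun j => by
      simp [he, j.2]
    have e2 : ∀ j : {j // ¬ p j}, e.symm (d₁, d₂) j = d₂ j := fun j => by
      simp [he, j.2]
    simp only [e1, e2]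
    congr 1
    rw [mul_comm]
  rw [h1]
  calc _ ≤ ∑ d₂ : {j // ¬ p j} → A, (∏ j : {j // ¬ p j}, μ j (d₂ j)) * β :=
        Finset.sum_le_sum fun d₂ _ => mul_le_mul_of_nonneg_left (h d₂)
          (Finset.prod_nonneg fun j _ => hμ _ _)
    _ = β := by
        rw [← Finset.sum_mul, sum_prod_eq_one (μ := fun j : {j // ¬ p j} => μ j)
          fun j => hμ1 j, one_mul]

/-- Bernstein's inequality for a sum over the indices with property `p`, whose summands may
depend on the observations with the other indices. -/
theorem prob_sum_ge_le_of_indep (hμ : ∀ j a, 0 ≤ μ j a) (hμ1 : ∀ j, ∑ a, μ j a = 1) (p : J → Prop)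
    [DecidablePred p] (X : (J → A) → J → A → ℝ) (m v η lam : (J → A) → ℝ) {b β : ℝ} {R : ℕ}
    (hR : Fintype.card {j // p j} = R)
    (hX : ∀ d d', (∀ j, ¬ p j → d j = d' j) → X d = X d')
    (hb : ∀ d j a, |X d j a| ≤ b) (hm : ∀ d j, p j → ∑ a, μ j a * X d j a = m d)
    (hv : ∀ d j, p j → ∑ a, μ j a * X d j a ^ 2 ≤ v d) (hl : ∀ d, 0 ≤ lam d)
    (hlb : ∀ d, lam d * b ≤ 1)
    (hη : ∀ d d', (∀ j, ¬ p j → d j = d' j) → η d = η d')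
    (hβ : ∀ d, Real.exp (-(R * (lam d * η d - lam d ^ 2 * v d))) ≤ β) :
    prob μ (fun d => R * (m d + η d) ≤ ∑ j : {j // p j}, X d j (d j)) ≤ β := by
  classical
  refine prob_le_of_cond hμ hμ1 p _ fun d₂ => ?_
  set e := Equiv.piEquivPiSubtypeProd p fun _ : J => A with he
  by_cases hne : Nonempty ({j // p j} → A)
  · obtain ⟨d₁⟩ := hne
    set d₀ := e.symm (d₁, d₂) with hd₀
    have hag : ∀ d : {j // p j} → A, ∀ j, ¬ p j → e.symm (d, d₂) j = d₀ j := fun d j hj => by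
      simp [hd₀, he, hj]
    have hev : ∀ (d : {j // p j} → A) (j : {j // p j}), e.symm (d, d₂) j = d j := fun d j => by
      simp [he, j.2]
    have := prob_sum_ge_le (μ := fun j : {j // p j} => μ j) (fun j => hμ j) (fun j => hμ1 j)
      (fun j => X d₀ j) (b := b) (m := m d₀) (v := v d₀) (η := η d₀) (lam := lam d₀)
      (fun j a => hb _ _ _) (fun j => hm _ _ j.2) (fun j => hv _ _ j.2) (hl _) (hlb _)
    rw [hR] at this
    refine le_trans (prob_mono (μ := fun j : {j // p j} => μ j) (fun j => hμ j) fun d hd => ?_)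
      (this.trans (hβ d₀))
    have hXd := hX _ _ (hag d)
    have hmd : R * m (e.symm (d, d₂)) = R * m d₀ := by
      rw [← hR]
      by_cases hc : Nonempty {j // p j}
      · obtain ⟨j⟩ := hc
        rw [← hm _ _ j.2, ← hm _ _ j.2, hXd]
      · have : Fintype.card {j // p j} = 0 := Fintype.card_eq_zero_iff.2 (not_nonempty_iff.1 hc)
        simp [this]
    rw [mul_add, hmd, hη _ _ (hag d), hXd] at hd
    simp only [hev] at hd
    rw [mul_add]
    exact hd
  · have : prob (fun j : {j // p j} => μ j) (fun d₁ => R * (m (e.symm (d₁, d₂)) +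
        η (e.symm (d₁, d₂))) ≤ ∑ j : {j // p j}, X (e.symm (d₁, d₂)) j
          (e.symm (d₁, d₂) j)) = 0 := by
      unfold prob
      exact Finset.sum_eq_zero fun d _ => absurd ⟨d⟩ hne
    rw [this]
    have hJ : Nonempty (J → A) := by
      by_contra hcon
      have h1 := sum_prod_eq_one (μ := μ) hμ1
      rw [Finset.sum_eq_zero fun d _ => absurd ⟨d⟩ hcon] at h1
      exact zero_ne_one h1
    exact (Real.exp_pos _).le.trans (hβ hJ.some)

end

/-! ### Combining two halves -/

/-- Lagrange's identity for vectors with two coordinates. -/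
theorem lagrange_two (g₀ g₁ u₀ u₁ : ℂ) :
    (‖u₀‖ ^ 2 + ‖u₁‖ ^ 2) * (‖g₀‖ ^ 2 + ‖g₁‖ ^ 2) - ‖star g₀ * u₀ + star g₁ * u₁‖ ^ 2 =
      ‖g₀ * u₁ - g₁ * u₀‖ ^ 2 := by
  simp [sq_norm_eq]; ring

/-- A column of an approximation `G` of the rank one matrix `u u*` is nearly parallel to `u`,
if its diagonal entry is the largest one. -/
theorem column_almost_parallel (u : Bool → ℂ) (G : Bool → Bool → ℂ) (r : Bool) {θ U : ℝ}
    (hθ : 0 < θ) (hU : ‖u false‖ ^ 2 + ‖u true‖ ^ 2 = U)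
    (hG : ∀ i j, ‖G i j - u i * star (u j)‖ ≤ θ) (hr : (G (!r) (!r)).re ≤ (G r r).re)
    (hθU : 8 * θ ≤ U) :
    0 < (G r r).re ∧ ‖G false r * u true - G true r * u false‖ ^ 2 * U ≤
      15 * θ ^ 2 * (‖G false r‖ ^ 2 + ‖G true r‖ ^ 2) := by
  have hdiag : ∀ i, ‖u i‖ ^ 2 - θ ≤ (G i i).re := by
    intro i
    have h1 := (abs_le.1 ((Complex.abs_re_le_norm _).trans (hG i i))).1
    have h2 : (u i * star (u i)).re = ‖u i‖ ^ 2 := by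
      rw [sq_norm_eq]; simp
    rw [Complex.sub_re, h2] at h1
    linarith
  have hrr : 3 / 8 * U ≤ (G r r).re := by
    have h0 := hdiag r
    have h1 := hdiag (!r)
    have h2 : ‖u r‖ ^ 2 + ‖u (!r)‖ ^ 2 = U := by
      cases r
      · exact hU
      · rw [← hU, add_comm]; rfl
    by_cases h : U / 2 ≤ ‖u r‖ ^ 2 <;> linarith
  have hUpos : 0 < U := by linarith
  refine ⟨by linarith, ?_⟩
  have hg : (3 / 8 * U) ^ 2 ≤ ‖G false r‖ ^ 2 + ‖G true r‖ ^ 2 := by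
    have h1 : (3 / 8 * U) ^ 2 ≤ ‖G r r‖ ^ 2 :=
      pow_le_pow_left₀ (by positivity) (hrr.trans (Complex.re_le_norm _)) 2
    cases r
    · nlinarith [sq_nonneg ‖G true false‖]
    · nlinarith [sq_nonneg ‖G false true‖]
  have hcross : ‖G false r * u true - G true r * u false‖ ^ 2 ≤ 2 * θ ^ 2 * U := by
    have e : G false r * u true - G true r * u false =
        (G false r - u false * star (u r)) * u true -
          (G true r - u true * star (u r)) * u false := by ring
    have h1 : ‖G false r * u true - G true r * u false‖ ≤ θ * ‖u true‖ + θ * ‖u false‖ := by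
      rw [e]
      refine (norm_sub_le _ _).trans ?_
      rw [norm_mul, norm_mul]
      exact add_le_add (mul_le_mul_of_nonneg_right (hG _ _) (norm_nonneg _))
        (mul_le_mul_of_nonneg_right (hG _ _) (norm_nonneg _))
    calc _ ≤ (θ * ‖u true‖ + θ * ‖u false‖) ^ 2 := pow_le_pow_left₀ (norm_nonneg _) h1 2
      _ ≤ 2 * θ ^ 2 * U := by
        rw [← hU]
        nlinarith [mul_nonneg (sq_nonneg θ) (sq_nonneg (‖u true‖ - ‖u false‖))]
  calc _ ≤ 2 * θ ^ 2 * U * U := mul_le_mul_of_nonneg_right hcross hUpos.le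
    _ ≤ 15 * θ ^ 2 * (3 / 8 * U) ^ 2 := by nlinarith [mul_nonneg (sq_nonneg θ) (sq_nonneg U)]
    _ ≤ _ := mul_le_mul_of_nonneg_left hg (by positivity)

/-- The loss of fidelity at a node of weight `p`, in terms of the losses `p₀ - ‖u₀‖²` and
`p₁ - ‖u₁‖²` of its halves. The combination with coefficients `g` is only controlled when `u` is
large compared to the accuracy `θ`; in all the other cases `p` itself is small enough. -/
theorem loss_combine_le (u g : Bool → ℂ) {N p p₀ p₁ B θ : ℝ} (hN : 1 ≤ N) (hB : 0 < B)
    (hθ : θ ^ 2 = 8 * max p B * B) (hp : p = p₀ + p₁)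
    (h₀ : ‖u false‖ ^ 2 ≤ p₀) (h₁ : ‖u true‖ ^ 2 ≤ p₁)
    (hg : 0 < ‖g false‖ ^ 2 + ‖g true‖ ^ 2)
    (hgood : 8 * θ ≤ ‖u false‖ ^ 2 + ‖u true‖ ^ 2 →
      ‖g false * u true - g true * u false‖ ^ 2 * (‖u false‖ ^ 2 + ‖u true‖ ^ 2) ≤
        15 * θ ^ 2 * (‖g false‖ ^ 2 + ‖g true‖ ^ 2)) :
    p - ‖star (g false) * u false + star (g true) * u true‖ ^ 2 /
        (‖g false‖ ^ 2 + ‖g true‖ ^ 2) ≤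
      (1 + 1 / N) * ((p₀ - ‖u false‖ ^ 2) + (p₁ - ‖u true‖ ^ 2)) + 512 * (N + 1) ^ 2 * B := by
  have hlag := lagrange_two (g false) (g true) (u false) (u true)
  set U := ‖u false‖ ^ 2 + ‖u true‖ ^ 2 with hU
  set W := ‖g false‖ ^ 2 + ‖g true‖ ^ 2
  set I := ‖star (g false) * u false + star (g true) * u true‖ ^ 2
  set Cr := ‖g false * u true - g true * u false‖ ^ 2
  have hI0 : 0 ≤ I / W := by positivity
  have hU0 : 0 ≤ U := by positivity
  have hN0 : 0 < N := by linarith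
  have hL0 : 0 ≤ (p₀ - ‖u false‖ ^ 2) + (p₁ - ‖u true‖ ^ 2) := by linarith
  have hL : (p₀ - ‖u false‖ ^ 2) + (p₁ - ‖u true‖ ^ 2) = p - U := by rw [hp, hU]; ring
  rw [hL] at hL0 ⊢
  have hA0 : 0 ≤ (1 + 1 / N) * (p - U) := by positivity
  have hA1 : p - U ≤ (1 + 1 / N) * (p - U) := le_mul_of_one_le_left hL0 (by
    have : 0 ≤ 1 / N := by positivity
    linarith)
  have hsq : 1 ≤ (N + 1) ^ 2 := by nlinarith
  -- the node has little weight
  by_cases hpB : p < B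
  · have : B ≤ 512 * (N + 1) ^ 2 * B := le_mul_of_one_le_left hB.le (by linarith)
    linarith
  rw [not_lt] at hpB
  rw [max_eq_left hpB] at hθ
  have hp0 : 0 < p := hB.trans_le hpB
  -- the losses of the halves already make up almost all of `p`
  by_cases hsmall : (N + 1) * U < p
  · have h1 : p ≤ (1 + 1 / N) * (p - U) := by
      have : (1 + 1 / N) * (p - U) = p + (p - (N + 1) * U) / N := by field_simp; ring
      rw [this]
      have : 0 ≤ (p - (N + 1) * U) / N := div_nonneg (by linarith) hN0.le
      linarith
    have : 0 ≤ 512 * (N + 1) ^ 2 * B := by positivity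
    linarith
  rw [not_lt] at hsmall
  have hUpos : 0 < U := by
    by_contra hcon
    have : U = 0 := le_antisymm (not_lt.1 hcon) hU0
    rw [this, mul_zero] at hsmall
    linarith
  -- if `U` is small, then so is `p`, being at most `(N + 1) * U`
  by_cases hlarge : 8 * θ ≤ U
  · have h1 := hgood hlarge
    have h2 : p - I / W = (p - U) + Cr / W := by
      rw [← hlag]; field_simp; ring
    have h3 : Cr / W ≤ 512 * (N + 1) ^ 2 * B := by
      rw [div_le_iff₀ hg]
      have h4 : Cr * U ≤ 512 * (N + 1) ^ 2 * B * W * U := by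
        calc _ ≤ 15 * θ ^ 2 * W := h1
          _ = 120 * B * W * p := by rw [hθ]; ring
          _ ≤ 120 * B * W * ((N + 1) * U) := mul_le_mul_of_nonneg_left hsmall (by positivity)
          _ ≤ _ := by
            have : 120 * (N + 1) ≤ 512 * (N + 1) ^ 2 := by nlinarith
            have h5 : 0 ≤ B * W * U := by positivity
            nlinarith [mul_le_mul_of_nonneg_right this h5]
      exact le_of_mul_le_mul_right h4 hUpos
    linarith
  · rw [not_le] at hlarge
    have h1 : p < (N + 1) * (8 * θ) :=
      hsmall.trans_lt (mul_lt_mul_of_pos_left hlarge (by positivity))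
    have h2 : p * p ≤ 512 * (N + 1) ^ 2 * B * p := by
      have h3 : p ^ 2 ≤ ((N + 1) * (8 * θ)) ^ 2 := pow_le_pow_left₀ hp0.le h1.le 2
      have h4 : ((N + 1) * (8 * θ)) ^ 2 = 512 * (N + 1) ^ 2 * B * p := by
        rw [mul_pow, mul_pow, hθ]; ring
      rw [← h4, ← pow_two]; exact h3
    have := le_of_mul_le_mul_right h2 hp0
    linarith

/-! ### Residue classes of labels -/

section

variable {E : Type*} [AddCommMonoid E]

/-- Sum over the labels below `2 ^ n` in a residue class modulo `2 ^ k`, that is, over the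
labels whose first `k` bits are prescribed. -/
def classSum (n k q : ℕ) (F : ℕ → E) : E :=
  ∑ y ∈ Finset.range (2 ^ n), if y % 2 ^ k = q then F y else 0

theorem classSum_congr {n k q : ℕ} {F G : ℕ → E} (h : ∀ y < 2 ^ n, y % 2 ^ k = q → F y = G y) :
    classSum n k q F = classSum n k q G := by
  refine Finset.sum_congr rfl fun y hy => ?_
  split_ifs with h1
  · exact h y (Finset.mem_range.1 hy) h1
  · rfl

theorem mod_two_pow_succ_eq_iff {k r : ℕ} (hr : r < 2 ^ k) (y : ℕ) :
    y % 2 ^ k = r ↔ y % 2 ^ (k + 1) = r ∨ y % 2 ^ (k + 1) = r + 2 ^ k := by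
  rw [Nat.mod_pow_succ]
  have h := Nat.mod_lt y (Nat.two_pow_pos k)
  rcases Nat.mod_two_eq_zero_or_one (y / 2 ^ k) with h1 | h1 <;> rw [h1] <;> omega

/-- A class modulo `2 ^ k` consists of two classes modulo `2 ^ (k + 1)`. -/
theorem classSum_split {n k r : ℕ} (hr : r < 2 ^ k) (F : ℕ → E) :
    classSum n k r F = classSum n (k + 1) r F + classSum n (k + 1) (r + 2 ^ k) F := by
  unfold classSum
  rw [← Finset.sum_add_distrib]
  refine Finset.sum_congr rfl fun y _ => ?_
  have h := mod_two_pow_succ_eq_iff hr y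
  by_cases h1 : y % 2 ^ (k + 1) = r
  · have h2 : y % 2 ^ (k + 1) ≠ r + 2 ^ k := by
      have := Nat.two_pow_pos k; omega
    rw [if_pos (h.2 (Or.inl h1)), if_pos h1, if_neg h2, add_zero]
  · by_cases h2 : y % 2 ^ (k + 1) = r + 2 ^ k
    · rw [if_pos (h.2 (Or.inr h2)), if_neg h1, if_pos h2, zero_add]
    · rw [if_neg (fun h3 => (h.1 h3).elim h1 h2), if_neg h1, if_neg h2, add_zero]

theorem classSum_zero (n : ℕ) (F : ℕ → E) :
    classSum n 0 0 F = ∑ y ∈ Finset.range (2 ^ n), F y := by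
  simp [classSum, Nat.mod_one]

theorem classSum_self {n q : ℕ} (hq : q < 2 ^ n) (F : ℕ → E) : classSum n n q F = F q := by
  unfold classSum
  rw [Finset.sum_eq_single q]
  · rw [if_pos (Nat.mod_eq_of_lt hq)]
  · intro y hy hne
    rw [Nat.mod_eq_of_lt (Finset.mem_range.1 hy), if_neg hne]
  · intro h; exact absurd (Finset.mem_range.2 hq) h

end

theorem classSum_mul {n k q : ℕ} (c : ℂ) (F : ℕ → ℂ) :
    classSum n k q (fun y => c * F y) = c * classSum n k q F := by
  simp only [classSum, Finset.mul_sum, mul_ite, mul_zero]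

theorem classSum_mul_real {n k q : ℕ} (c : ℝ) (F : ℕ → ℝ) :
    classSum n k q (fun y => c * F y) = c * classSum n k q F := by
  simp only [classSum, Finset.mul_sum, mul_ite, mul_zero]

theorem classSum_nonneg {n k q : ℕ} {F : ℕ → ℝ} (h : ∀ y, 0 ≤ F y) : 0 ≤ classSum n k q F :=
  Finset.sum_nonneg fun y _ => by split_ifs; exacts [h y, le_rfl]

/-! ### The loss of fidelity on a residue class -/

section

variable (n : ℕ) (v : ℕ → ℂ) (Φ : ℕ → GaussianInt) (k q : ℕ)

/-- Squared norm of the restriction of `v` to a residue class modulo `2 ^ k`. -/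
noncomputable def classProb : ℝ := classSum n k q fun y => ‖v y‖ ^ 2

/-- Inner product of the restrictions of `Φ` and `v` to a residue class modulo `2 ^ k`. -/
noncomputable def overlap : ℂ := classSum n k q fun y => star (Φ y : ℂ) * v y

/-- Squared norm of the restriction of `Φ` to a residue class modulo `2 ^ k`. -/
noncomputable def classMass : ℝ := classSum n k q fun y => ‖(Φ y : ℂ)‖ ^ 2

/-- Inner product with `v` of the normalized restriction of `Φ` to a residue class. -/
noncomputable def unitOverlap : ℂ := overlap n v Φ k q / (√(classMass n Φ k q) : ℝ)

/-- The squared norm of the part of `v` on a residue class that is orthogonal to `Φ`. -/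
noncomputable def loss : ℝ := classProb n v k q - ‖unitOverlap n v Φ k q‖ ^ 2

variable {n v Φ k q}

theorem classMass_nonneg : 0 ≤ classMass n Φ k q := classSum_nonneg fun _ => by positivity

theorem sq_norm_unitOverlap :
    ‖unitOverlap n v Φ k q‖ ^ 2 = ‖overlap n v Φ k q‖ ^ 2 / classMass n Φ k q := by
  rw [unitOverlap, norm_div, div_pow, Complex.norm_real, Real.norm_eq_abs, sq_abs,
    Real.sq_sqrt classMass_nonneg]

theorem sq_norm_overlap_le :
    ‖overlap n v Φ k q‖ ^ 2 ≤ classMass n Φ k q * classProb n v k q := by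
  have h1 : overlap n v Φ k q = ∑ y ∈ Finset.range (2 ^ n),
      star (if y % 2 ^ k = q then (Φ y : ℂ) else 0) * (if y % 2 ^ k = q then v y else 0) := by
    unfold overlap classSum
    refine Finset.sum_congr rfl fun y _ => ?_
    split_ifs <;> simp
  have h2 : ‖overlap n v Φ k q‖ ≤ ∑ y ∈ Finset.range (2 ^ n),
      ‖(if y % 2 ^ k = q then (Φ y : ℂ) else 0)‖ * ‖(if y % 2 ^ k = q then v y else 0)‖ := by
    rw [h1]
    refine (norm_sum_le _ _).trans (Finset.sum_le_sum fun y _ => ?_)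
    rw [norm_mul, norm_star]
  refine (pow_le_pow_left₀ (norm_nonneg _) h2 2).trans
    ((Finset.sum_mul_sq_le_sq_mul_sq _ _ _).trans (le_of_eq ?_))
  unfold classMass classProb classSum
  refine congrArg₂ (· * ·) ?_ ?_ <;> refine Finset.sum_congr rfl fun y _ => ?_ <;>
    split_ifs <;> simp

theorem sq_norm_unitOverlap_le : ‖unitOverlap n v Φ k q‖ ^ 2 ≤ classProb n v k q := by
  rw [sq_norm_unitOverlap]
  rcases classMass_nonneg.eq_or_lt with h | h
  · rw [← h, div_zero]; exact classSum_nonneg fun _ => by positivity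
  · rw [div_le_iff₀ h, mul_comm]; exact sq_norm_overlap_le

theorem toComplex_norm_eq (g : GaussianInt) : ((g.norm : ℤ) : ℝ) = ‖(g : ℂ)‖ ^ 2 := by
  rw [GaussianInt.intCast_real_norm, Complex.normSq_eq_norm_sq]

theorem Data.mass_eq (D : Data) (Φ : ℕ → GaussianInt) (k q : ℕ) :
    ((D.mass Φ k q : ℤ) : ℝ) = classMass D.n Φ (k + 1) q := by
  unfold Data.mass classMass classSum
  rw [Int.cast_sum]
  refine Finset.sum_congr rfl fun y _ => ?_
  split_ifs
  · exact toComplex_norm_eq _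
  · simp

end

/-! ### One level of the tree -/

/-- The two residue classes modulo `2 ^ (k + 1)` that make up the class of `r` modulo `2 ^ k`. -/
def child (k r : ℕ) (i : Bool) : ℕ := if i then r + 2 ^ k else r

theorem child_lt {k r : ℕ} (hr : r < 2 ^ k) (i : Bool) : child k r i < 2 ^ (k + 1) := by
  rw [pow_succ]; cases i <;> simp [child] <;> omega

theorem mod_of_mod_child {k r z : ℕ} (hr : r < 2 ^ k) {i : Bool}
    (hz : z % 2 ^ (k + 1) = child k r i) : z % 2 ^ k = r := by
  rw [mod_two_pow_succ_eq_iff hr]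
  cases i
  · exact Or.inl hz
  · exact Or.inr hz

theorem child_injective (k r : ℕ) : Function.Injective (child k r) := by
  intro i j h
  have := Nat.two_pow_pos k
  cases i <;> cases j <;> simp [child] at h ⊢

theorem classSum_child {E : Type*} [AddCommMonoid E] {n k r : ℕ} (hr : r < 2 ^ k) (F : ℕ → E) :
    classSum n k r F =
      classSum n (k + 1) (child k r false) F + classSum n (k + 1) (child k r true) F :=
  classSum_split hr F

namespace Data

variable (D : Data) (v : ℕ → ℂ) (Φ : ℕ → GaussianInt) (k r : ℕ)

/-- `gram`, normalized so that it estimates an entry of the rank one matrix formed by the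
numbers `unitOverlap`. -/
noncomputable def unitGram (q q' : ℕ) : ℂ :=
  (D.gram Φ k q q' : ℂ) / ((D.R * 2 ^ (D.n - k) *
    (√(classMass D.n Φ (k + 1) q) * √(classMass D.n Φ (k + 1) q')) : ℝ) : ℂ)

/-- The error of `unitGram` for two children of a class. -/
noncomputable def gramError (i j : Bool) : ℂ :=
  D.unitGram Φ k (child k r i) (child k r j) -
    unitOverlap D.n v Φ (k + 1) (child k r i) * star (unitOverlap D.n v Φ (k + 1) (child k r j))

/-- The accuracy that is needed at a class whose weight in the state is `p`. It improves with
decreasing `p`, in the way in which the second moments of the estimates do. -/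
noncomputable def tolerance (B p : ℝ) : ℝ := 2 * √(max p B * B)

/-- All four estimates at the class `r` are accurate. -/
def Accurate (B : ℝ) : Prop :=
  ∀ i j, |(D.gramError v Φ k r i j).re| ≤ tolerance B (classProb D.n v k r) ∧
    |(D.gramError v Φ k r i j).im| ≤ tolerance B (classProb D.n v k r)

variable {D v Φ k r}

/-- All amplitudes in a class modulo `2 ^ k` use the same column `ref`, so that the two halves are
multiplied by one factor each. -/
theorem exists_coef (hr : r < 2 ^ k) : ∃ ref : Bool,
    (D.gram Φ k (child k r (!ref)) (child k r (!ref))).re * D.mass Φ k (child k r ref) ≤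
      (D.gram Φ k (child k r ref) (child k r ref)).re * D.mass Φ k (child k r (!ref)) ∧
    ∀ i z, z % 2 ^ (k + 1) = child k r i → D.coef Φ k z =
      if 1 ≤ (D.gram Φ k (child k r ref) (child k r ref)).re then
        D.gram Φ k (child k r i) (child k r ref) * (D.mass Φ k (child k r (!i)) : ℤ)
      else 1 := by
  have hhalf : ∀ z, z % 2 ^ k = r → half 0 k z = child k r false ∧ half 1 k z = child k r true := by
    intro z hz; simp [half, child, hz]
  have hother : ∀ i z, z % 2 ^ (k + 1) = child k r i →
      (if z % 2 ^ (k + 1) = half 0 k z then half 1 k z else half 0 k z) = child k r (!i) := by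
    intro i z hz
    obtain ⟨h0, h1⟩ := hhalf z (mod_of_mod_child hr hz)
    rw [h0, h1, hz]
    cases i
    · rw [if_pos rfl]; rfl
    · rw [if_neg fun h => by simpa using child_injective k r h]; rfl
  by_cases h : (D.gram Φ k (child k r true) (child k r true)).re * D.mass Φ k (child k r false) ≤
      (D.gram Φ k (child k r false) (child k r false)).re * D.mass Φ k (child k r true)
  · refine ⟨false, h, fun i z hz => ?_⟩
    obtain ⟨h0, h1⟩ := hhalf z (mod_of_mod_child hr hz)
    have hp : D.pivot Φ k z = child k r false := by
      rw [pivot, h0, h1, if_pos h]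
    rw [coef, hp, hother i z hz, hz]
  · refine ⟨true, (not_le.1 h).le, fun i z hz => ?_⟩
    obtain ⟨h0, h1⟩ := hhalf z (mod_of_mod_child hr hz)
    have hp : D.pivot Φ k z = child k r true := by
      rw [pivot, h0, h1, if_neg h]
    rw [coef, hp, hother i z hz, hz]

/-- The effect of one level at the class `r`. The new amplitudes do not vanish on the class, and the
loss there is bounded by means of `loss_combine_le` if the estimates are accurate. -/
theorem loss_level_le {Φ' : ℕ → GaussianInt} (hr : r < 2 ^ k) (hR : 1 ≤ D.R)
    (hΦ' : ∀ z, Φ' z = Φ z * D.coef Φ k z)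
    (hM : ∀ i, 0 < classMass D.n Φ (k + 1) (child k r i)) :
    0 < classMass D.n Φ' k r ∧ ∀ N B : ℝ, 1 ≤ N → 0 < B → D.Accurate v Φ k r B →
      loss D.n v Φ' k r ≤ (1 + 1 / N) * (loss D.n v Φ (k + 1) (child k r false) +
        loss D.n v Φ (k + 1) (child k r true)) + 512 * (N + 1) ^ 2 * B := by
  obtain ⟨ref, hord, hcoef⟩ := D.exists_coef (Φ := Φ) hr
  set M : Bool → ℝ := fun i => classMass D.n Φ (k + 1) (child k r i) with hMdef
  have hmass : ∀ i, ((D.mass Φ k (child k r i) : ℤ) : ℝ) = M i := fun i => D.mass_eq Φ k _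
  have hmass0 : ∀ i, 0 < D.mass Φ k (child k r i) := fun i => by
    have := hM i; rw [← D.mass_eq] at this; exact_mod_cast this
  set c : Bool → GaussianInt := fun i =>
    if 1 ≤ (D.gram Φ k (child k r ref) (child k r ref)).re then
      D.gram Φ k (child k r i) (child k r ref) * (D.mass Φ k (child k r (!i)) : ℤ) else 1 with hc
  set g : Bool → ℂ := fun i => (c i : ℂ) * (√(M i) : ℝ) with hg
  set u : Bool → ℂ := fun i => unitOverlap D.n v Φ (k + 1) (child k r i) with hu
  have hsqrt : ∀ i, 0 < √(M i) := fun i => Real.sqrt_pos.2 (hM i)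
  have hmass' : classMass D.n Φ' k r = ‖g false‖ ^ 2 + ‖g true‖ ^ 2 := by
    unfold classMass
    rw [classSum_child hr]
    have : ∀ i, classSum D.n (k + 1) (child k r i) (fun y => ‖(Φ' y : ℂ)‖ ^ 2) = ‖g i‖ ^ 2 := by
      intro i
      rw [classSum_congr (G := fun y => ‖(c i : ℂ)‖ ^ 2 * ‖(Φ y : ℂ)‖ ^ 2) fun y _ hy => by
        rw [hΦ', hcoef i y hy, map_mul, norm_mul, mul_pow, mul_comm], classSum_mul_real, hg]
      simp only [norm_mul, mul_pow, Complex.norm_real, Real.norm_eq_abs, sq_abs]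
      rw [Real.sq_sqrt (hM i).le]; rfl
    rw [this, this]
  have hover' : overlap D.n v Φ' k r = star (g false) * u false + star (g true) * u true := by
    unfold overlap
    rw [classSum_child hr]
    have : ∀ i, classSum D.n (k + 1) (child k r i) (fun y => star (Φ' y : ℂ) * v y) =
        star (g i) * u i := by
      intro i
      rw [classSum_congr (G := fun y => star (c i : ℂ) * (star (Φ y : ℂ) * v y)) fun y _ hy => by
        rw [hΦ', hcoef i y hy, map_mul, star_mul']; ring, classSum_mul, hg, hu]
      have h1 : ((√(M i) : ℝ) : ℂ) ≠ 0 := by exact_mod_cast (hsqrt i).ne'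
      simp only [star_mul', unitOverlap, overlap]
      rw [show star ((√(M i) : ℝ) : ℂ) = (√(M i) : ℝ) from Complex.conj_ofReal _, mul_assoc]
      congr 1
      exact (mul_div_cancel₀ _ h1).symm
    rw [this, this]
  have hgpos : 0 < ‖g false‖ ^ 2 + ‖g true‖ ^ 2 := by
    have hcr : c ref ≠ 0 := by
      simp only [hc]
      split_ifs with h1
      · refine mul_ne_zero (fun h0 => ?_) ?_
        · rw [h0] at h1; simp at h1
        · exact_mod_cast (hmass0 _).ne'
      · exact one_ne_zero
    have h1 : 0 < ‖g ref‖ ^ 2 := by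
      have : g ref ≠ 0 := mul_ne_zero
        (fun h => hcr (GaussianInt.toComplex_eq_zero.1 h)) (by exact_mod_cast (hsqrt ref).ne')
      positivity
    cases ref
    · nlinarith [sq_nonneg ‖g true‖]
    · nlinarith [sq_nonneg ‖g false‖]
  refine ⟨hmass' ▸ hgpos, fun N B hN hB hacc => ?_⟩
  have hp := classSum_child (n := D.n) hr fun y => ‖v y‖ ^ 2
  have hmaxB : 0 < max (classProb D.n v k r) B * B := mul_pos (lt_max_of_lt_right hB) hB
  -- `θ` is `√2` times the tolerance, because real and imaginary part are controlled separately
  set θ : ℝ := √(8 * max (classProb D.n v k r) B * B) with hθdef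
  have hθ0 : 0 < θ := Real.sqrt_pos.2 (by linarith)
  have hθ2 : θ ^ 2 = 8 * max (classProb D.n v k r) B * B := Real.sq_sqrt (by linarith)
  have hkey := loss_combine_le u g hN hB hθ2 hp
    (sq_norm_unitOverlap_le (n := D.n)) (sq_norm_unitOverlap_le (n := D.n)) hgpos ?_
  · unfold loss
    rw [sq_norm_unitOverlap (Φ := Φ'), hmass', hover']
    exact hkey
  intro hlarge
  have hRpos : (0 : ℝ) < D.R := by exact_mod_cast hR
  set G : Bool → Bool → ℂ := fun i j => D.unitGram Φ k (child k r i) (child k r j) with hG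
  have hGerr : ∀ i j, ‖G i j - u i * star (u j)‖ ≤ θ := by
    intro i j
    obtain ⟨h1, h2⟩ := hacc i j
    have h3 : ‖G i j - u i * star (u j)‖ ^ 2 ≤ θ ^ 2 := by
      rw [sq_norm_eq, hθ2]
      have e : tolerance B (classProb D.n v k r) ^ 2 = 4 * (max (classProb D.n v k r) B * B) := by
        rw [tolerance, mul_pow, Real.sq_sqrt hmaxB.le]; norm_num
      have a1 := sq_le_sq' (abs_le.1 h1).1 (abs_le.1 h1).2
      have a2 := sq_le_sq' (abs_le.1 h2).1 (abs_le.1 h2).2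
      have e2 : G i j - u i * star (u j) = D.gramError v Φ k r i j := rfl
      rw [e2]
      nlinarith
    exact (pow_le_pow_iff_left₀ (norm_nonneg _) hθ0.le two_ne_zero).1 h3
  have hdiag : ∀ i, (G i i).re =
      ((D.gram Φ k (child k r i) (child k r i)).re : ℝ) / (D.R * 2 ^ (D.n - k) * M i) := by
    intro i
    have h1 : √(M i) * √(M i) = M i := Real.mul_self_sqrt (hM i).le
    simp only [hG, unitGram]
    rw [show √(classMass D.n Φ (k + 1) (child k r i)) * √(classMass D.n Φ (k + 1) (child k r i)) =
      M i from h1, Complex.div_ofReal_re]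
    simp
  have hS : (0 : ℝ) < D.R * 2 ^ (D.n - k) := by positivity
  have hord' : (G (!ref) (!ref)).re ≤ (G ref ref).re := by
    rw [hdiag, hdiag, div_le_div_iff₀ (mul_pos hS (hM _)) (mul_pos hS (hM _))]
    have h1 : ((D.gram Φ k (child k r (!ref)) (child k r (!ref))).re : ℝ) * M ref ≤
        ((D.gram Φ k (child k r ref) (child k r ref)).re : ℝ) * M (!ref) := by
      rw [← hmass, ← hmass]; exact_mod_cast hord
    calc _ = (D.R * 2 ^ (D.n - k)) *
          (((D.gram Φ k (child k r (!ref)) (child k r (!ref))).re : ℝ) * M ref) := by ring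
      _ ≤ (D.R * 2 ^ (D.n - k)) *
          (((D.gram Φ k (child k r ref) (child k r ref)).re : ℝ) * M (!ref)) :=
          mul_le_mul_of_nonneg_left h1 hS.le
      _ = _ := by ring
  obtain ⟨hpos, hpar⟩ := column_almost_parallel u G ref hθ0 rfl hGerr hord' hlarge
  have hone : 1 ≤ (D.gram Φ k (child k r ref) (child k r ref)).re := by
    rw [hdiag] at hpos
    have h1 := (div_pos_iff_of_pos_right (mul_pos hS (hM ref))).1 hpos
    have h2 : 0 < (D.gram Φ k (child k r ref) (child k r ref)).re := by exact_mod_cast h1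
    omega
  -- The coefficients are proportional to the column `ref` of the normalized matrix.
  set t : ℝ := D.R * 2 ^ (D.n - k) * √(M ref) * (M false * M true) with ht
  have hgt : ∀ i, g i = t * G i ref := by
    intro i
    have h1 : (√(M i) : ℂ) * √(M i) = M i := by exact_mod_cast Real.mul_self_sqrt (hM i).le
    have h2 : (M i : ℂ) * M (!i) = M false * M true := by cases i <;> simp [mul_comm]
    have h3 : ((√(M i) : ℝ) : ℂ) ≠ 0 := by exact_mod_cast (hsqrt i).ne'
    have h4 : ((√(M ref) : ℝ) : ℂ) ≠ 0 := by exact_mod_cast (hsqrt ref).ne'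
    have h5 : ((D.mass Φ k (child k r (!i)) : GaussianInt) : ℂ) = (M (!i) : ℂ) := by
      rw [← hmass]; simp
    have h6 : (D.R : ℂ) ≠ 0 := by exact_mod_cast hRpos.ne'
    have h7 : G i ref = (D.gram Φ k (child k r i) (child k r ref) : ℂ) /
      ((D.R * 2 ^ (D.n - k) * (√(M i) * √(M ref)) : ℝ) : ℂ) := rfl
    simp only [hg, hc, if_pos hone, map_mul]
    rw [h5, h7, ht]
    push_cast
    rw [← h2, ← h1]
    field_simp
  rw [hgt, hgt]
  have e1 : ‖(t : ℂ) * G false ref * u true - t * G true ref * u false‖ ^ 2 =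
      t ^ 2 * ‖G false ref * u true - G true ref * u false‖ ^ 2 := by
    rw [mul_assoc, mul_assoc, ← mul_sub, norm_mul, mul_pow, Complex.norm_real, Real.norm_eq_abs,
      sq_abs]
  have e2 : ∀ i, ‖(t : ℂ) * G i ref‖ ^ 2 = t ^ 2 * ‖G i ref‖ ^ 2 := fun i => by
    rw [norm_mul, mul_pow, Complex.norm_real, Real.norm_eq_abs, sq_abs]
  rw [e1, e2, e2]
  have := mul_le_mul_of_nonneg_left hpar (sq_nonneg t)
  linarith

end Data

namespace Data

/-! ### All levels of the tree -/

variable {D : Data}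

theorem classMass_amplitude_pos (hR : 1 ≤ D.R) : ∀ h ≤ D.n, ∀ r < 2 ^ (D.n - h),
    0 < classMass D.n (D.amplitude h) (D.n - h) r
  | 0, _, r, hr => by
    rw [Nat.sub_zero] at hr ⊢
    rw [classMass, classSum_self hr]
    simp [amplitude]
  | h + 1, hh, r, hr => by
    have e : D.n - (h + 1) = D.n - 1 - h := by omega
    have e1 : D.n - 1 - h + 1 = D.n - h := by omega
    rw [e] at hr ⊢
    refine (loss_level_le (v := 0) hr hR (fun z => rfl) fun i => ?_).1
    rw [e1]
    exact classMass_amplitude_pos hR h (by omega) _ (by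
      have := child_lt hr i; rwa [e1] at this)

/-- The tolerance parameter for a class modulo `2 ^ k`. -/
noncomputable def levelTolerance (D : Data) (lam : ℝ) (k : ℕ) : ℝ := 2 ^ (D.n - k) * lam / D.R

theorem sum_range_two_pow_succ (k : ℕ) (f : ℕ → ℝ) :
    ∑ r ∈ Finset.range (2 ^ (k + 1)), f r =
      ∑ r ∈ Finset.range (2 ^ k), (f (child k r false) + f (child k r true)) := by
  rw [pow_succ, mul_two, Finset.sum_range_add, Finset.sum_add_distrib]
  simp [child, add_comm]

/-- The total loss of all the nodes at one height. Each level adds the same amount, as the tolerance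
is inversely proportional to the number of nodes. -/
theorem sum_loss_le {v : ℕ → ℂ} {lam : ℝ} (hlam : 0 < lam) (hR : 1 ≤ D.R)
    (hacc : ∀ h < D.n, ∀ r < 2 ^ (D.n - 1 - h),
      D.Accurate v (D.amplitude h) (D.n - 1 - h) r (D.levelTolerance lam (D.n - 1 - h))) :
    ∀ h ≤ D.n, ∑ r ∈ Finset.range (2 ^ (D.n - h)), loss D.n v (D.amplitude h) (D.n - h) r ≤
      512 * ((D.n : ℝ) + 1) ^ 2 * (2 ^ D.n * lam / D.R) * h * (1 + 1 / (D.n : ℝ)) ^ h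
  | 0, _ => by
    rw [Nat.sub_zero]
    refine le_of_eq ?_
    rw [Nat.cast_zero, mul_zero, zero_mul]
    refine Finset.sum_eq_zero fun r hr => ?_
    rw [Finset.mem_range] at hr
    rw [loss, sq_norm_unitOverlap, classProb, overlap, classMass, classSum_self hr,
      classSum_self hr, classSum_self hr]
    simp [amplitude]
  | h + 1, hh => by
    have ih := sum_loss_le hlam hR hacc h (by omega)
    have e : D.n - (h + 1) = D.n - 1 - h := by omega
    have e1 : D.n - h = D.n - 1 - h + 1 := by omega
    have hn : (1 : ℝ) ≤ D.n := by exact_mod_cast (show 1 ≤ D.n by omega)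
    have hRpos : (0 : ℝ) < D.R := by exact_mod_cast hR
    rw [e1] at ih
    rw [sum_range_two_pow_succ] at ih
    rw [e]
    set k := D.n - 1 - h with hk
    set A : ℝ := 512 * ((D.n : ℝ) + 1) ^ 2 * (2 ^ D.n * lam / D.R) with hA
    have hA0 : 0 ≤ A := by positivity
    have hB0 : 0 < D.levelTolerance lam k := by unfold levelTolerance; positivity
    have hstep : ∀ r ∈ Finset.range (2 ^ k), loss D.n v (D.amplitude (h + 1)) k r ≤
        (1 + 1 / (D.n : ℝ)) * (loss D.n v (D.amplitude h) (k + 1) (child k r false) +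
          loss D.n v (D.amplitude h) (k + 1) (child k r true)) +
          512 * ((D.n : ℝ) + 1) ^ 2 * D.levelTolerance lam k := by
      intro r hr
      rw [Finset.mem_range] at hr
      refine (loss_level_le hr hR (fun z => rfl) fun i => ?_).2 _ _ hn hB0
        (hacc h (by omega) r hr)
      have h1 := classMass_amplitude_pos hR h (by omega) (child k r i)
      rw [e1] at h1
      exact h1 (child_lt hr i)
    have hlevel : (2 : ℝ) ^ k * (512 * ((D.n : ℝ) + 1) ^ 2 * D.levelTolerance lam k) = A := by
      have : (2 : ℝ) ^ D.n = 2 ^ k * 2 ^ (D.n - k) := by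
        rw [← pow_add]; congr 1; omega
      rw [hA, levelTolerance, this]; ring
    refine (Finset.sum_le_sum hstep).trans ?_
    rw [Finset.sum_add_distrib, ← Finset.mul_sum, Finset.sum_const, Finset.card_range,
      nsmul_eq_mul]
    push_cast
    rw [hlevel]
    have hq : 1 ≤ 1 + 1 / (D.n : ℝ) := by
      have : 0 ≤ 1 / (D.n : ℝ) := by positivity
      linarith
    have h2 := mul_le_mul_of_nonneg_left ih (zero_le_one.trans hq)
    have h3 : A ≤ A * (1 + 1 / (D.n : ℝ)) ^ (h + 1) :=
      le_mul_of_one_le_right hA0 (one_le_pow₀ hq)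
    calc _ ≤ (1 + 1 / (D.n : ℝ)) * (A * h * (1 + 1 / (D.n : ℝ)) ^ h) +
          A * (1 + 1 / (D.n : ℝ)) ^ (h + 1) := add_le_add h2 h3
      _ = _ := by ring

/-- If all the estimates are accurate, then the final loss of fidelity is small. -/
theorem loss_amplitude_le {v : ℕ → ℂ} {lam : ℝ} (hlam : 0 < lam) (hR : 1 ≤ D.R) (hn : 1 ≤ D.n)
    (hacc : ∀ h < D.n, ∀ r < 2 ^ (D.n - 1 - h),
      D.Accurate v (D.amplitude h) (D.n - 1 - h) r (D.levelTolerance lam (D.n - 1 - h))) :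
    loss D.n v (D.amplitude D.n) 0 0 ≤
      1536 * ((D.n : ℝ) + 1) ^ 3 * (2 ^ D.n * lam / D.R) := by
  have h1 := sum_loss_le hlam hR hacc D.n le_rfl
  rw [Nat.sub_self] at h1
  simp only [pow_zero, Finset.range_one, Finset.sum_singleton] at h1
  refine h1.trans ?_
  have hn' : (0 : ℝ) < D.n := by exact_mod_cast hn
  have hRpos : (0 : ℝ) < D.R := by exact_mod_cast hR
  have h3 : (1 + 1 / (D.n : ℝ)) ^ D.n ≤ 3 := by
    calc _ ≤ Real.exp (1 / (D.n : ℝ)) ^ D.n := by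
          refine pow_le_pow_left₀ (by positivity) ?_ _
          rw [add_comm]; exact Real.add_one_le_exp _
      _ = Real.exp 1 := by
          rw [← Real.exp_nat_mul]; congr 1; field_simp
      _ ≤ 3 := Real.exp_one_lt_three.le
  have hX : 0 ≤ 512 * ((D.n : ℝ) + 1) ^ 2 * (2 ^ D.n * lam / D.R) * D.n := by positivity
  refine (mul_le_mul_of_nonneg_left h3 hX).trans ?_
  have h4 : 0 ≤ ((D.n : ℝ) + 1) ^ 2 * (2 ^ D.n * lam / D.R) := by positivity
  nlinarith

/-! ### Dependence of the amplitudes on the data -/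

theorem weight_congr {D' : Data} (hn : D.n = D'.n) {k c : ℕ}
    (hb : ∀ l < D.n, D.basis (c * D.n + l) = D'.basis (c * D.n + l))
    (ho : ∀ l < D.n, D.outcome (c * D.n + l) = D'.outcome (c * D.n + l)) (y y' : ℕ) :
    D.weight k c y y' = D'.weight k c y y' := by
  unfold weight
  rw [← hn]
  refine Finset.prod_congr rfl fun l hl => ?_
  rw [hb l (Finset.mem_range.1 hl), ho l (Finset.mem_range.1 hl)]

theorem mass_congr {D' : Data} (hn : D.n = D'.n) (Φ : ℕ → GaussianInt) (k q : ℕ) :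
    D.mass Φ k q = D'.mass Φ k q := by
  unfold mass; rw [hn]

theorem gram_congr {D' : Data} (hn : D.n = D'.n) (hR : D.R = D'.R) {k : ℕ}
    (hw : ∀ i < D.R, ∀ y y', D.weight k (k * D.R + i) y y' = D'.weight k (k * D.R + i) y y')
    (Φ : ℕ → GaussianInt) (r r' : ℕ) : D.gram Φ k r r' = D'.gram Φ k r r' := by
  unfold gram
  rw [← hn, ← hR]
  refine Finset.sum_congr rfl fun i hi => Finset.sum_congr rfl fun y _ =>
    Finset.sum_congr rfl fun y' _ => ?_
  rw [gramTerm, gramTerm, ← hR, hw i (Finset.mem_range.1 hi)]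

/-- The amplitudes after `h` levels depend only on the copies of the last `h` levels. -/
theorem amplitude_congr {D' : Data} (hn : D.n = D'.n) (hR : D.R = D'.R) : ∀ h ≤ D.n,
    (∀ c, (D.n - h) * D.R ≤ c → c < D.n * D.R → ∀ l < D.n,
      D.basis (c * D.n + l) = D'.basis (c * D.n + l) ∧
        D.outcome (c * D.n + l) = D'.outcome (c * D.n + l)) →
    D.amplitude h = D'.amplitude h
  | 0, _, _ => rfl
  | h + 1, hh, hd => by
    have ih := amplitude_congr hn hR h (by omega) fun c hc => hd c
      (le_trans (Nat.mul_le_mul_right _ (by omega)) hc)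
    have hg : ∀ Φ r r', D.gram Φ (D.n - 1 - h) r r' = D'.gram Φ (D.n - 1 - h) r r' := by
      refine gram_congr hn hR fun i hi => ?_
      have h1 : (D.n - (h + 1)) * D.R ≤ (D.n - 1 - h) * D.R + i := by
        rw [show D.n - (h + 1) = D.n - 1 - h by omega]; omega
      have h2 : (D.n - 1 - h) * D.R + i < D.n * D.R := by
        have : (D.n - 1 - h + 1) * D.R ≤ D.n * D.R := Nat.mul_le_mul_right _ (by omega)
        rw [Nat.add_mul] at this; omega
      exact weight_congr hn (fun l hl => (hd _ h1 h2 l hl).1) fun l hl => (hd _ h1 h2 l hl).2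
    funext z
    have hp : D.pivot (D.amplitude h) (D.n - 1 - h) z =
        D'.pivot (D.amplitude h) (D.n - 1 - h) z := by
      unfold pivot; simp only [hg, mass_congr hn]
    simp only [amplitude, coef]
    rw [← ih, ← hn, hp, hg, hg, mass_congr hn]

end Data

/-! ### Labels as numbers -/

theorem labelIndex_eq_ofBits : ∀ {n : ℕ} (x : Fin n → Bool), labelIndex x = Nat.ofBits x
  | 0, x => by simp [labelIndex, Nat.ofBits_zero]
  | n + 1, x => by
    rw [Nat.ofBits_succ, ← labelIndex_eq_ofBits]
    simp only [labelIndex, Fin.sum_univ_succ, Finset.mul_sum, Function.comp_def, Fin.val_zero,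
      pow_zero, Fin.val_succ, pow_succ, mul_ite, mul_comm]
    rw [add_comm]
    cases x 0 <;> simp

theorem labelIndex_lt {n : ℕ} (x : Fin n → Bool) : labelIndex x < 2 ^ n := by
  rw [labelIndex_eq_ofBits]; exact Nat.ofBits_lt_two_pow x

theorem testBit_labelIndex {n : ℕ} (x : Fin n → Bool) (l : Fin n) :
    (labelIndex x).testBit l = x l := by
  rw [labelIndex_eq_ofBits, Nat.testBit_ofBits_lt x l l.2]

theorem labelIndex_testBit {n y : ℕ} (hy : y < 2 ^ n) :
    labelIndex (fun l : Fin n => y.testBit l) = y := by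
  rw [labelIndex_eq_ofBits, Nat.ofBits_testBit, Nat.mod_eq_of_lt hy]

theorem sum_range_eq_sum_label {E : Type*} [AddCommMonoid E] (n : ℕ) (F : ℕ → E) :
    ∑ y ∈ Finset.range (2 ^ n), F y = ∑ x : Fin n → Bool, F (labelIndex x) := by
  refine Finset.sum_nbij' (fun y l => y.testBit (l : Fin n)) labelIndex (fun _ _ =>
    Finset.mem_univ _) (fun x _ => Finset.mem_range.2 (labelIndex_lt x)) (fun y hy =>
    labelIndex_testBit (Finset.mem_range.1 hy)) (fun x _ => ?_) fun y hy => ?_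
  · funext l; exact testBit_labelIndex x l
  · rw [labelIndex_testBit (Finset.mem_range.1 hy)]

theorem digit_labelIndex {n : ℕ} (x : Fin n → Bool) (l : Fin n) :
    digit (labelIndex x) l = bitInt (x l) := by
  rw [← testBit_labelIndex x l, Nat.testBit_eq_decide_div_mod_eq, digit, bitInt]
  rcases Nat.mod_two_eq_zero_or_one (labelIndex x / 2 ^ (l : ℕ)) with h | h <;> simp [h]

/-- The prescribed bits at a node of the tree: the first `k` bits are those of `r`. -/
def prefixFlags (n k r : ℕ) (l : Fin n) : Option Bool :=
  if (l : ℕ) < k then some (r.testBit l) else none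

theorem labelIndex_mod_eq_iff {n k r : ℕ} (hr : r < 2 ^ k) (hk : k ≤ n) (x : Fin n → Bool) :
    labelIndex x % 2 ^ k = r ↔ ∀ l : Fin n, (l : ℕ) < k → x l = r.testBit l := by
  constructor
  · rintro h l hl
    rw [← h, Nat.testBit_mod_two_pow, testBit_labelIndex]; simp [hl]
  · intro h
    refine Nat.eq_of_testBit_eq fun i => ?_
    rw [Nat.testBit_mod_two_pow]
    by_cases hi : i < k
    · have := h ⟨i, by omega⟩ hi
      rw [← testBit_labelIndex x] at this
      simpa [hi] using this
    · rw [Nat.testBit_lt_two_pow (hr.trans_le (Nat.pow_le_pow_right two_pos (not_lt.1 hi)))]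
      simp [hi]

theorem compatProd_prefixFlags {n k r : ℕ} (hr : r < 2 ^ k) (hk : k ≤ n) (x : Fin n → Bool) :
    compatProd (prefixFlags n k r) x = if labelIndex x % 2 ^ k = r then 1 else 0 := by
  rw [compatProd]
  split_ifs with h
  · rw [labelIndex_mod_eq_iff hr hk] at h
    refine Finset.prod_eq_one fun l _ => ?_
    unfold prefixFlags
    split_ifs with hl
    · simp [compat, h l hl]
    · rfl
  · rw [labelIndex_mod_eq_iff hr hk] at h
    push Not at h
    obtain ⟨l, hl, hne⟩ := h
    refine Finset.prod_eq_zero (Finset.mem_univ l) ?_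
    simp [prefixFlags, hl, compat, hne]

theorem freeCount_prefixFlags {n k r : ℕ} (hk : k ≤ n) :
    freeCount (prefixFlags n k r) = n - k := by
  have h1 : ∀ l : Fin n, (if prefixFlags n k r l = none then 1 else 0) =
      if (l : ℕ) < k then 0 else 1 := by
    intro l; unfold prefixFlags; split_ifs <;> simp_all
  rw [freeCount, Finset.sum_congr rfl fun l _ => h1 l,
    Fin.sum_univ_eq_sum_range (fun l => if l < k then 0 else 1) n]
  obtain ⟨j, rfl⟩ := Nat.exists_eq_add_of_le hk
  rw [Finset.sum_range_add, Finset.sum_eq_zero fun l hl => if_pos (Finset.mem_range.1 hl)]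
  simp

/-! ### One copy -/

/-- The basis and the outcome of the measurement of one copy. -/
abbrev Observation (n : ℕ) : Type := (Fin n → Fin 3) × (Fin n → Bool)

section

variable {n : ℕ} (f : Fin n → Option Bool) (ψ a b : (Fin n → Bool) → ℂ)

/-- Probability of an observation. Only whether a bit is prescribed matters here, not its value:
the former says which qubits are measured in the basis `Z`. -/
noncomputable def law (x : Observation n) : ℝ := basisWeight f x.1 * ‖productAmp x.1 x.2 ψ‖ ^ 2

/-- The estimate that one observation gives of `⟨a|ψ⟩⟨ψ|b⟩`. -/
noncomputable def observable (x : Observation n) : ℂ :=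
  (∑ z, ∑ z', shadowProd f x.1 x.2 z z' * (star (a z) * b z')) / 2 ^ freeCount f

theorem law_nonneg (x : Observation n) : 0 ≤ law f ψ x :=
  mul_nonneg (basisWeight_nonneg _ _) (sq_nonneg _)

theorem sum_pauliWeight (t : Option Bool) : ∑ P, pauliWeight t P = 1 := by
  cases t <;> simp [pauliWeight]

theorem sum_basisWeight : ∑ P, basisWeight f P = 1 := by
  unfold basisWeight
  rw [← Fintype.prod_sum]
  simp [sum_pauliWeight]

variable {ψ a b}

theorem sum_law (hψ : ∑ y, ‖ψ y‖ ^ 2 = 1) : ∑ x, law f ψ x = 1 := by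
  rw [Fintype.sum_prod_type]
  simp only [law, ← Finset.mul_sum, sum_sq_norm_productAmp, hψ, mul_one, sum_basisWeight]

variable {f}

theorem mean_observable (ha : ∀ z, (compatProd f z : ℂ) * a z = a z)
    (hb : ∀ z, (compatProd f z : ℂ) * b z = b z) :
    ∑ x, (law f ψ x : ℂ) * observable f a b x =
      (∑ z, star (a z) * ψ z) * star (∑ z, star (b z) * ψ z) := by
  have hc : ∀ z, star (compatProd f z : ℂ) = (compatProd f z : ℂ) := fun z => Complex.conj_ofReal _
  calc _ = (∑ z, ∑ z', (∑ P, ∑ o, ((basisWeight f P * ‖productAmp P o ψ‖ ^ 2 : ℝ) : ℂ) *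
        shadowProd f P o z z') * (star (a z) * b z')) / 2 ^ freeCount f := by
        simp only [observable, law, mul_div_assoc', ← Finset.sum_div, Finset.mul_sum]
        rw [Finset.sum_comm]
        refine congrArg (· / _) (Finset.sum_congr rfl fun z _ => ?_)
        rw [Finset.sum_comm]
        refine Finset.sum_congr rfl fun z' _ => ?_
        simp only [Fintype.sum_prod_type, Finset.sum_mul, mul_assoc]
    _ = ∑ z, ∑ z', (star ((compatProd f z : ℂ) * a z) * ψ z) *
        star (star ((compatProd f z' : ℂ) * b z') * ψ z') := by
        rw [Finset.sum_div]
        refine Finset.sum_congr rfl fun z _ => ?_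
        rw [Finset.sum_div]
        refine Finset.sum_congr rfl fun z' _ => ?_
        rw [mean_shadowProd]
        simp only [star_mul', star_star, hc]
        push_cast
        field_simp
    _ = _ := by
        simp only [ha, hb]
        rw [star_sum, Finset.sum_mul_sum]

theorem norm_observable_le (ha : ∑ z, ‖a z‖ ^ 2 ≤ 1) (hb : ∑ z, ‖b z‖ ^ 2 ≤ 1)
    (x : Observation n) : ‖observable f a b x‖ ≤ 2 ^ freeCount f := by
  rw [observable, norm_div, norm_pow, Complex.norm_ofNat, div_le_iff₀ (by positivity), ← mul_pow]
  norm_num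
  exact norm_shadowProd_form_le f x.1 x.2 a b ha hb

theorem secondMoment_observable_le (ha : ∑ z, ‖a z‖ ^ 2 ≤ 1) (hb : ∑ z, ‖b z‖ ^ 2 ≤ 1) :
    ∑ x, law f ψ x * ‖observable f a b x‖ ^ 2 ≤
      2 ^ freeCount f * ∑ z, compatProd f z * ‖ψ z‖ ^ 2 := by
  have h1 := secondMoment_shadowProd f ψ fun z z' => star (a z) * b z'
  have h2 : ∑ z, ∑ z', ‖star (a z) * b z'‖ ^ 2 ≤ 1 := by
    simp only [norm_mul, norm_star, mul_pow, ← Finset.mul_sum, ← Finset.sum_mul]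
    exact mul_le_one₀ ha (Finset.sum_nonneg fun _ _ => sq_nonneg _) hb
  have h3 : 0 ≤ ∑ z, compatProd f z * ‖ψ z‖ ^ 2 :=
    Finset.sum_nonneg fun z _ => mul_nonneg (compatProd_nonneg _ _) (sq_nonneg _)
  have h4 : ∑ x, law f ψ x * ‖observable f a b x‖ ^ 2 = (∑ P, ∑ o, basisWeight f P *
      (‖productAmp P o ψ‖ ^ 2 * ‖∑ z, ∑ z', shadowProd f P o z z' *
        (star (a z) * b z')‖ ^ 2)) / 4 ^ freeCount f := by
    rw [Fintype.sum_prod_type, Finset.sum_div]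
    refine Finset.sum_congr rfl fun P _ => ?_
    rw [Finset.sum_div]
    refine Finset.sum_congr rfl fun o _ => ?_
    rw [law, observable, norm_div, div_pow, norm_pow, Complex.norm_ofNat, ← pow_mul, mul_comm _ 2,
      pow_mul]
    norm_num
    ring
  rw [h4, div_le_iff₀ (by positivity)]
  refine h1.trans ?_
  calc _ ≤ 8 ^ freeCount f * ((∑ z, compatProd f z * ‖ψ z‖ ^ 2) * 1) :=
        mul_le_mul_of_nonneg_left (mul_le_mul_of_nonneg_left h2 h3) (by positivity)
    _ = _ := by
        rw [show (8 : ℝ) = 2 * 4 by norm_num, mul_pow]; ring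

end

/-! ### The estimates as averages of independent observables -/

/-- The data of the estimator for given observations. -/
def observed (n R : ℕ) (d : Fin (n * R) → Observation n) : Data where
  n := n
  R := R
  basis q := if h : q < n * R * n then
    (((d (Fin.divNat ⟨q, h⟩)).1 (Fin.modNat ⟨q, h⟩) : ℕ) : ℤ) else 0
  outcome q := if h : q < n * R * n then
    bitInt ((d (Fin.divNat ⟨q, h⟩)).2 (Fin.modNat ⟨q, h⟩)) else 0

section

variable {n R : ℕ} (d : Fin (n * R) → Observation n)

theorem cell_lt (c : Fin (n * R)) (l : Fin n) : (c : ℕ) * n + l < n * R * n := by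
  have h1 := c.2
  have h2 := l.2
  have : ((c : ℕ) + 1) * n ≤ n * R * n := Nat.mul_le_mul_right _ h1
  rw [Nat.add_mul] at this; omega

theorem divNat_cell (c : Fin (n * R)) (l : Fin n) :
    Fin.divNat ⟨(c : ℕ) * n + l, cell_lt c l⟩ = c := by
  apply Fin.ext
  have h2 := l.2
  change ((c : ℕ) * n + l) / n = c
  rw [mul_comm, Nat.mul_add_div (by omega), Nat.div_eq_of_lt h2, add_zero]

theorem modNat_cell (c : Fin (n * R)) (l : Fin n) :
    Fin.modNat ⟨(c : ℕ) * n + l, cell_lt c l⟩ = l := by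
  apply Fin.ext
  change ((c : ℕ) * n + l) % n = l
  rw [mul_comm, Nat.mul_add_mod, Nat.mod_eq_of_lt l.2]

theorem observed_basis (c : Fin (n * R)) (l : Fin n) :
    (observed n R d).basis (c * n + l) = (((d c).1 l : ℕ) : ℤ) := by
  simp only [observed, dif_pos (cell_lt c l), divNat_cell, modNat_cell]

theorem observed_outcome (c : Fin (n * R)) (l : Fin n) :
    (observed n R d).outcome (c * n + l) = bitInt ((d c).2 l) := by
  simp only [observed, dif_pos (cell_lt c l), divNat_cell, modNat_cell]

theorem bitInt_inj {a b : Bool} : bitInt a = bitInt b ↔ a = b := by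
  cases a <;> cases b <;> simp [bitInt]

theorem toComplex_weight {k r : ℕ} (hr : r < 2 ^ k) (hk : k ≤ n) (c : Fin (n * R))
    {z z' : Fin n → Bool} (hz : labelIndex z % 2 ^ k = r) (hz' : labelIndex z' % 2 ^ k = r) :
    ((observed n R d).weight k c (labelIndex z) (labelIndex z') : ℂ) =
      shadowProd (prefixFlags n k r) (d c).1 (d c).2 z z' := by
  rw [labelIndex_mod_eq_iff hr hk] at hz hz'
  have hn : (observed n R d).n = n := rfl
  rw [Data.weight, hn, shadowProd, map_prod, ← Fin.prod_univ_eq_prod_range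
    (fun l => (entry k l ((observed n R d).basis (c * n + l)) ((observed n R d).outcome (c * n + l))
      (digit (labelIndex z) l) (digit (labelIndex z') l) : ℂ)) n]
  refine Finset.prod_congr rfl fun l _ => ?_
  rw [observed_basis, observed_outcome, digit_labelIndex, digit_labelIndex]
  unfold prefixFlags
  split_ifs with hl
  · simp only [entry, if_pos hl, shadow, bitInt_inj, hz l hl, hz' l hl]
    by_cases h : (d c).2 l = r.testBit l
    · simp [h, GaussianInt.toComplex_def]
    · simp [h, Ne.symm h, GaussianInt.toComplex_def]
  · simp only [shadow]
    rw [show entry k l = entry 0 0 by funext P o a b; simp only [entry, if_neg hl, lt_irrefl,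
      if_false]]

end

section

variable {n : ℕ} {Φ : ℕ → GaussianInt} {k r : ℕ}

/-- The normalized restriction of `Φ` to a residue class. -/
noncomputable def unitPart (n : ℕ) (Φ : ℕ → GaussianInt) (k q : ℕ) (z : Fin n → Bool) : ℂ :=
  if labelIndex z % 2 ^ k = q then (Φ (labelIndex z) : ℂ) / (√(classMass n Φ k q) : ℝ) else 0

theorem sum_sq_norm_unitPart_le (q : ℕ) : ∑ z, ‖unitPart n Φ k q z‖ ^ 2 ≤ 1 := by
  have h : ∑ z, ‖unitPart n Φ k q z‖ ^ 2 = classMass n Φ k q / classMass n Φ k q := by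
    conv_rhs => arg 1; rw [classMass, classSum, sum_range_eq_sum_label]
    rw [Finset.sum_div]
    refine Finset.sum_congr rfl fun z _ => ?_
    unfold unitPart
    split_ifs
    · rw [norm_div, div_pow, Complex.norm_real, Real.norm_eq_abs, sq_abs,
        Real.sq_sqrt classMass_nonneg]
    · simp
  rw [h]
  exact div_self_le_one _

theorem compatProd_mul_unitPart (hr : r < 2 ^ k) (hk : k ≤ n) (i : Bool) (z : Fin n → Bool) :
    (compatProd (prefixFlags n k r) z : ℂ) * unitPart n Φ (k + 1) (child k r i) z =
      unitPart n Φ (k + 1) (child k r i) z := by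
  rw [compatProd_prefixFlags hr hk, unitPart]
  by_cases h : labelIndex z % 2 ^ (k + 1) = child k r i
  · simp [mod_of_mod_child hr h]
  · simp [h]

theorem sum_unitPart_mul (v : ℕ → ℂ) (q : ℕ) :
    ∑ z, star (unitPart n Φ k q z) * v (labelIndex z) = unitOverlap n v Φ k q := by
  rw [unitOverlap, overlap, classSum, sum_range_eq_sum_label, Finset.sum_div]
  refine Finset.sum_congr rfl fun z _ => ?_
  unfold unitPart
  split_ifs
  · rw [star_div₀, show star ((√(classMass n Φ k q) : ℝ) : ℂ) = (√(classMass n Φ k q) : ℝ) from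
      Complex.conj_ofReal _]
    ring
  · simp

theorem sum_compatProd_mul (v : ℕ → ℂ) (hr : r < 2 ^ k) (hk : k ≤ n) :
    ∑ z, compatProd (prefixFlags n k r) z * ‖v (labelIndex z)‖ ^ 2 = classProb n v k r := by
  rw [classProb, classSum, sum_range_eq_sum_label]
  refine Finset.sum_congr rfl fun z _ => ?_
  rw [compatProd_prefixFlags hr hk, ite_mul, one_mul, zero_mul]

/-- The copies of level `k` form a block. -/
def levelEquiv {n R k : ℕ} (hk : k < n) (hR : 1 ≤ R) :
    Fin R ≃ {j : Fin (n * R) // (j : ℕ) / R = k} where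
  toFun i := ⟨⟨k * R + i, by
    have : (k + 1) * R ≤ n * R := Nat.mul_le_mul_right _ hk
    have := i.2
    rw [Nat.add_mul] at *; omega⟩, by
    change (k * R + i) / R = k
    rw [mul_comm, Nat.mul_add_div (by omega), Nat.div_eq_of_lt i.2, add_zero]⟩
  invFun j := ⟨(j.1 : ℕ) % R, Nat.mod_lt _ (by omega)⟩
  left_inv i := by
    apply Fin.ext
    simp only [mul_comm k R, Nat.mul_add_mod, Nat.mod_eq_of_lt i.2]
  right_inv j := by
    apply Subtype.ext
    apply Fin.ext
    have := Nat.div_add_mod (j.1 : ℕ) R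
    rw [j.2, mul_comm] at this
    exact this

theorem mul_unitGram {R : ℕ} (d : Fin (n * R) → Observation n) (hR : 1 ≤ R) (hk : k < n)
    (hr : r < 2 ^ k) (i j : Bool) :
    (R : ℂ) * (observed n R d).unitGram Φ k (child k r i) (child k r j) =
      ∑ c : {c : Fin (n * R) // (c : ℕ) / R = k}, observable (prefixFlags n k r)
        (unitPart n Φ (k + 1) (child k r i)) (unitPart n Φ (k + 1) (child k r j)) (d c) := by
  have hRC : (R : ℂ) ≠ 0 := by exact_mod_cast (show R ≠ 0 by omega)
  have hn : (observed n R d).n = n := rfl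
  have hR' : (observed n R d).R = R := rfl
  set q := child k r i with hq
  set q' := child k r j with hq'
  have hgram : ((observed n R d).gram Φ k q q' : ℂ) =
      ∑ c : Fin R, ∑ z : Fin n → Bool, ∑ z' : Fin n → Bool,
        ((observed n R d).gramTerm Φ k q q' c (labelIndex z) (labelIndex z') : ℂ) := by
    rw [Data.gram, hn, hR', ← Fin.sum_univ_eq_sum_range (fun c => ∑ y ∈ Finset.range (2 ^ n),
      ∑ y' ∈ Finset.range (2 ^ n), (observed n R d).gramTerm Φ k q q' c y y') R]
    simp only [sum_range_eq_sum_label, map_sum]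
  rw [Data.unitGram, hgram, hn, hR', ← (levelEquiv hk hR).sum_comp, Finset.sum_div,
    Finset.mul_sum]
  refine Finset.sum_congr rfl fun c _ => ?_
  rw [observable, freeCount_prefixFlags hk.le, Finset.sum_div, Finset.sum_div, Finset.mul_sum]
  refine Finset.sum_congr rfl fun z _ => ?_
  rw [Finset.sum_div, Finset.sum_div, Finset.mul_sum]
  refine Finset.sum_congr rfl fun z' _ => ?_
  unfold Data.gramTerm unitPart
  by_cases hz : labelIndex z % 2 ^ (k + 1) = q
  · by_cases hz' : labelIndex z' % 2 ^ (k + 1) = q'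
    · have hw := toComplex_weight d hr hk.le ((levelEquiv hk hR c) : Fin (n * R))
        (mod_of_mod_child hr hz) (mod_of_mod_child hr hz')
      have hc : (((levelEquiv hk hR c) : Fin (n * R)) : ℕ) = k * R + c := rfl
      rw [hc] at hw
      rw [if_pos ⟨hz, hz'⟩, if_pos hz, if_pos hz', map_mul, map_mul, hR', hw,
        GaussianInt.toComplex_star, star_div₀, show star ((√(classMass n Φ (k + 1) q) : ℝ) : ℂ) =
          (√(classMass n Φ (k + 1) q) : ℝ) from Complex.conj_ofReal _]
      push_cast
      rw [mul_div_assoc', Complex.star_def]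
      field_simp
    · simp [hz']
  · simp [hz]

end

/-! ### The probability that some estimate is inaccurate -/

theorem law_prefixFlags {n : ℕ} (k r r' : ℕ) (ψ : (Fin n → Bool) → ℂ) :
    law (prefixFlags n k r) ψ = law (prefixFlags n k r') ψ := by
  funext x
  rw [law, law]
  congr 1
  refine Finset.prod_congr rfl fun l _ => ?_
  unfold prefixFlags
  split_ifs <;> rfl

/-- The law of the observation of copy `c`, when the bases are exactly uniform. -/
noncomputable def copyLaw (n R : ℕ) (v : ℕ → ℂ) (c : Fin (n * R)) : Observation n → ℝ :=
  law (prefixFlags n ((c : ℕ) / R) 0) fun x => v (labelIndex x)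

/-- The vectors whose overlaps are estimated at a level do not depend on the copies of that
level. -/
theorem amplitude_observed_congr {n R h : ℕ} (hh : h < n) (hR : 1 ≤ R)
    {d d' : Fin (n * R) → Observation n}
    (hd : ∀ j : Fin (n * R), ¬ (j : ℕ) / R = n - 1 - h → d j = d' j) :
    (observed n R d).amplitude h = (observed n R d').amplitude h := by
  refine Data.amplitude_congr (D := observed n R d) (D' := observed n R d') rfl rfl h hh.le
    fun c hc hc' l hl => ?_
  have hl' : l < n := hl
  have hc2 : c < n * R := hc'
  have h1 : d ⟨c, hc2⟩ = d' ⟨c, hc2⟩ := by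
    refine hd _ fun h2 => ?_
    change c / R = n - 1 - h at h2
    have h3 : (n - h) * R ≤ c := hc
    have h4 := (Nat.le_div_iff_mul_le hR).2 h3
    omega
  have h5 := observed_basis d ⟨c, hc2⟩ ⟨l, hl'⟩
  have h6 := observed_basis d' ⟨c, hc2⟩ ⟨l, hl'⟩
  have h7 := observed_outcome d ⟨c, hc2⟩ ⟨l, hl'⟩
  have h8 := observed_outcome d' ⟨c, hc2⟩ ⟨l, hl'⟩
  rw [h1] at h5 h7
  exact ⟨h5.trans h6.symm, h7.trans h8.symm⟩

section

variable {n R : ℕ} {v : ℕ → ℂ} {lam : ℝ}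

theorem copyLaw_nonneg (c : Fin (n * R)) (x : Observation n) : 0 ≤ copyLaw n R v c x :=
  law_nonneg _ _ _

theorem sum_copyLaw (hv : ∑ z : Fin n → Bool, ‖v (labelIndex z)‖ ^ 2 = 1) (c : Fin (n * R)) :
    ∑ x, copyLaw n R v c x = 1 := sum_law _ hv

/-- A single estimate is inaccurate in the direction `t` only with small probability. The
parameter of the exponential moment is chosen so that the exponent in Bernstein's
inequality becomes `lam`. -/
theorem prob_deviation_le (hv : ∑ z : Fin n → Bool, ‖v (labelIndex z)‖ ^ 2 = 1) (hR : 1 ≤ R)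
    (hlam : 0 < lam) {h r : ℕ} (hh : h < n) (hr : r < 2 ^ (n - 1 - h)) (i j : Bool) {t : ℂ}
    (ht : ‖t‖ = 1) :
    prob (copyLaw n R v) (fun d =>
      Data.tolerance (2 ^ (n - (n - 1 - h)) * lam / R) (classProb n v (n - 1 - h) r) ≤
        (t * (observed n R d).gramError v ((observed n R d).amplitude h) (n - 1 - h) r i j).re) ≤
      Real.exp (-lam) := by
  have hk : n - 1 - h < n := by omega
  have hRpos : (0 : ℝ) < R := by exact_mod_cast hR
  set k := n - 1 - h with hkdef
  set f := prefixFlags n k r with hf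
  set p := classProb n v k r with hp
  set B : ℝ := 2 ^ (n - k) * lam / R with hB
  have hBpos : 0 < B := by positivity
  have hmax : 0 < max p B := lt_max_of_lt_right hBpos
  set η := Data.tolerance B p with hη
  have hη0 : 0 ≤ η := by rw [hη, Data.tolerance]; positivity
  have hη2 : η ^ 2 = 4 * (max p B * B) := by
    rw [hη, Data.tolerance, mul_pow, Real.sq_sqrt (by positivity)]; norm_num
  have hηle : η ≤ 2 * max p B := by
    refine (pow_le_pow_iff_left₀ hη0 (by positivity) two_ne_zero).1 ?_
    rw [hη2]
    have := mul_le_mul_of_nonneg_left (le_max_right p B) hmax.le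
    nlinarith
  set σ : ℝ := 2 ^ (n - k) * max p B with hσ
  have hσ0 : 0 < σ := by positivity
  set Φ : (Fin (n * R) → Observation n) → ℕ → GaussianInt :=
    fun d => (observed n R d).amplitude h with hΦ
  set a : (Fin (n * R) → Observation n) → Bool → (Fin n → Bool) → ℂ :=
    fun d i => unitPart n (Φ d) (k + 1) (child k r i) with ha
  have hΦc : ∀ d d' : Fin (n * R) → Observation n,
      (∀ j : Fin (n * R), ¬ (j : ℕ) / R = k → d j = d' j) → Φ d = Φ d' :=
    fun d d' hd => amplitude_observed_congr hh hR hd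
  have hlaw : ∀ c : Fin (n * R), (c : ℕ) / R = k →
      copyLaw n R v c = law f fun x => v (labelIndex x) := by
    intro c hc; rw [copyLaw, hc]; exact law_prefixFlags _ _ _ _
  have hfree : freeCount f = n - k := freeCount_prefixFlags hk.le
  have hobs : ∀ d x, |(t * observable f (a d i) (a d j) x).re| ≤ ‖observable f (a d i) (a d j) x‖ :=
    fun d x => (Complex.abs_re_le_norm _).trans (by rw [norm_mul, ht, one_mul])
  have key := prob_sum_ge_le_of_indep (μ := copyLaw n R v) copyLaw_nonneg (sum_copyLaw hv)
    (fun c : Fin (n * R) => (c : ℕ) / R = k)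
    (fun d _ x => (t * observable f (a d i) (a d j) x).re)
    (fun d => (t * (unitOverlap n v (Φ d) (k + 1) (child k r i) *
      star (unitOverlap n v (Φ d) (k + 1) (child k r j)))).re)
    (fun _ => σ) (fun _ => η) (fun _ => η / (2 * σ)) (b := 2 ^ (n - k)) (β := Real.exp (-lam))
    (R := R) (by rw [← Fintype.card_congr (levelEquiv hk hR), Fintype.card_fin])
    (fun d d' hd => by
      simp only [ha, hΦc d d' hd])
    (fun d _ x => (hobs d x).trans (by
      rw [← hfree]
      exact norm_observable_le (sum_sq_norm_unitPart_le _) (sum_sq_norm_unitPart_le _) x))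
    (fun d c hc => by
      rw [hlaw c hc, ← sum_unitPart_mul, ← sum_unitPart_mul,
        ← mean_observable (f := f) (compatProd_mul_unitPart hr hk.le i)
          (compatProd_mul_unitPart hr hk.le j), Finset.mul_sum, Complex.re_sum]
      refine Finset.sum_congr rfl fun x _ => ?_
      rw [mul_left_comm, Complex.re_ofReal_mul])
    (fun d c hc => by
      rw [hlaw c hc]
      refine (Finset.sum_le_sum fun x _ => mul_le_mul_of_nonneg_left
        (sq_le_sq' (neg_le_of_abs_le (hobs d x)) (le_of_abs_le (hobs d x)))
        (law_nonneg _ _ _)).trans ?_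
      refine (secondMoment_observable_le (sum_sq_norm_unitPart_le _)
        (sum_sq_norm_unitPart_le _)).trans ?_
      rw [hfree, sum_compatProd_mul v hr hk.le]
      exact mul_le_mul_of_nonneg_left (le_max_left _ _) (by positivity))
    (fun _ => by positivity)
    (fun _ => by
      rw [div_mul_eq_mul_div, div_le_one (by positivity), hσ]
      have : (0 : ℝ) < 2 ^ (n - k) := by positivity
      nlinarith)
    (fun _ _ _ => rfl)
    (fun _ => by
      refine le_of_eq ?_
      have h1 : (R : ℝ) * (η / (2 * σ) * η - (η / (2 * σ)) ^ 2 * σ) = R * η ^ 2 / (4 * σ) := by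
        field_simp; ring
      rw [h1, hη2, hσ, hB]
      congr 1
      field_simp)
  refine (prob_mono copyLaw_nonneg fun d hd => ?_).trans key
  have h2 := mul_unitGram (Φ := Φ d) d hR hk hr i j
  have h3 : (∑ c : {c : Fin (n * R) // (c : ℕ) / R = k},
      (t * observable f (a d i) (a d j) (d c)).re) =
      R * (t * (observed n R d).unitGram (Φ d) k (child k r i) (child k r j)).re := by
    rw [← Complex.re_sum, ← Finset.mul_sum, ← h2, mul_left_comm]
    rw [show ((R : ℕ) : ℂ) = ((R : ℝ) : ℂ) by simp, Complex.re_ofReal_mul]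
  rw [h3]
  refine mul_le_mul_of_nonneg_left ?_ hRpos.le
  rw [Data.gramError, mul_sub, Complex.sub_re] at hd
  change η ≤ (t * (observed n R d).unitGram (Φ d) k (child k r i) (child k r j)).re -
    (t * (unitOverlap n v (Φ d) (k + 1) (child k r i) *
      star (unitOverlap n v (Φ d) (k + 1) (child k r j)))).re at hd
  linarith

/-- Every node of the tree is accurate for the given observations. -/
def AllAccurate (D : Data) (v : ℕ → ℂ) (lam : ℝ) : Prop :=
  ∀ h < D.n, ∀ r < 2 ^ (D.n - 1 - h),
    D.Accurate v (D.amplitude h) (D.n - 1 - h) r (D.levelTolerance lam (D.n - 1 - h))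

theorem sum_two_pow_levels (n : ℕ) : ∑ h ∈ Finset.range n, (2 : ℝ) ^ (n - 1 - h) = 2 ^ n - 1 := by
  rw [Finset.sum_range_reflect (fun j => (2 : ℝ) ^ j) n, geom_sum_eq (by norm_num)]
  norm_num

/-- The union bound over the nodes, the four entries and the four directions. -/
theorem prob_not_allAccurate_le (hv : ∑ z : Fin n → Bool, ‖v (labelIndex z)‖ ^ 2 = 1) (hR : 1 ≤ R)
    (hlam : 0 < lam) :
    prob (copyLaw n R v) (fun d => ¬ AllAccurate (observed n R d) v lam) ≤
      16 * 2 ^ n * Real.exp (-lam) := by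
  set dir : Fin 4 → ℂ := ![1, -1, -Complex.I, Complex.I] with hdir
  have hdir1 : ∀ t, ‖dir t‖ = 1 := fun t => by fin_cases t <;> simp [hdir]
  set E : ℕ → ℕ → Bool × Bool × Fin 4 → (Fin (n * R) → Observation n) → Prop := fun h r e d =>
    Data.tolerance (2 ^ (n - (n - 1 - h)) * lam / R) (classProb n v (n - 1 - h) r) ≤
      (dir e.2.2 * (observed n R d).gramError v ((observed n R d).amplitude h) (n - 1 - h) r
        e.1 e.2.1).re with hE
  have h1 : ∀ d, ¬ AllAccurate (observed n R d) v lam →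
      ∃ h ∈ Finset.range n, ∃ r ∈ Finset.range (2 ^ (n - 1 - h)), ∃ e ∈ Finset.univ, E h r e d := by
    intro d hd
    by_contra hcon
    push Not at hcon
    refine hd fun h hh r hr i j => ?_
    have h2 := hcon h (Finset.mem_range.2 hh) r (Finset.mem_range.2 hr)
    simp only [hE, Finset.mem_univ, true_imp_iff, not_le] at h2
    have a0 := h2 (i, j, 0)
    have a1 := h2 (i, j, 1)
    have a2 := h2 (i, j, 2)
    have a3 := h2 (i, j, 3)
    simp [hdir] at a0 a1 a2 a3
    exact ⟨abs_le.2 ⟨by linarith!, a0.le⟩, abs_le.2 ⟨by linarith!, a2.le⟩⟩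
  refine (prob_mono copyLaw_nonneg h1).trans ((prob_exists_le copyLaw_nonneg _ _).trans ?_)
  have h3 : ∀ h ∈ Finset.range n, prob (copyLaw n R v)
      (fun d => ∃ r ∈ Finset.range (2 ^ (n - 1 - h)), ∃ e ∈ Finset.univ, E h r e d) ≤
      2 ^ (n - 1 - h) * (16 * Real.exp (-lam)) := by
    intro h hh
    refine (prob_exists_le copyLaw_nonneg _ _).trans ?_
    refine (Finset.sum_le_card_nsmul _ _ (16 * Real.exp (-lam)) fun r hr => ?_).trans ?_
    · refine (prob_exists_le copyLaw_nonneg _ _).trans ?_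
      refine (Finset.sum_le_card_nsmul _ _ (Real.exp (-lam)) fun e _ => ?_).trans ?_
      · exact prob_deviation_le hv hR hlam (Finset.mem_range.1 hh) (Finset.mem_range.1 hr) _ _
          (hdir1 _)
      · simp
    · simp
  refine (Finset.sum_le_sum h3).trans ?_
  rw [← Finset.sum_mul, sum_two_pow_levels]
  have := Real.exp_pos (-lam)
  nlinarith

end

/-! ### Random bits -/

section

variable {J : Type*} [Fintype J]

/-- Finitely many of the random bits are independent and fair. -/
theorem coinMeasure_eval_eq {e : J → ℕ} (he : Function.Injective e) (b : J → Bool) :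
    coinMeasure {ω | (fun j => ω (e j)) = b} = (2⁻¹ : ENNReal) ^ Fintype.card J := by
  classical
  have hset : {ω : ℕ → Bool | (fun j => ω (e j)) = b} =
      Set.pi ((Finset.univ.map ⟨e, he⟩ : Finset ℕ) : Set ℕ)
        fun i => {x | ∀ j, e j = i → x = b j} := by
    ext ω
    simp only [Set.mem_ofPred_eq, funext_iff, Set.mem_pi, Finset.coe_map,
      Function.Embedding.coeFn_mk, Finset.coe_univ, Set.image_univ, Set.mem_range,
      forall_exists_index, forall_apply_eq_imp_iff]
    refine forall_congr' fun j => ⟨fun h j' hj => ?_, fun h => h j rfl⟩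
    rw [he hj]; exact h
  rw [hset, coinMeasure, Measure.infinitePi_pi _ fun _ _ => MeasurableSet.of_discrete,
    Finset.prod_map]
  rw [← Finset.card_univ, ← Finset.prod_const]
  refine Finset.prod_congr rfl fun j _ => ?_
  have : {x | ∀ j', e j' = (⟨e, he⟩ : J ↪ ℕ) j → x = b j'} = {b j} := by
    ext x
    refine ⟨fun h => h j rfl, fun h j' hj => ?_⟩
    have : j' = j := he hj
    rw [this]; exact h
  rw [this, PMF.toMeasure_apply_singleton _ _ (MeasurableSet.singleton _)]
  simp [PMF.uniformOfFintype_apply]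

theorem lintegral_coinMeasure [DecidableEq J] {e : J → ℕ} (he : Function.Injective e)
    (F : (J → Bool) → ENNReal) :
    ∫⁻ ω, F (fun j => ω (e j)) ∂coinMeasure = ∑ b, F b * (2⁻¹ : ENNReal) ^ Fintype.card J := by
  have hmeas : Measurable fun (ω : ℕ → Bool) (j : J) => ω (e j) :=
    measurable_pi_lambda _ fun j => measurable_pi_apply _
  rw [← lintegral_map (f := F) (measurable_of_finite F) hmeas, lintegral_fintype]
  refine Finset.sum_congr rfl fun b _ => ?_
  rw [Measure.map_apply hmeas (MeasurableSet.singleton _)]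
  congr 1
  exact coinMeasure_eval_eq he b

end

/-! ### Near-uniform elements of `Fin 3` from random bits -/

/-- Every residue modulo three has about a third of the numbers below `M`. -/
theorem card_filter_mod_three_le (M a : ℕ) :
    3 * ((Finset.range M).filter fun y => y % 3 = a).card ≤ M + 2 := by
  have h : ((Finset.range M).filter fun y => y % 3 = a).card ≤
      (Finset.range ((M + 2) / 3)).card := by
    refine Finset.card_le_card_of_injOn (fun y => y / 3) (fun y hy => ?_) fun y hy y' hy' hh => ?_
    · simp only [Finset.coe_filter, Finset.mem_range, Set.mem_ofPred_eq] at hy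
      simp only [Finset.coe_range, Set.mem_Iio]; omega
    · simp only [Finset.coe_filter, Finset.mem_range, Set.mem_ofPred_eq] at hy hy'
      have hh' : y / 3 = y' / 3 := hh
      omega
  rw [Finset.card_range] at h
  omega

/-- The basis for a qubit in terms of its block of random bits. -/
def tritOf (z : Bool) {t : ℕ} (b : Fin t → Bool) : Fin 3 :=
  if z then 2 else ⟨labelIndex b % 3, Nat.mod_lt _ (by norm_num)⟩

/-- The exact law that `tritOf` approximates. -/
noncomputable def tritWeight (z : Bool) (P : Fin 3) : ℝ :=
  pauliWeight (if z then some false else none) P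

theorem sum_tritOf_le (z : Bool) (t : ℕ) (P : Fin 3) :
    ∑ b : Fin t → Bool, (if tritOf z b = P then ((2 : ℝ) ^ t)⁻¹ else 0) ≤
      tritWeight z P * (1 + 2 / 2 ^ t) := by
  have h2 : (0 : ℝ) < 2 ^ t := by positivity
  cases z
  · have h1 : ∀ b : Fin t → Bool, (if tritOf false b = P then ((2 : ℝ) ^ t)⁻¹ else 0) =
        if labelIndex b % 3 = P then ((2 : ℝ) ^ t)⁻¹ else 0 := by
      intro b
      simp only [tritOf, Fin.ext_iff, Bool.false_eq_true, if_false]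
    rw [Finset.sum_congr rfl fun b _ => h1 b,
      ← sum_range_eq_sum_label t fun y => if y % 3 = (P : ℕ) then ((2 : ℝ) ^ t)⁻¹ else 0,
      ← Finset.sum_filter, Finset.sum_const, nsmul_eq_mul]
    have h3 : (3 : ℝ) * ((Finset.range (2 ^ t)).filter fun y => y % 3 = (P : ℕ)).card ≤
        2 ^ t + 2 := by exact_mod_cast card_filter_mod_three_le (2 ^ t) P
    have e : tritWeight false P * (1 + 2 / 2 ^ t) = (2 ^ t + 2) / 3 * ((2 : ℝ) ^ t)⁻¹ := by
      simp only [tritWeight, pauliWeight, Bool.false_eq_true, if_false]; field_simp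
    rw [e]
    exact mul_le_mul_of_nonneg_right (by linarith) (by positivity)
  · have h3 : 0 ≤ 2 / (2 : ℝ) ^ t := by positivity
    by_cases h : P = 2
    · simpa [tritOf, tritWeight, pauliWeight, h] using h3
    · simp [tritOf, tritWeight, pauliWeight, h, Ne.symm h]

section

variable {κ : Type*} [Fintype κ] [DecidableEq κ]

/-- The blocks of random bits give probabilities that exceed the exact ones at most by a
constant factor. -/
theorem sum_trits_le (z : κ → Bool) (t : ℕ) (g : (κ → Fin 3) → ℝ) (hg : ∀ τ, 0 ≤ g τ) :
    ∑ β : κ → Fin t → Bool, (∏ _q : κ, ((2 : ℝ) ^ t)⁻¹) * g (fun q => tritOf (z q) (β q)) ≤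
      (1 + 2 / 2 ^ t) ^ Fintype.card κ * ∑ τ, (∏ q, tritWeight (z q) (τ q)) * g τ := by
  have h1 : ∀ β : κ → Fin t → Bool,
      (∏ _q : κ, ((2 : ℝ) ^ t)⁻¹) * g (fun q => tritOf (z q) (β q)) =
        ∑ τ, g τ * ∏ q, if tritOf (z q) (β q) = τ q then ((2 : ℝ) ^ t)⁻¹ else 0 := by
    intro β
    rw [Finset.sum_eq_single fun q => tritOf (z q) (β q)]
    · simp [mul_comm]
    · intro τ _ hne
      obtain ⟨q, hq⟩ := Function.ne_iff.1 hne
      rw [Finset.prod_eq_zero (Finset.mem_univ q) (if_neg (Ne.symm hq)), mul_zero]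
    · intro h; exact absurd (Finset.mem_univ _) h
  rw [Finset.sum_congr rfl fun β _ => h1 β, Finset.sum_comm, Finset.mul_sum]
  refine Finset.sum_le_sum fun τ _ => ?_
  rw [← Finset.mul_sum, ← Fintype.prod_sum fun (q : κ) (b : Fin t → Bool) =>
    if tritOf (z q) b = τ q then ((2 : ℝ) ^ t)⁻¹ else 0]
  have h2 : ∏ q, ∑ b : Fin t → Bool, (if tritOf (z q) b = τ q then ((2 : ℝ) ^ t)⁻¹ else 0) ≤
      ∏ q, tritWeight (z q) (τ q) * (1 + 2 / 2 ^ t) :=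
    Finset.prod_le_prod (fun q _ => Finset.sum_nonneg fun b _ => by positivity)
      fun q _ => sum_tritOf_le _ _ _
  rw [Finset.prod_mul_distrib, Finset.prod_const, Finset.card_univ] at h2
  refine (mul_le_mul_of_nonneg_left h2 (hg τ)).trans (le_of_eq ?_)
  ring

/-- Averaging over the random bits instead of the exact law of the bases. -/
theorem lintegral_trits_ge (z : κ → Bool) {t : ℕ} {e : κ × Fin t → ℕ}
    (he : Function.Injective e) (g : (κ → Fin 3) → ℝ) (hg : ∀ τ, 0 ≤ g τ) :
    ENNReal.ofReal (1 - (1 + 2 / 2 ^ t) ^ Fintype.card κ *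
        ∑ τ, (∏ q, tritWeight (z q) (τ q)) * g τ) ≤
      ∫⁻ ω, ENNReal.ofReal (1 - g fun q => tritOf (z q) fun j => ω (e (q, j))) ∂coinMeasure := by
  rw [lintegral_coinMeasure he fun b => ENNReal.ofReal
    (1 - g fun q => tritOf (z q) fun j => b (q, j))]
  set J := κ × Fin t
  have hcard : Fintype.card J = t * Fintype.card κ := by
    simp [J, Fintype.card_prod, mul_comm]
  have h1 : ∀ b : J → Bool, ENNReal.ofReal (1 - g fun q => tritOf (z q) fun j => b (q, j)) *
      (2⁻¹ : ENNReal) ^ Fintype.card J =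
      ENNReal.ofReal ((1 - g fun q => tritOf (z q) fun j => b (q, j)) *
        ∏ _q : κ, ((2 : ℝ) ^ t)⁻¹) := by
    intro b
    rw [ENNReal.ofReal_mul' (by positivity)]
    congr 1
    rw [Finset.prod_const, Finset.card_univ, hcard, pow_mul, ENNReal.ofReal_pow (by positivity),
      ENNReal.ofReal_inv_of_pos (by positivity), ENNReal.ofReal_pow (by positivity),
      ENNReal.inv_pow]
    simp
  rw [Finset.sum_congr rfl fun b _ => h1 b]
  refine le_trans (ENNReal.ofReal_le_ofReal ?_) (Finset.le_sum_of_subadditive ENNReal.ofReal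
    ENNReal.ofReal_zero.le (fun _ _ => ENNReal.ofReal_add_le) _ _)
  have h2 : ∑ β : κ → Fin t → Bool, ∏ _q : κ, ((2 : ℝ) ^ t)⁻¹ = 1 := by
    rw [← Fintype.prod_sum fun (_ : κ) (_ : Fin t → Bool) => ((2 : ℝ) ^ t)⁻¹]
    simp
  have h3 := (Equiv.curry κ (Fin t) Bool).sum_comp fun β : κ → Fin t → Bool =>
    (1 - g fun q => tritOf (z q) (β q)) * ∏ _q : κ, ((2 : ℝ) ^ t)⁻¹
  have h4 := sum_trits_le z t g hg
  have h5 : ∑ β : κ → Fin t → Bool, (1 - g fun q => tritOf (z q) (β q)) *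
      ∏ _q : κ, ((2 : ℝ) ^ t)⁻¹ = 1 - ∑ β : κ → Fin t → Bool, (∏ _q : κ, ((2 : ℝ) ^ t)⁻¹) *
        g (fun q => tritOf (z q) (β q)) := by
    simp only [sub_mul, one_mul, Finset.sum_sub_distrib, h2]
    congr 1
    exact Finset.sum_congr rfl fun β _ => mul_comm _ _
  rw [h5] at h3
  refine le_trans ?_ (le_of_eq h3.symm)
  linarith

end

theorem one_add_pow_le_two {t : ℕ} (ht : 4 ≤ t) : (1 + 2 / (2 : ℝ) ^ t) ^ t ≤ 2 := by
  have h1 : 4 * t ≤ 2 ^ t := by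
    induction t, ht using Nat.le_induction with
    | base => norm_num
    | succ t ht ih => rw [pow_succ]; omega
  have h2 : 4 * (t : ℝ) ≤ 2 ^ t := by exact_mod_cast h1
  have h3 : (1 + 2 / (2 : ℝ) ^ t) ^ t ≤ Real.exp (1 / 2) := by
    calc _ ≤ Real.exp (2 / 2 ^ t) ^ t := by
          refine pow_le_pow_left₀ (by positivity) ?_ _
          rw [add_comm]; exact Real.add_one_le_exp _
      _ = Real.exp (t * (2 / 2 ^ t)) := by rw [← Real.exp_nat_mul]
      _ ≤ _ := by
        refine Real.exp_le_exp.2 ?_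
        rw [mul_div_assoc', div_le_div_iff₀ (by positivity) (by norm_num)]
        linarith
  refine h3.trans ?_
  refine (pow_le_pow_iff_left₀ (Real.exp_pos _).le (by norm_num) two_ne_zero).1 ?_
  rw [← Real.exp_nat_mul]
  have := Real.exp_one_lt_three
  norm_num
  linarith

/-! ### The algorithm -/

/-- The tomography algorithm: one fixed pair of programs for all parameters. -/
def tomography : Algorithm where
  sampler := samplerCmd
  estimator := estimatorCmd

theorem Sampled.of_same {n K m : ℕ} {ω : ℕ → Bool} {s s' : State} (h : s'.Same s)
    (hs : Sampled n K m ω s) : Sampled n K m ω s' := by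
  constructor
  · rw [h.reg]; exact hs.reg0
  · rw [h.reg]; exact hs.reg3
  · rw [h.reg]; exact hs.reg5
  · rw [h.arr]; exact hs.pow
  · rw [h.arr]; exact hs.cell
  · rw [h.arr]; exact hs.out

theorem one_le_perLevel {n K m : ℕ} (hK : 1 ≤ K) : 1 ≤ perLevel n K m :=
  Nat.one_le_two_pow.trans (le_perLevel n K m hK)

theorem tomography_sampled {n K m : ℕ} (hn : 1 ≤ n) (hK : 1 ≤ K) (ω : ℕ → Bool) :
    Sampled n K m ω (tomography.sampled n K m ω) :=
  (samplerCmd_ok hn hK le_rfl le_rfl).2.of_same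
    (exec_same ω samplerCmd (s := initial n K m) (s' := initial n K m) ⟨rfl, rfl, rfl⟩)

theorem numBases_eq {n K m : ℕ} (hn : 1 ≤ n) (hK : 1 ≤ K) (ω : ℕ → Bool) :
    tomography.numBases n K m ω = n * perLevel n K m := by
  rw [Algorithm.numBases, (tomography_sampled hn hK ω).reg3, Int.toNat_natCast]

/-- Whether qubit `q.2` of copy `q.1` is always measured in the basis `Z`. -/
def fixedZ (n R : ℕ) (q : Fin (n * R) × Fin n) : Bool := decide ((q.2 : ℕ) < (q.1 : ℕ) / R)

/-- Which random bits are used for a basis. -/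
def coinIndex (n R : ℕ) (p : (Fin (n * R) × Fin n) × Fin (n * R * n)) : ℕ :=
  n * R * n * (p.1.1 * n + p.1.2) + p.2

/-- The chosen bases. -/
def trits (n R : ℕ) (ω : ℕ → Bool) (q : Fin (n * R) × Fin n) : Fin 3 :=
  tritOf (fixedZ n R q) fun j => ω (coinIndex n R (q, j))

theorem coinIndex_injective (n R : ℕ) : Function.Injective (coinIndex n R) := by
  rintro ⟨⟨c, l⟩, j⟩ ⟨⟨c', l'⟩, j'⟩ h
  have h' : n * R * n * (c * n + l) + j = n * R * n * (c' * n + l') + j' := h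
  have hpos : 0 < n * R * n := j.pos
  have h1 := congrArg (· / (n * R * n)) h'
  have h2 := congrArg (· % (n * R * n)) h'
  simp only [Nat.mul_add_div hpos, Nat.div_eq_of_lt j.2, Nat.div_eq_of_lt j'.2, add_zero] at h1
  simp only [Nat.mul_add_mod, Nat.mod_eq_of_lt j.2, Nat.mod_eq_of_lt j'.2] at h2
  have h3 : (⟨c * n + l, cell_lt c l⟩ : Fin (n * R * n)) = ⟨c' * n + l', cell_lt c' l'⟩ :=
    Fin.ext h1
  have h4 := congrArg Fin.divNat h3
  have h5 := congrArg Fin.modNat h3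
  rw [divNat_cell, divNat_cell] at h4
  rw [modNat_cell, modNat_cell] at h5
  rw [h4, h5, Fin.ext h2]

theorem cellValue_eq {n R : ℕ} (ω : ℕ → Bool) (c : Fin (n * R)) (l : Fin n) :
    cellValue n R (n * R * n) ω (c * n + l) = ((trits n R ω (c, l) : ℕ) : ℤ) := by
  have h1 : ((c : ℕ) * n + l) % n = l := by
    rw [mul_comm, Nat.mul_add_mod, Nat.mod_eq_of_lt l.2]
  have h2 : ((c : ℕ) * n + l) / n = c := by
    rw [mul_comm, Nat.mul_add_div l.pos, Nat.div_eq_of_lt l.2, add_zero]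
  have h3 : coinValue ω (n * R * n * (c * n + l)) (n * R * n) =
      labelIndex fun j => ω (coinIndex n R ((c, l), j)) := by
    rw [coinValue, labelIndex, ← Fin.sum_univ_eq_sum_range
      (fun j => if ω (n * R * n * (c * n + l) + j) then 2 ^ j else 0)]
    rfl
  rw [cellValue, h1, h2, h3, trits, tritOf, fixedZ]
  by_cases h : (l : ℕ) < (c : ℕ) / R <;> simp [h]

section

variable {n K m : ℕ} {ω : ℕ → Bool}

theorem basis_eq (hn : 1 ≤ n) (hK : 1 ≤ K) (c : Fin (n * perLevel n K m)) :
    tomography.basis n K m ω c = fun l => pauli (trits n (perLevel n K m) ω (c, l)) := by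
  funext l
  rw [Algorithm.basis, (tomography_sampled hn hK ω).cell _ (cell_lt c l), cellValue_eq]
  rfl

/-- The observations that correspond to given bases and outcomes. -/
def observations {N n : ℕ} (τ : Fin N × Fin n → Fin 3) (o : Fin N → Fin n → Bool) (c : Fin N) :
    Observation n := (fun l => τ (c, l), o c)

/-- The data in the memory when the estimation starts. -/
def memoryData (n K m : ℕ) (s : State) : Data where
  n := n
  R := perLevel n K m
  basis := s.arr 0
  outcome := s.arr 1

theorem env_record {s : State} (hs : Sampled n K m ω s)
    (o : Fin (n * perLevel n K m) → Fin n → Bool) :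
    Env (memoryData n K m (s.record o)) (s.record o) ∧ (memoryData n K m (s.record o)).Valid := by
  refine ⟨⟨hs.reg0, hs.reg5, ?_, rfl, rfl⟩, ?_⟩
  · exact hs.pow
  · intro q
    simp only [memoryData, State.record, Function.update_self]
    split_ifs <;> simp

/-- The memory and the observations contain the same data, as far as the estimator reads them. -/
theorem amplitude_memoryData {s : State} (hs : Sampled n K m ω s)
    (o : Fin (n * perLevel n K m) → Fin n → Bool) :
    (memoryData n K m (s.record o)).amplitude n =
      (observed n (perLevel n K m)
        (observations (trits n (perLevel n K m) ω) o)).amplitude n := by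
  refine Data.amplitude_congr (D := memoryData n K m (s.record o))
    (D' := observed n (perLevel n K m) (observations (trits n (perLevel n K m) ω) o)) rfl rfl n
    le_rfl fun c _ hc l hl => ?_
  have hc' : c < n * perLevel n K m := hc
  have hl' : l < n := hl
  have h1 := observed_basis (observations (trits n (perLevel n K m) ω) o) ⟨c, hc'⟩ ⟨l, hl'⟩
  have h2 := observed_outcome (observations (trits n (perLevel n K m) ω) o) ⟨c, hc'⟩ ⟨l, hl'⟩
  have hq := cell_lt (⟨c, hc'⟩ : Fin (n * perLevel n K m)) ⟨l, hl'⟩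
  refine ⟨Eq.trans ?_ h1.symm, Eq.trans ?_ h2.symm⟩
  · have h3 := hs.cell _ hq
    rw [cellValue_eq] at h3
    have h4 : (s.record o).arr 0 = s.arr 0 := by simp [State.record]
    change (s.record o).arr 0 (c * n + l) = _
    rw [h4]; exact h3
  · change (s.record o).arr 1 (c * n + l) = _
    simp only [State.record, Function.update_self]
    have h5 := divNat_cell (⟨c, hc'⟩ : Fin (n * perLevel n K m)) ⟨l, hl'⟩
    have h6 := modNat_cell (⟨c, hc'⟩ : Fin (n * perLevel n K m)) ⟨l, hl'⟩
    rw [dif_pos hq]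
    simp only [] at h5 h6
    rw [h5, h6]; rfl

end

/-! ### Correctness -/

theorem bornProb_pauli {n : ℕ} (P : Fin n → Fin 3) (ψ : Qubits n) (o : Fin n → Bool) :
    bornProb (fun l => pauli (P l)) ψ o = ‖productAmp P o ψ‖ ^ 2 := by
  rw [bornProb, PiLp.inner_apply, productAmp]
  congr 2
  refine Finset.sum_congr rfl fun y _ => ?_
  simp [basisVector, mul_comm]

/-- The coordinates of a vector, in the order of the numbers of their labels. -/
def coordinates {n : ℕ} (ψ : Qubits n) (y : ℕ) : ℂ := ψ fun l => y.testBit l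

theorem coordinates_labelIndex {n : ℕ} (ψ : Qubits n) (x : Fin n → Bool) :
    coordinates ψ (labelIndex x) = ψ x :=
  congrArg (fun y => ψ y) (funext fun l => testBit_labelIndex x l)

theorem sum_sq_norm_eq_one {n : ℕ} {ψ : Qubits n} (hψ : ‖ψ‖ = 1) : ∑ x, ‖ψ x‖ ^ 2 = 1 := by
  rw [← EuclideanSpace.norm_sq_eq, hψ, one_pow]

/-- The fidelity of the output state in terms of the loss at the root of the tree. -/
theorem fidelity_eq {n : ℕ} {ψ : Qubits n} (hψ : ‖ψ‖ = 1) {Φ : ℕ → GaussianInt} {s : State}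
    (hs : ∀ y < 2 ^ n, s.arr 2 (2 * y) = (Φ y).re ∧ s.arr 2 (2 * y + 1) = (Φ y).im) :
    ‖inner ℂ (outputState n s) ψ‖ ^ 2 = 1 - loss n (coordinates ψ) Φ 0 0 := by
  have hw : ∀ x, outputVector n s x = (Φ (labelIndex x) : ℂ) := by
    intro x
    obtain ⟨h1, h2⟩ := hs _ (labelIndex_lt x)
    simp only [outputVector, h1, h2, GaussianInt.toComplex_def]
  have h1 : classProb n (coordinates ψ) 0 0 = 1 := by
    rw [classProb, classSum_zero, sum_range_eq_sum_label]
    simp only [coordinates_labelIndex]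
    exact sum_sq_norm_eq_one hψ
  have h2 : overlap n (coordinates ψ) Φ 0 0 = inner ℂ (outputVector n s) ψ := by
    rw [overlap, classSum_zero, sum_range_eq_sum_label, PiLp.inner_apply]
    refine Finset.sum_congr rfl fun x _ => ?_
    rw [coordinates_labelIndex, hw, RCLike.inner_apply, mul_comm]
    rfl
  have h3 : classMass n Φ 0 0 = ‖outputVector n s‖ ^ 2 := by
    rw [classMass, classSum_zero, sum_range_eq_sum_label, EuclideanSpace.norm_sq_eq]
    simp only [hw]
  rw [loss, h1, sq_norm_unitOverlap, h2, h3, outputState, inner_smul_left, norm_mul, mul_pow]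
  simp
  ring

theorem exists_nat_bound (F : ℕ → ℕ) (n : ℕ) : ∃ V, ∀ j ≤ n, F j ≤ V :=
  ⟨∑ j ∈ Finset.range (n + 1), F j, fun j hj =>
    Finset.single_le_sum (fun _ _ => Nat.zero_le _) (Finset.mem_range.2 (by omega))⟩

section

variable {n K m : ℕ}

/-- The output of the program. The bounds on its running time do not matter here, so any `V` and `T`
that are large enough for the given data will do. -/
theorem final_arr (hn : 1 ≤ n) (hK : 1 ≤ K) (ω : ℕ → Bool)
    (o : Fin (n * perLevel n K m) → Fin n → Bool) : ∀ y < 2 ^ n,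
    (estimatorCmd.exec ω ((tomography.sampled n K m ω).record o)).arr 2 (2 * y) =
      ((observed n (perLevel n K m)
        (observations (trits n (perLevel n K m) ω) o)).amplitude n y).re ∧
    (estimatorCmd.exec ω ((tomography.sampled n K m ω).record o)).arr 2 (2 * y + 1) =
      ((observed n (perLevel n K m)
        (observations (trits n (perLevel n K m) ω) o)).amplitude n y).im := by
  have hs := tomography_sampled (m := m) hn hK ω
  obtain ⟨henv, hval⟩ := env_record hs o
  set s := (tomography.sampled n K m ω).record o with hsdef
  obtain ⟨V, hV⟩ := exists_nat_bound (memoryData n K m s).bound n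
  have h2 : s.arr 2 = 0 := by
    rw [hsdef]; simp [State.record, hs.out]
  have key : Holds (memoryData n K m s) ((estimatorCmd.run ω s).arr 2)
      ((memoryData n K m s).amplitude n) :=
    (estimatorCmd_ok (ω := ω) (T := 2 * 2 ^ n + perLevel n K m) (V := V + n) henv hval
    (one_le_perLevel hK) h2 (Nat.le_add_right _ _) (Nat.le_add_left _ _)
    (fun j hj => (hV j hj).trans (Nat.le_add_right _ _)) (Nat.le_add_left _ _)).2
  rw [← (exec_same ω estimatorCmd (s := s) (s' := s) ⟨rfl, rfl, rfl⟩).arr] at key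
  have ha := amplitude_memoryData hs o
  intro y hy
  rw [← ha]
  exact key y hy

open Classical in
/-- Probability over the outcomes that some estimate is inaccurate, for given bases. -/
noncomputable def failure (n R : ℕ) (v : ℕ → ℂ) (lam : ℝ) (τ : Fin (n * R) × Fin n → Fin 3) : ℝ :=
  ∑ o : Fin (n * R) → Fin n → Bool,
    if ¬ AllAccurate (observed n R (observations τ o)) v lam then
      ∏ c, ‖productAmp (fun l => τ (c, l)) (o c) (fun x => v (labelIndex x))‖ ^ 2 else 0

theorem failure_nonneg (R : ℕ) (v : ℕ → ℂ) (lam : ℝ) (τ : Fin (n * R) × Fin n → Fin 3) :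
    0 ≤ failure n R v lam τ :=
  Finset.sum_nonneg fun o _ => by
    split_ifs
    · exact le_rfl
    · exact Finset.prod_nonneg fun c _ => sq_nonneg _

/-- Averaging over bases and outcomes one after the other is the same as averaging over the
observations. -/
theorem sum_failure (R : ℕ) (v : ℕ → ℂ) (lam : ℝ) :
    ∑ τ, (∏ q, tritWeight (fixedZ n R q) (τ q)) * failure n R v lam τ =
      prob (copyLaw n R v) fun d => ¬ AllAccurate (observed n R d) v lam := by
  classical
  unfold prob
  rw [← (Equiv.arrowProdEquivProdArrow (Fin (n * R)) (fun _ => Fin n → Fin 3)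
    fun _ => Fin n → Bool).symm.sum_comp, Fintype.sum_prod_type,
    ← (Equiv.curry (Fin (n * R)) (Fin n) (Fin 3)).sum_comp]
  refine Finset.sum_congr rfl fun τ _ => ?_
  rw [failure, Finset.mul_sum]
  refine Finset.sum_congr rfl fun o _ => ?_
  have hobs : (Equiv.arrowProdEquivProdArrow (Fin (n * R)) (fun _ => Fin n → Fin 3)
      fun _ => Fin n → Bool).symm ((Equiv.curry (Fin (n * R)) (Fin n) (Fin 3)) τ, o) =
      observations τ o := rfl
  rw [hobs]
  by_cases hacc : AllAccurate (observed n R (observations τ o)) v lam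
  · rw [if_neg (not_not.2 hacc), if_neg (not_not.2 hacc), mul_zero]
  · rw [if_pos hacc, if_pos hacc, Fintype.prod_prod_type, ← Finset.prod_mul_distrib]
    refine Finset.prod_congr rfl fun c _ => ?_
    rw [copyLaw, law, basisWeight]
    congr 1
    refine Finset.prod_congr rfl fun l _ => ?_
    simp only [tritWeight, fixedZ, prefixFlags, decide_eq_true_eq, Nat.zero_testBit, observations]

theorem successGiven_ge (hn : 1 ≤ n) (hK : 1 ≤ K) (ω : ℕ → Bool) {ψ : Qubits n} (hψ : ‖ψ‖ = 1)
    {ε : ℝ} (hε : 1 / (K : ℝ) ≤ ε) :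
    1 - failure n (perLevel n K m) (coordinates ψ) (n + m + 5) (trits n (perLevel n K m) ω) ≤
      tomography.successGiven n K m ψ ε ω := by
  classical
  set R := perLevel n K m with hR
  set τ := trits n R ω with hτ
  set lam : ℝ := n + m + 5 with hlam
  have hlam0 : 0 < lam := by positivity
  have hR1 : 1 ≤ R := one_le_perLevel hK
  have hval : tomography.successGiven n K m ψ ε ω = ∑ o : Fin (n * R) → Fin n → Bool,
      if 1 - ε ≤ ‖inner ℂ (outputState n
        (estimatorCmd.exec ω ((tomography.sampled n K m ω).record o))) ψ‖ ^ 2 then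
        ∏ i : Fin (n * R), bornProb (tomography.basis n K m ω i) ψ (o i) else 0 := by
    have h : tomography.successGiven n K m ψ ε ω =
        (fun N : ℕ => ∑ o : Fin N → Fin n → Bool,
          if 1 - ε ≤ ‖inner ℂ (outputState n
            (estimatorCmd.exec ω ((tomography.sampled n K m ω).record o))) ψ‖ ^ 2 then
            ∏ i : Fin N, bornProb (tomography.basis n K m ω i) ψ (o i) else 0)
          (tomography.numBases n K m ω) := rfl
    rw [h, numBases_eq hn hK]
  have hborn : ∀ (c : Fin (n * R)) (o : Fin n → Bool),
      bornProb (tomography.basis n K m ω c) ψ o =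
        ‖productAmp (fun l => τ (c, l)) o (fun x => coordinates ψ (labelIndex x))‖ ^ 2 := by
    intro c o
    rw [basis_eq hn hK, bornProb_pauli]
    simp only [coordinates_labelIndex]; rfl
  have hone : ∑ o : Fin (n * R) → Fin n → Bool, ∏ c, ‖productAmp (fun l => τ (c, l)) (o c)
      (fun x => coordinates ψ (labelIndex x))‖ ^ 2 = 1 := by
    rw [← Fintype.prod_sum fun (c : Fin (n * R)) (o : Fin n → Bool) =>
      ‖productAmp (fun l => τ (c, l)) o (fun x => coordinates ψ (labelIndex x))‖ ^ 2]
    refine Finset.prod_eq_one fun c _ => ?_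
    rw [sum_sq_norm_productAmp]
    simp only [coordinates_labelIndex]
    exact sum_sq_norm_eq_one hψ
  conv_lhs => rw [← hone]
  rw [hval, failure, ← Finset.sum_sub_distrib]
  refine Finset.sum_le_sum fun o _ => ?_
  simp only [hborn]
  have hprod : 0 ≤ ∏ c, ‖productAmp (fun l => τ (c, l)) (o c)
      (fun x => coordinates ψ (labelIndex x))‖ ^ 2 := Finset.prod_nonneg fun c _ => sq_nonneg _
  by_cases hacc : AllAccurate (observed n R (observations τ o)) (coordinates ψ) lam
  · have hloss := Data.loss_amplitude_le (D := observed n R (observations τ o))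
      (v := coordinates ψ) hlam0 hR1 hn hacc
    have hRK : 1536 * ((n : ℝ) + 1) ^ 3 * (2 ^ n * lam / R) = 1 / K := by
      have hK' : (K : ℝ) ≠ 0 := by exact_mod_cast (by omega : K ≠ 0)
      have : (R : ℝ) = 1536 * ((n : ℝ) + 1) ^ 3 * 2 ^ n * lam * K := by
        rw [hR, perLevel, hlam]; push_cast; ring
      rw [this]; field_simp
    have hloss' : loss n (coordinates ψ)
        ((observed n R (observations τ o)).amplitude n) 0 0 ≤ 1 / K := hRK ▸ hloss
    have hfid : 1 - ε ≤ ‖inner ℂ (outputState n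
        (estimatorCmd.exec ω ((tomography.sampled n K m ω).record o))) ψ‖ ^ 2 := by
      rw [fidelity_eq hψ (final_arr hn hK ω o)]
      linarith
    rw [if_pos hfid, if_neg (not_not.2 hacc), sub_zero]
  · rw [if_pos hacc, sub_self]
    split_ifs
    · exact hprod
    · exact le_rfl

/-- The union bound leaves a failure probability of at most `(1 / 2) ^ m / 2` for exactly uniform
bases; the near-uniform ones at most double it. -/
theorem tomography_success (hn : 1 ≤ n) (hK : 1 ≤ K) {ψ : Qubits n} (hψ : ‖ψ‖ = 1) {ε δ : ℝ}
    (hε : 1 / (K : ℝ) ≤ ε) (hδ : (1 / 2 : ℝ) ^ m ≤ δ) :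
    ENNReal.ofReal (1 - δ) ≤ tomography.successProb n K m ψ ε := by
  set R := perLevel n K m with hR
  set lam : ℝ := n + m + 5 with hlam
  have hR1 : 1 ≤ R := one_le_perLevel hK
  have hv : ∑ z : Fin n → Bool, ‖coordinates ψ (labelIndex z)‖ ^ 2 = 1 := by
    simp only [coordinates_labelIndex]; exact sum_sq_norm_eq_one hψ
  have h1 := lintegral_trits_ge (fixedZ n R) (coinIndex_injective n R)
    (failure n R (coordinates ψ) lam) (failure_nonneg R _ _)
  refine le_trans (ENNReal.ofReal_le_ofReal ?_) (h1.trans (lintegral_mono fun ω =>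
    ENNReal.ofReal_le_ofReal (successGiven_ge hn hK ω hψ hε)))
  rw [sum_failure, Fintype.card_prod, Fintype.card_fin, Fintype.card_fin]
  have h2 : (1 + 2 / (2 : ℝ) ^ (n * R * n)) ^ (n * R * n) ≤ 2 := by
    refine one_add_pow_le_two ?_
    have h3 : 4 ≤ R := by
      have : 1536 * 1 * 1 * 1 * 1 ≤ 1536 * (n + 1) ^ 3 * 2 ^ n * (n + m + 5) * K := by
        gcongr
        · exact Nat.one_le_pow _ _ (by omega)
        · exact Nat.one_le_two_pow
        · omega
      rw [hR, perLevel]; omega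
    calc 4 ≤ R := h3
      _ ≤ n * R := Nat.le_mul_of_pos_left _ hn
      _ ≤ n * R * n := Nat.le_mul_of_pos_right _ hn
  have h3 := prob_not_allAccurate_le (n := n) (v := coordinates ψ) hv hR1
    (by positivity : 0 < lam)
  have h4 : 16 * 2 ^ n * Real.exp (-lam) ≤ (1 / 2) ^ m / 2 := by
    have h5 : Real.exp (-lam) ≤ (1 / 2) ^ (n + m + 5) := by
      have e : -lam = (n + m + 5 : ℕ) * (-1 : ℝ) := by rw [hlam]; push_cast; ring
      rw [e, Real.exp_nat_mul]
      refine pow_le_pow_left₀ (Real.exp_pos _).le ?_ _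
      rw [Real.exp_neg, one_div]
      exact inv_anti₀ two_pos (by have := Real.add_one_le_exp 1; linarith)
    calc _ ≤ 16 * 2 ^ n * (1 / 2) ^ (n + m + 5) := mul_le_mul_of_nonneg_left h5 (by positivity)
      _ = _ := by
        rw [pow_add, pow_add]
        have : (2 : ℝ) ^ n * (1 / 2) ^ n = 1 := by rw [← mul_pow]; norm_num
        linear_combination (16 * (1 / 2 : ℝ) ^ m * (1 / 2) ^ 5) * this
  have h6 : 0 ≤ prob (copyLaw n R (coordinates ψ)) fun d =>
      ¬ AllAccurate (observed n R d) (coordinates ψ) lam :=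
    Finset.sum_nonneg fun d _ => by
      split_ifs
      · exact Finset.prod_nonneg fun c _ => copyLaw_nonneg _ _
      · exact le_rfl
  have h7 := mul_le_mul_of_nonneg_right h2 h6
  linarith

end

/-! ### Running time and number of copies -/

/-- The bounds grow by the rule `b ↦ Z * b ^ 5` with `Z = R * 64 ^ n`. -/
theorem Data.bound_mul_le (D : Data) (hR : 1 ≤ D.R) : ∀ h,
    D.bound h * (D.R * 64 ^ D.n) ≤ (D.R * 64 ^ D.n) ^ 5 ^ h
  | 0 => by simp [bound]
  | h + 1 => by
    have ih := bound_mul_le D hR h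
    set Z := D.R * 64 ^ D.n with hZ
    have hZ1 : 1 ≤ Z := Nat.one_le_iff_ne_zero.2 (by positivity)
    have h64 : (64 : ℕ) ^ D.n = 2 ^ D.n * 2 ^ D.n * 8 ^ D.n * 2 ^ D.n := by
      simp only [← mul_pow, Nat.reduceMul]
    have hgrowth : D.bound (h + 1) = D.bound h ^ 5 * Z := by
      rw [bound, growth, hZ, h64]; ring
    have hZ2 : Z ^ 2 ≤ Z ^ 5 := Nat.pow_le_pow_right hZ1 (by norm_num)
    calc D.bound (h + 1) * Z = D.bound h ^ 5 * Z ^ 2 := by rw [hgrowth]; ring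
      _ ≤ D.bound h ^ 5 * Z ^ 5 := Nat.mul_le_mul_left _ hZ2
      _ = (D.bound h * Z) ^ 5 := by ring
      _ ≤ (Z ^ 5 ^ h) ^ 5 := Nat.pow_le_pow_left ih 5
      _ = _ := by rw [← pow_mul, ← pow_succ]

/-- The amplitudes have exponentially many digits in the number of qubits, that is,
polynomially many in the dimension. -/
theorem Data.bound_le (D : Data) (hR : 1 ≤ D.R) {h : ℕ} (hh : h ≤ D.n) :
    D.bound h ≤ 2 ^ ((D.R + 6 * D.n) * 5 ^ D.n) := by
  have h1 := D.bound_mul_le hR h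
  have hZ1 : 1 ≤ D.R * 64 ^ D.n := Nat.one_le_iff_ne_zero.2 (by positivity)
  have hZ : D.R * 64 ^ D.n ≤ 2 ^ (D.R + 6 * D.n) := by
    rw [pow_add, pow_mul]
    exact Nat.mul_le_mul_right _ Nat.lt_two_pow_self.le
  calc D.bound h ≤ D.bound h * (D.R * 64 ^ D.n) := Nat.le_mul_of_pos_right _ hZ1
    _ ≤ (D.R * 64 ^ D.n) ^ 5 ^ h := h1
    _ ≤ (D.R * 64 ^ D.n) ^ 5 ^ D.n :=
        Nat.pow_le_pow_right hZ1 (Nat.pow_le_pow_right (by norm_num) hh)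
    _ ≤ (2 ^ (D.R + 6 * D.n)) ^ 5 ^ D.n := Nat.pow_le_pow_left hZ _
    _ = _ := by rw [← pow_mul]

/-- The quantity in terms of which the running time is polynomial. -/
def problemSize (n K m : ℕ) : ℕ := 2 ^ n * K * (m + 1)

section

variable {n K m : ℕ}

theorem le_problemSize (hK : 1 ≤ K) : n + 1 ≤ problemSize n K m ∧ 2 ^ n ≤ problemSize n K m ∧
    K ≤ problemSize n K m ∧ m ≤ problemSize n K m := by
  have h2 : 1 ≤ 2 ^ n := Nat.one_le_two_pow
  have hn : n + 1 ≤ 2 ^ n := Nat.lt_two_pow_self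
  have e : problemSize n K m = 2 ^ n * K * (m + 1) := rfl
  have h1 : 2 ^ n ≤ problemSize n K m := by
    rw [e, mul_assoc]; exact Nat.le_mul_of_pos_right _ (by positivity)
  have h3 : K ≤ problemSize n K m := by
    rw [e, mul_comm (2 ^ n) K, mul_assoc]; exact Nat.le_mul_of_pos_right _ (by positivity)
  have h4 : m + 1 ≤ problemSize n K m := by
    rw [e]; exact Nat.le_mul_of_pos_left _ (by positivity)
  exact ⟨hn.trans h1, h1, h3, by omega⟩

theorem perLevel_le (hK : 1 ≤ K) : perLevel n K m ≤ 10752 * problemSize n K m ^ 6 := by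
  obtain ⟨h1, h2, h3, h4⟩ := le_problemSize (n := n) (m := m) hK
  set Q := problemSize n K m
  calc perLevel n K m ≤ 1536 * Q ^ 3 * Q * (7 * Q) * Q := by
        unfold perLevel; gcongr; omega
    _ = _ := by ring

theorem State.Bdd.record {V N : ℕ} {s : State} (hV : 1 ≤ V) (hs : s.Bdd V)
    (o : Fin N → Fin n → Bool) : (s.record o).Bdd V := by
  refine ⟨hs.reg, fun a i => ?_⟩
  by_cases ha : a = 1
  · subst ha
    simp only [State.record, Function.update_self]
    split_ifs <;> simp [hV]
  · simp only [State.record, Function.update_of_ne ha]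
    exact hs.arr a i

theorem initial_bdd {V : ℕ} (hn : n ≤ V) (hK : K ≤ V) (hm : m ≤ V) : (initial n K m).Bdd V := by
  refine ⟨fun x => ?_, fun a i => by simp [initial]⟩
  simp only [initial]
  split_ifs <;> simp [*]

/-- A bound for the running time in terms of the size of the problem. -/
theorem time_le (hn : 1 ≤ n) (hK : 1 ≤ K) (ω : ℕ → Bool)
    (o : Fin (n * perLevel n K m) → Fin n → Bool) :
    (estimatorCmd.exec ω ((tomography.sampled n K m ω).record o)).time ≤
      (samplerCmd.length + estimatorCmd.length) *
        (21508 * problemSize n K m ^ 9) ^ (samplerCmd.depth + estimatorCmd.depth + 2) := by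
  obtain ⟨h1, h2, h3, h4⟩ := le_problemSize (n := n) (m := m) hK
  have hR := perLevel_le (n := n) (m := m) hK
  have hR1 := one_le_perLevel (n := n) (m := m) hK
  set Q := problemSize n K m with hQ
  have hQ1 : 1 ≤ Q := by omega
  have hQp : ∀ {i j : ℕ}, i ≤ j → Q ^ i ≤ Q ^ j := fun h => Nat.pow_le_pow_right hQ1 h
  have hQ9 : Q ≤ Q ^ 9 := by simpa using hQp (i := 1) (j := 9) (by norm_num)
  have hQ8 : Q ≤ Q ^ 8 := by simpa using hQp (i := 1) (j := 8) (by norm_num)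
  have hQ68 := hQp (i := 6) (j := 8) (by norm_num)
  have hQ89 := hQp (i := 8) (j := 9) (by norm_num)
  -- `T` bounds the loop counts and `E` the bit lengths; both constants are `2 * 10752 + 2`
  set T := 21506 * Q ^ 8 with hT
  set E := 21506 * Q ^ 9 with hE
  set V := 2 ^ E with hV
  have ht : n * perLevel n K m * n ≤ 10752 * Q ^ 8 := by
    calc _ ≤ Q * (10752 * Q ^ 6) * Q := by gcongr <;> omega
      _ = _ := by ring
  have hpowV : ∀ {i}, i ≤ E → 2 ^ i ≤ V := fun h => Nat.pow_le_pow_right two_pos h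
  have hleV : ∀ {i}, i ≤ E → i ≤ V := fun {i} h => Nat.lt_two_pow_self.le.trans (hpowV h)
  have hV1 : 1 ≤ V := Nat.one_le_two_pow
  have hTV : T ≤ V := hleV (by omega)
  have hsafe := (samplerCmd_ok (ω := ω) (T := T) (V := V) (m := m) hn hK (by omega)
    (hpowV (by omega))).1
  have hinit : (initial n K m).Bdd V := initial_bdd (hleV (by omega)) (hleV (by omega))
    (hleV (by omega))
  have hsame0 : (initial n K m).Same (initial n K m) := ⟨rfl, rfl, rfl⟩
  have ht1 := hsafe.time_le hV1 hTV samplerCmd hsame0 hinit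
  have hs := tomography_sampled (m := m) hn hK ω
  obtain ⟨henv, hval⟩ := env_record hs o
  have hbdd : ((tomography.sampled n K m ω).record o).Bdd V :=
    (((exec_same ω samplerCmd hsame0).bdd' (hsafe.bdd hV1 hTV samplerCmd hinit))).record hV1 o
  set s := (tomography.sampled n K m ω).record o with hsdef
  have h5 : 5 ^ n ≤ Q ^ 3 := by
    calc 5 ^ n ≤ 8 ^ n := Nat.pow_le_pow_left (by norm_num) n
      _ = (2 ^ n) ^ 3 := by rw [← pow_mul, mul_comm, pow_mul]; norm_num
      _ ≤ Q ^ 3 := Nat.pow_le_pow_left h2 3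
  have hexp : (perLevel n K m + 6 * n) * 5 ^ n ≤ E := by
    have hQ6 : Q ≤ Q ^ 6 := by simpa using hQp (i := 1) (j := 6) (by norm_num)
    calc _ ≤ (10758 * Q ^ 6) * Q ^ 3 := Nat.mul_le_mul (by omega) h5
      _ = 10758 * Q ^ 9 := by ring
      _ ≤ E := Nat.mul_le_mul_right _ (by norm_num)
  have hout : s.arr 2 = 0 := by rw [hsdef]; simp [State.record, hs.out]
  have hsafe2 := (estimatorCmd_ok (ω := ω) (T := T) (V := V) henv hval hR1 hout
    (show 2 * 2 ^ n ≤ T by omega) (show perLevel n K m ≤ T by omega)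
    (fun j hj => ((memoryData n K m s).bound_le hR1 hj).trans (hpowV hexp))
    (hleV (show n ≤ E by omega))).1
  have ht2 := hsafe2.time_le hV1 hTV estimatorCmd (s := s) ⟨rfl, rfl, rfl⟩ hbdd
  have hsize : V.size = E + 1 := Nat.size_pow
  have htime : s.time = (samplerCmd.exec ω (initial n K m)).time := rfl
  have hi : (initial n K m).time = 0 := rfl
  rw [hsize] at ht1 ht2
  rw [hi, zero_add] at ht1
  set G := 21508 * Q ^ 9 with hG
  have hG1 : 1 ≤ G := by omega
  have hTG : T + 1 ≤ G := by omega
  have hEG : E + 1 + 1 ≤ G := by omega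
  have hpiece : ∀ l d : ℕ, d ≤ samplerCmd.depth + estimatorCmd.depth →
      l * (T + 1) ^ d * (E + 1 + 1) ^ 2 ≤
        l * G ^ (samplerCmd.depth + estimatorCmd.depth + 2) := by
    intro l d hd
    calc _ ≤ l * G ^ d * G ^ 2 := by gcongr
      _ = l * G ^ (d + 2) := by rw [pow_add, mul_assoc]
      _ ≤ _ := Nat.mul_le_mul_left _ (Nat.pow_le_pow_right hG1 (by omega))
  have a1 := hpiece samplerCmd.length samplerCmd.depth (by omega)
  have a2 := hpiece estimatorCmd.length estimatorCmd.depth (by omega)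
  rw [add_mul]
  omega

end

/-! ### The parameters -/

section

variable {n : ℕ} {ε δ : ℝ}

theorem accuracyParam_bounds (h0 : 0 < ε) (h1 : ε < 1) :
    1 ≤ accuracyParam ε ∧ 1 / (accuracyParam ε : ℝ) ≤ ε ∧ (accuracyParam ε : ℝ) ≤ 2 * (1 / ε) := by
  have hinv : 1 < 1 / ε := by rw [lt_div_iff₀ h0]; linarith
  have h2 : 1 / ε ≤ accuracyParam ε := Nat.le_ceil _
  have h3 : (accuracyParam ε : ℝ) < 1 / ε + 1 := Nat.ceil_lt_add_one (by positivity)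
  refine ⟨?_, ?_, by linarith⟩
  · exact_mod_cast hinv.le.trans h2
  · rw [div_le_iff₀ (by linarith)]
    rw [div_le_iff₀ h0] at h2
    linarith

theorem half_le_log (h0 : 0 < δ) (h1 : δ < 1) : 1 ≤ 2 * Real.log (2 / δ) := by
  have h2 : Real.log 2 ≤ Real.log (2 / δ) :=
    Real.log_le_log two_pos (by rw [le_div_iff₀ h0]; linarith)
  have := Real.log_two_gt_d9
  linarith

theorem confidenceParam_bounds (h0 : 0 < δ) (h1 : δ < 1) :
    (1 / 2 : ℝ) ^ confidenceParam δ ≤ δ ∧ (confidenceParam δ : ℝ) ≤ 2 * Real.log (2 / δ) := by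
  have hinv : 1 < 1 / δ := by rw [lt_div_iff₀ h0]; linarith
  have h2 : Real.logb 2 (1 / δ) ≤ confidenceParam δ := Nat.le_ceil _
  have h3 : (confidenceParam δ : ℝ) < Real.logb 2 (1 / δ) + 1 :=
    Nat.ceil_lt_add_one (Real.logb_nonneg one_lt_two hinv.le)
  constructor
  · rw [Real.logb_le_iff_le_rpow one_lt_two (by positivity), Real.rpow_natCast,
      div_le_iff₀ h0] at h2
    rw [div_pow, one_pow, div_le_iff₀ (by positivity)]
    linarith
  · have h4 : Real.logb 2 (1 / δ) + 1 = Real.log (2 / δ) / Real.log 2 := by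
      have hlog := Real.log_pos one_lt_two
      rw [show 2 / δ = 1 / δ * 2 by ring, Real.log_mul (by positivity) two_ne_zero, add_div,
        div_self hlog.ne', Real.logb]
    rw [h4] at h3
    have hlog2 := Real.log_two_gt_d9
    have h5 : Real.log (2 / δ) / Real.log 2 ≤ 2 * Real.log (2 / δ) := by
      rw [div_le_iff₀ (by linarith)]
      have := half_le_log h0 h1
      nlinarith
    linarith

theorem numBases_le (hn : 1 ≤ n) (hε : 0 < ε) (hε1 : ε < 1) (hδ : 0 < δ) (hδ1 : δ < 1) :
    ((n * perLevel n (accuracyParam ε) (confidenceParam δ) : ℕ) : ℝ) ≤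
      344064 * copyScale 5 n ε δ := by
  obtain ⟨-, -, hK⟩ := accuracyParam_bounds hε hε1
  obtain ⟨-, hm⟩ := confidenceParam_bounds hδ hδ1
  have hL := half_le_log hδ hδ1
  set K := accuracyParam ε
  set m := confidenceParam δ
  set L := Real.log (2 / δ) with hLdef
  have hn' : (1 : ℝ) ≤ n := by exact_mod_cast hn
  have hlam : (n : ℝ) + m + 5 ≤ 14 * (n * L) := by nlinarith
  have hL0 : 0 ≤ L := by linarith
  calc ((n * perLevel n K m : ℕ) : ℝ) = n * (1536 * (n + 1) ^ 3 * 2 ^ n * (n + m + 5) * K) := by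
        rw [perLevel]; push_cast; ring
    _ ≤ n * (1536 * (2 * n) ^ 3 * 2 ^ n * (14 * (n * L)) * (2 * (1 / ε))) := by
        gcongr; linarith
    _ = 344064 * copyScale 5 n ε δ := by rw [copyScale]; ring

theorem problemSize_le (hε : 0 < ε) (hε1 : ε < 1) (hδ : 0 < δ) (hδ1 : δ < 1) :
    (problemSize n (accuracyParam ε) (confidenceParam δ) : ℝ) ≤
      8 * (2 ^ n * (1 / ε) * Real.log (2 / δ)) := by
  obtain ⟨-, -, hK⟩ := accuracyParam_bounds hε hε1
  obtain ⟨-, hm⟩ := confidenceParam_bounds hδ hδ1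
  have hL := half_le_log hδ hδ1
  rw [problemSize]
  push_cast
  calc _ ≤ 2 ^ n * (2 * (1 / ε)) * (4 * Real.log (2 / δ)) := by gcongr; linarith
    _ = _ := by ring

theorem finalTime_le (hn : 1 ≤ n) (hε : 0 < ε) (hε1 : ε < 1) (hδ : 0 < δ) (hδ1 : δ < 1)
    (ω : ℕ → Bool) {N : ℕ} (hN : N = n * perLevel n (accuracyParam ε) (confidenceParam δ))
    (o : Fin N → Fin n → Bool) :
    ((estimatorCmd.exec ω ((tomography.sampled n (accuracyParam ε) (confidenceParam δ) ω).record
        o)).time : ℝ) ≤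
      ((samplerCmd.length + estimatorCmd.length) *
        (21508 * 8 ^ 9) ^ (samplerCmd.depth + estimatorCmd.depth + 2) : ℕ) *
      (2 ^ n * (1 / ε) * Real.log (2 / δ)) ^
        (9 * (samplerCmd.depth + estimatorCmd.depth + 2)) := by
  subst hN
  have h1 := Nat.cast_le (α := ℝ).2 (time_le hn (accuracyParam_bounds hε hε1).1 ω o)
  refine h1.trans ?_
  have h2 := problemSize_le (n := n) hε hε1 hδ hδ1
  set Q := problemSize n (accuracyParam ε) (confidenceParam δ)
  set F := 2 ^ n * (1 / ε) * Real.log (2 / δ)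
  have h3 : 21508 * (Q : ℝ) ^ 9 ≤ 21508 * 8 ^ 9 * F ^ 9 := by
    calc 21508 * (Q : ℝ) ^ 9 ≤ 21508 * (8 * F) ^ 9 := by gcongr
      _ = _ := by ring
  rw [Nat.cast_mul, Nat.cast_mul, Nat.cast_pow, Nat.cast_pow, Nat.cast_mul, Nat.cast_mul,
    Nat.cast_pow, Nat.cast_pow, pow_mul, mul_assoc, ← mul_pow]
  refine mul_le_mul_of_nonneg_left (pow_le_pow_left₀ (by positivity) ?_ _) (Nat.cast_nonneg _)
  exact_mod_cast h3

end

end PauliTomography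

theorem mainTheorem1 :
    ∃ A : PauliTomography.Algorithm,
      -- copy complexity
      (∃ C a b : ℕ, ∀ (n : ℕ) (ε δ : ℝ), 1 ≤ n → 0 < ε → ε < 1 → 0 < δ → δ < 1 →
        ∀ ω : ℕ → Bool,
          (A.numBases n (PauliTomography.accuracyParam ε)
              (PauliTomography.confidenceParam δ) ω : ℝ) ≤
            C * PauliTomography.copyScale a n ε δ *
              Real.log (2 + PauliTomography.copyScale a n ε δ) ^ b) ∧
      -- running time
      (∃ C c : ℕ, ∀ (n : ℕ) (ε δ : ℝ), 1 ≤ n → 0 < ε → ε < 1 → 0 < δ → δ < 1 →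
        ∀ (ω : ℕ → Bool)
          (o : Fin (A.numBases n (PauliTomography.accuracyParam ε)
              (PauliTomography.confidenceParam δ) ω) → Fin n → Bool),
          ((A.final n (PauliTomography.accuracyParam ε)
              (PauliTomography.confidenceParam δ) ω o).time : ℝ) ≤
            C * (2 ^ n * (1 / ε) * Real.log (2 / δ)) ^ c) ∧
      -- correctness
      (∀ (n : ℕ) (ε δ : ℝ), 1 ≤ n → 0 < ε → ε < 1 → 0 < δ → δ < 1 →
        ∀ ψ : PauliTomography.Qubits n, ‖ψ‖ = 1 →
          ENNReal.ofReal (1 - δ) ≤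
            A.successProb n (PauliTomography.accuracyParam ε)
              (PauliTomography.confidenceParam δ) ψ ε) := by
  open PauliTomography in
  refine ⟨tomography, ⟨344064, 5, 0, fun n ε δ hn hε hε1 hδ hδ1 ω => ?_⟩,
    ⟨(samplerCmd.length + estimatorCmd.length) *
        (21508 * 8 ^ 9) ^ (samplerCmd.depth + estimatorCmd.depth + 2),
      9 * (samplerCmd.depth + estimatorCmd.depth + 2),
      fun n ε δ hn hε hε1 hδ hδ1 ω => ?_⟩,
    fun n ε δ hn hε hε1 hδ hδ1 ψ hψ => ?_⟩
  · rw [numBases_eq hn (accuracyParam_bounds hε hε1).1, pow_zero, mul_one]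
    exact_mod_cast numBases_le hn hε hε1 hδ hδ1
  · exact finalTime_le hn hε hε1 hδ hδ1 ω (numBases_eq hn (accuracyParam_bounds hε hε1).1 ω)
  · obtain ⟨hK, hKε, -⟩ := accuracyParam_bounds hε hε1
    exact tomography_success hn hK hψ hKε (confidenceParam_bounds hδ hδ1).1
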